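/- Let $\mathbb H,\mathbb U$ be real Hilbert spaces, let $A$ be the generator of a $C_0$-semigroup $G$ in $\mathbb H$, and let $B\in\mathcal L(\mathbb U;\mathbb H)$, $F_1=F_1^*\in\mathcal L(\mathbb H)$, $F_2\in\mathcal L(\mathbb H;\mathbb U)$, $F_3=F_3^*\in\mathcal L(\mathbb U)$ with $F_3\ge cI$ for some $c>0$. Put $$\mathcal F(v,\xi)=(F_1v,v)_{\mathbb H}+2(F_2v,\xi)_{\mathbb U}+(F_3\xi,\xi)_{\mathbb U},$$ and let $\mathcal F^{\mathbb C}(v_1+iv_2,\xi_1+i\xi_2)=\mathcal F(v_1,\xi_1)+\mathcal F(v_2,\xi_2)$ be its Hermitian extension to the complexifications $\mathbb H^{\mathbb C},\mathbb U^{\mathbb C}$ (on which operators are extended complex-linearly). Assume: 1. (Dichotomy) $G$ admits an exponential dichotomy of finite rank $j\ge 0$: there are a bounded projector $\Pi^u$ of rank $j$ commuting with all $G(t)$, $t\ge0$, and constants $\varepsilon,K>0$ such that $G(t)$ is bijective on $\operatorname{Ran}\Pi^u$, $|G(t)z|\le Ke^{-\varepsilon t}|z|$ for $z\in\operatorname{Ker}\Pi^u$,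 and $|z|\le Ke^{-\varepsilon t}|G(t)z|$ for $z\in\operatorname{Ran}\Pi^u$, for all $t\ge 0$. 2. (Frequency condition) For some $\delta>0$, $\mathcal F^{\mathbb C}(-(A-i\omega I)^{-1}B\xi,\xi)\ge\delta|\xi|^2_{\mathbb U^{\mathbb C}}$ for all $\xi\in\mathbb U^{\mathbb C}$ and $\omega\in\mathbb R$. 3. ($L_2$-controllability of $(A,B)$) For each $v_0\in\mathbb H$ the set $\mathfrak M_{v_0}$ is nonempty. Here $\mathfrak M_{v_0}$ is the set of pairs $(v,\xi)\in L_2(0,\infty;\mathbb H)\times L_2(0,\infty;\mathbb U)$ such that $v(t)=G(t)v_0+\int_0^tG(t-s)B\xi(s)\,ds$ for all $t\ge0$. Then every $i\omega$, $\omega\in\mathbb R$, belongs to the resolvent set of $A$, the number $M:=\sup_{\omega\in\mathbb R}\|(A-i\omega I)^{-1}B\|$ is finite, and for all $(v,\xi)\in\mathfrak M_0$ $$\mathcal J_{\mathcal F}(v,\xi):=\int_0^\infty\mathcal F(v(t),\xi(t))\,dt\ \ge\ \frac{\delta}{M^2+1}\Big(\|v\|^2_{L_2(0,\infty;\mathbb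 H)}+\|\xi\|^2_{L_2(0,\infty;\mathbb U)}\Big).$$ Moreover, let $\mathbb L_b^+\subset\mathbb H\times\mathbb H$ be the set of initial values $(v(0),\eta(0))$ of all bounded mild solutions on $[0,\infty)$ of the Hamiltonian system $$\dot v=Av-BF_3^{-1}F_2v+BF_3^{-1}B^*\eta,\qquad \dot\eta=-A^*\eta+(F_1-F_2^*F_3^{-1}F_2)v+(BF_3^{-1}F_2)^*\eta .$$ Here a mild solution is a pair of continuous functions $v,\eta:[0,\infty)\to\mathbb H$ satisfying, with $f$ and $g$ denoting the bounded terms of the first and second equation, $v(t)=G(t-s)v(s)+\int_s^tG(t-\theta)f(\theta)\,d\theta$ and $\eta(s)=G(t-s)^*\eta(t)-\int_s^tG(\theta-s)^*g(\theta)\,d\theta$ for all $0\le s\le t$. Then the system is nonoscillating: there is a bounded self-adjoint operator $P\in\mathcal L(\mathbb H)$ with $\mathbb L_b^+=\{(v,-Pv): v\in\mathbb H\}$. -/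

import Mathlib

set_option linter.unusedSectionVars false

open MeasureTheory Set Filter Topology
open scoped InnerProductSpace

noncomputable section

/-! ### Complexification of a real Hilbert space -/

/-- The complexification `E^ℂ` of a real inner product space `E`: the pair `(x, y)` stands for
`x + i y`, and the norm is given by `‖x + i y‖² = ‖x‖² + ‖y‖²`. -/
def Complexification (E : Type*) : Type _ := WithLp 2 (E × E)

namespace Complexification

variable {E F : Type*} [NormedAddCommGroup E] [InnerProductSpace ℝ E]
  [NormedAddCommGroup F] [InnerProductSpace ℝ F]

/-- The vector `x + i y`. -/
def mk (x y : E) : Complexification E := WithLp.toLp 2 (x, y)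

/-- The real part `x` of `x + i y`. -/
def re (z : Complexification E) : E := (WithLp.ofLp z).1

/-- The imaginary part `y` of `x + i y`. -/
def im (z : Complexification E) : E := (WithLp.ofLp z).2

instance : NormedAddCommGroup (Complexification E) :=
  inferInstanceAs (NormedAddCommGroup (WithLp 2 (E × E)))

instance [CompleteSpace E] : CompleteSpace (Complexification E) :=
  inferInstanceAs (CompleteSpace (WithLp 2 (E × E)))

@[ext] theorem ext {z w : Complexification E} (h₁ : z.re = w.re) (h₂ : z.im = w.im) : z = w :=
  WithLp.ofLp_injective 2 (Prod.ext h₁ h₂)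

@[simp] theorem re_mk (x y : E) : (mk x y).re = x := rfl
@[simp] theorem im_mk (x y : E) : (mk x y).im = y := rfl
@[simp] theorem re_add (z w : Complexification E) : (z + w).re = z.re + w.re := rfl
@[simp] theorem im_add (z w : Complexification E) : (z + w).im = z.im + w.im := rfl
@[simp] theorem re_zero : (0 : Complexification E).re = 0 := rfl
@[simp] theorem im_zero : (0 : Complexification E).im = 0 := rfl

theorem norm_sq_eq (z : Complexification E) : ‖z‖ ^ 2 = ‖z.re‖ ^ 2 + ‖z.im‖ ^ 2 :=
  WithLp.prod_norm_sq_eq_of_L2 (α := E) (β := E) z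

theorem continuous_re : Continuous (re : Complexification E → E) :=
  continuous_fst.comp (WithLp.prod_continuous_ofLp 2 E E)

theorem continuous_im : Continuous (im : Complexification E → E) :=
  continuous_snd.comp (WithLp.prod_continuous_ofLp 2 E E)

/-- `(a + i b) (x + i y) = (a x - b y) + i (a y + b x)`. -/
instance : SMul ℂ (Complexification E) :=
  ⟨fun c z => mk (c.re • z.re - c.im • z.im) (c.re • z.im + c.im • z.re)⟩

@[simp] theorem re_smul (c : ℂ) (z : Complexification E) :
    (c • z).re = c.re • z.re - c.im • z.im := rfl
@[simp] theorem im_smul (c : ℂ) (z : Complexification E) :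
    (c • z).im = c.re • z.im + c.im • z.re := rfl

instance : Module ℂ (Complexification E) where
  one_smul z := by ext <;> simp
  mul_smul a b z := by
    ext <;> simp only [re_smul, im_smul, Complex.mul_re, Complex.mul_im] <;> module
  smul_zero a := by ext <;> simp
  smul_add a z w := by
    ext <;> simp only [re_smul, im_smul, re_add, im_add] <;> module
  add_smul a b z := by
    ext <;> simp only [re_smul, im_smul, re_add, im_add, Complex.add_re, Complex.add_im] <;> module
  zero_smul z := by ext <;> simp

/-- The Hermitian inner product extending that of `E`, conjugate-linear in the first argument. -/
instance : Inner ℂ (Complexification E) :=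
  ⟨fun z w => ⟨⟪z.re, w.re⟫_ℝ + ⟪z.im, w.im⟫_ℝ, ⟪z.re, w.im⟫_ℝ - ⟪z.im, w.re⟫_ℝ⟩⟩

theorem inner_def (z w : Complexification E) :
    ⟪z, w⟫_ℂ = ⟨⟪z.re, w.re⟫_ℝ + ⟪z.im, w.im⟫_ℝ, ⟪z.re, w.im⟫_ℝ - ⟪z.im, w.re⟫_ℝ⟩ := rfl

instance : NormedSpace ℂ (Complexification E) where
  norm_smul_le c z := by
    refine abs_le_of_sq_le_sq' ?_ (by positivity) |>.2
    rw [mul_pow, norm_sq_eq, norm_sq_eq, re_smul, im_smul, norm_sub_sq_real, norm_add_sq_real,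
      Complex.sq_norm, Complex.normSq_apply]
    simp only [norm_smul, inner_smul_left, inner_smul_right, mul_pow, Real.norm_eq_abs, sq_abs,
      real_inner_comm z.re z.im, conj_trivial]
    apply le_of_eq
    ring

instance : InnerProductSpace ℂ (Complexification E) where
  norm_sq_eq_re_inner z := by
    rw [norm_sq_eq, inner_def]
    simp
  conj_inner_symm z w := by
    rw [inner_def, inner_def]
    apply Complex.ext <;> simp [real_inner_comm]
  add_left z w u := by
    simp only [inner_def]
    apply Complex.ext <;> simp [inner_add_left] <;> ring
  smul_left z w c := by
    simp only [inner_def]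
    apply Complex.ext <;>
      simp [inner_add_left, inner_sub_left, inner_smul_left] <;> ring

end Complexification

section Complexify

open Complexification

variable {E F : Type*} [NormedAddCommGroup E] [InnerProductSpace ℝ E]
  [NormedAddCommGroup F] [InnerProductSpace ℝ F]

/-- The complexification `T^ℂ (x + i y) = T x + i T y` of a bounded operator. -/
def ContinuousLinearMap.complexify (T : E →L[ℝ] F) :
    Complexification E →L[ℂ] Complexification F where
  toFun z := Complexification.mk (T z.re) (T z.im)
  map_add' z w := by ext <;> simp
  map_smul' c z := by ext <;> simp
  cont := (WithLp.prod_continuous_toLp 2 F F).comp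
    ((T.continuous.comp continuous_re).prodMk (T.continuous.comp continuous_im))

/-- The complexification of an unbounded operator `A`: its domain consists of all `x + i y` with
`x, y ∈ D(A)`, and `A^ℂ (x + i y) = A x + i A y`. -/
def LinearPMap.complexify (A : E →ₗ.[ℝ] F) : Complexification E →ₗ.[ℂ] Complexification F where
  domain :=
    { carrier := {z | z.re ∈ A.domain ∧ z.im ∈ A.domain}
      add_mem' := fun hz hw => ⟨A.domain.add_mem hz.1 hw.1, A.domain.add_mem hz.2 hw.2⟩
      zero_mem' := ⟨A.domain.zero_mem, A.domain.zero_mem⟩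
      smul_mem' := fun c _ hz =>
        ⟨A.domain.sub_mem (A.domain.smul_mem _ hz.1) (A.domain.smul_mem _ hz.2),
          A.domain.add_mem (A.domain.smul_mem _ hz.2) (A.domain.smul_mem _ hz.1)⟩ }
  toFun :=
    { toFun := fun z => Complexification.mk (A ⟨z.1.re, z.2.1⟩) (A ⟨z.1.im, z.2.2⟩)
      map_add' := fun z w => by
        ext
        · exact A.map_add ⟨z.1.re, z.2.1⟩ ⟨w.1.re, w.2.1⟩
        · exact A.map_add ⟨z.1.im, z.2.2⟩ ⟨w.1.im, w.2.2⟩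
      map_smul' := fun c z => by
        ext
        · exact (A.map_sub (c.re • ⟨z.1.re, z.2.1⟩) (c.im • ⟨z.1.im, z.2.2⟩)).trans
            (by rw [A.map_smul, A.map_smul])
        · exact (A.map_add (c.re • ⟨z.1.im, z.2.2⟩) (c.im • ⟨z.1.re, z.2.1⟩)).trans
            (by rw [A.map_smul, A.map_smul]) }

end Complexify

/-! ### Resolvent of an unbounded operator -/

/-- `R` is a bounded two-sided inverse of `A - p I : D(A) → X`. -/
def LinearPMap.IsResolventAt {X : Type*} [NormedAddCommGroup X] [NormedSpace ℂ X]
    (A : X →ₗ.[ℂ] X) (p : ℂ) (R : X →L[ℂ] X) : Prop :=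
  (∀ w : X, ∃ h : R w ∈ A.domain, A ⟨R w, h⟩ - p • R w = w) ∧
    ∀ v : A.domain, R (A v - p • (v : X)) = v

open Classical in
/-- The resolvent `(A - p I)⁻¹`; by convention it is `0` if `p` is not in the resolvent set. -/
def LinearPMap.resolventAt {X : Type*} [NormedAddCommGroup X] [NormedSpace ℂ X]
    (A : X →ₗ.[ℂ] X) (p : ℂ) : X →L[ℂ] X :=
  if h : ∃ R, A.IsResolventAt p R then h.choose else 0

/-! ### Strongly continuous semigroups -/

/-- A `C₀`-semigroup `G(t)`, `t ≥ 0`, of bounded operators in `H`. The values of `G` at negative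
times carry no information. -/
structure C0Semigroup (H : Type*) [NormedAddCommGroup H] [InnerProductSpace ℝ H] where
  /-- The operator `G(t)`. -/
  op : ℝ → H →L[ℝ] H
  op_zero : op 0 = ContinuousLinearMap.id ℝ H
  op_add : ∀ s t : ℝ, 0 ≤ s → 0 ≤ t → op (s + t) = (op s).comp (op t)
  continuousOn : ∀ x : H, ContinuousOn (fun t => op t x) (Ici 0)

namespace C0Semigroup

variable {H U : Type*} [NormedAddCommGroup H] [InnerProductSpace ℝ H]
  [NormedAddCommGroup U] [InnerProductSpace ℝ U]

/-- `y` is the right derivative of `t ↦ G(t) x` at `t = 0`. -/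
def HasGeneratorAt (G : C0Semigroup H) (x y : H) : Prop :=
  Tendsto (fun t : ℝ => t⁻¹ • (G.op t x - x)) (𝓝[>] 0) (𝓝 y)

theorem HasGeneratorAt.add {G : C0Semigroup H} {x y x' y' : H} (h : G.HasGeneratorAt x y)
    (h' : G.HasGeneratorAt x' y') : G.HasGeneratorAt (x + x') (y + y') := by
  refine (Tendsto.add h h').congr fun t => ?_
  rw [map_add, ← smul_add]
  congr 1
  abel

theorem HasGeneratorAt.smul {G : C0Semigroup H} {x y : H} (c : ℝ) (h : G.HasGeneratorAt x y) :
    G.HasGeneratorAt (c • x) (c • y) := by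
  refine (Tendsto.const_smul h c).congr fun t => ?_
  rw [map_smul, ← smul_sub, smul_comm]

theorem HasGeneratorAt.zero (G : C0Semigroup H) : G.HasGeneratorAt 0 0 :=
  tendsto_const_nhds.congr fun t => by simp

/-- The (infinitesimal) generator `A` of `G`: `A x = lim_{t → 0+} (G(t) x - x) / t`, the domain
`D(A)` consisting of all `x` for which the limit exists. -/
def generator (G : C0Semigroup H) : H →ₗ.[ℝ] H where
  domain :=
    { carrier := {x | ∃ y, G.HasGeneratorAt x y}
      add_mem' := fun ⟨_, h⟩ ⟨_, h'⟩ => ⟨_, h.add h'⟩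
      zero_mem' := ⟨0, HasGeneratorAt.zero G⟩
      smul_mem' := fun c _ ⟨_, h⟩ => ⟨_, h.smul c⟩ }
  toFun :=
    { toFun := fun x => x.2.choose
      map_add' := fun x x' => tendsto_nhds_unique (x + x').2.choose_spec
        (x.2.choose_spec.add x'.2.choose_spec)
      map_smul' := fun c x => tendsto_nhds_unique (c • x).2.choose_spec
        (x.2.choose_spec.smul c) }

/-- `G` admits an exponential dichotomy of finite rank `j`: there is a bounded projector `Q`
of rank `j` commuting with the semigroup such that, with constants `ε, K > 0`, the semigroup decays
as `K e^{-ε t}` on the stable subspace `Ker Q`, is invertible on the unstable subspace `Ran Q`,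
and its inverse there decays as `K e^{-ε t}` too. -/
def HasExponentialDichotomy (G : C0Semigroup H) (j : ℕ) : Prop :=
  ∃ Q : H →L[ℝ] H, Q.comp Q = Q ∧
    FiniteDimensional ℝ Q.range ∧ Module.finrank ℝ Q.range = j ∧
    (∀ t, 0 ≤ t → Q.comp (G.op t) = (G.op t).comp Q) ∧
    (∀ t, 0 ≤ t → BijOn (G.op t) Q.range Q.range) ∧
    ∃ ε K : ℝ, 0 < ε ∧ 0 < K ∧
      (∀ t, 0 ≤ t → ∀ z, Q z = 0 → ‖G.op t z‖ ≤ K * Real.exp (-ε * t) * ‖z‖) ∧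
      (∀ t, 0 ≤ t → ∀ z ∈ Q.range, ‖z‖ ≤ K * Real.exp (-ε * t) * ‖G.op t z‖)

/-- The transfer operator `(A - i ω I)⁻¹ B : U^ℂ → H^ℂ`, where `A` is the generator of `G`. -/
def transfer (G : C0Semigroup H) (B : U →L[ℝ] H) (ω : ℝ) :
    Complexification U →L[ℂ] Complexification H :=
  (G.generator.complexify.resolventAt (Complex.I * ω)).comp B.complexify

/-- `v` is the mild solution on `[0, ∞)` of `v' = A v + B ξ`, `v(0) = v₀`, with `v` and `ξ` both
square-integrable on `(0, ∞)`; that is, `(v, ξ)` is a process through `v₀`. -/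
def IsAdmissiblePair (G : C0Semigroup H) (B : U →L[ℝ] H) (v₀ : H) (v : ℝ → H) (ξ : ℝ → U) : Prop :=
  MemLp v 2 (volume.restrict (Ioi 0)) ∧ MemLp ξ 2 (volume.restrict (Ioi 0)) ∧
    ∀ t, 0 ≤ t → v t = G.op t v₀ + ∫ s in (0 : ℝ)..t, G.op (t - s) (B (ξ s))

/-- The pair `(A, B)` is `L₂`-controllable. -/
def L2Controllable (G : C0Semigroup H) (B : U →L[ℝ] H) : Prop :=
  ∀ v₀ : H, ∃ (v : ℝ → H) (ξ : ℝ → U), G.IsAdmissiblePair B v₀ v ξ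

end C0Semigroup

/-! ### Quadratic forms -/

section Forms

variable {H U : Type*} [NormedAddCommGroup H] [InnerProductSpace ℝ H]
  [NormedAddCommGroup U] [InnerProductSpace ℝ U]

/-- `𝓕(v, ξ) = (F₁ v, v) + 2 (F₂ v, ξ) + (F₃ ξ, ξ)`. -/
def quadForm (F₁ : H →L[ℝ] H) (F₂ : H →L[ℝ] U) (F₃ : U →L[ℝ] U) (v : H) (ξ : U) : ℝ :=
  ⟪F₁ v, v⟫_ℝ + 2 * ⟪F₂ v, ξ⟫_ℝ + ⟪F₃ ξ, ξ⟫_ℝ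

/-- The Hermitian extension of `𝓕` to the complexifications,
`𝓕^ℂ(v₁ + i v₂, ξ₁ + i ξ₂) = 𝓕(v₁, ξ₁) + 𝓕(v₂, ξ₂)`. -/
def quadFormC (F₁ : H →L[ℝ] H) (F₂ : H →L[ℝ] U) (F₃ : U →L[ℝ] U)
    (v : Complexification H) (ξ : Complexification U) : ℝ :=
  quadForm F₁ F₂ F₃ v.re ξ.re + quadForm F₁ F₂ F₃ v.im ξ.im

/-- The frequency condition
`𝓕^ℂ(-(A - i ω I)⁻¹ B ξ, ξ) ≥ δ |ξ|²` for all `ξ ∈ U^ℂ` and `ω ∈ ℝ`. -/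
def FrequencyCondition (G : C0Semigroup H) (B : U →L[ℝ] H)
    (F₁ : H →L[ℝ] H) (F₂ : H →L[ℝ] U) (F₃ : U →L[ℝ] U) (δ : ℝ) : Prop :=
  ∀ (ω : ℝ) (ξ : Complexification U),
    δ * ‖ξ‖ ^ 2 ≤ quadFormC F₁ F₂ F₃ (-(G.transfer B ω ξ)) ξ

/-- The integral quadratic functional `∫₀^∞ 𝓕(v(t), ξ(t)) dt`. -/
def integralFunctional (F₁ : H →L[ℝ] H) (F₂ : H →L[ℝ] U) (F₃ : U →L[ℝ] U)
    (v : ℝ → H) (ξ : ℝ → U) : ℝ :=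
  ∫ t in Ioi (0 : ℝ), quadForm F₁ F₂ F₃ (v t) (ξ t)

end Forms

/-! ### The Hamiltonian system -/

section Hamiltonian

variable {H U : Type*} [NormedAddCommGroup H] [InnerProductSpace ℝ H] [CompleteSpace H]
  [NormedAddCommGroup U] [InnerProductSpace ℝ U] [CompleteSpace U]

/-- The `v`-component `-B F₃⁻¹ F₂ v + B F₃⁻¹ B* η` of the bounded part of the Hamiltonian system. -/
def hamV (B : U →L[ℝ] H) (F₂ : H →L[ℝ] U) (F₃ : U →L[ℝ] U) (v η : H) : H :=
  -(B (F₃.inverse (F₂ v))) + B (F₃.inverse (B.adjoint η))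

/-- The `η`-component `(F₁ - F₂* F₃⁻¹ F₂) v + (B F₃⁻¹ F₂)* η` of the bounded part. -/
def hamEta (B : U →L[ℝ] H) (F₁ : H →L[ℝ] H) (F₂ : H →L[ℝ] U) (F₃ : U →L[ℝ] U) (v η : H) : H :=
  (F₁ v - F₂.adjoint (F₃.inverse (F₂ v))) + (B.comp (F₃.inverse.comp F₂)).adjoint η

/-- `(v, η)` is a (continuous) mild solution on `[0, ∞)` of the Hamiltonian system
`v' = A v - B F₃⁻¹ F₂ v + B F₃⁻¹ B* η`,
`η' = -A* η + (F₁ - F₂* F₃⁻¹ F₂) v + (B F₃⁻¹ F₂)* η`.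
Both equations are understood through the Cauchy formula; the second one, whose linear part `-A*`
generates the semigroup `G(t)*` in reversed time, is solved backwards in time. -/
def IsHamiltonianSolution (G : C0Semigroup H) (B : U →L[ℝ] H)
    (F₁ : H →L[ℝ] H) (F₂ : H →L[ℝ] U) (F₃ : U →L[ℝ] U) (v η : ℝ → H) : Prop :=
  ContinuousOn v (Ici 0) ∧ ContinuousOn η (Ici 0) ∧
    ∀ s t, 0 ≤ s → s ≤ t →
      v t = G.op (t - s) (v s) + ∫ θ in s..t, G.op (t - θ) (hamV B F₂ F₃ (v θ) (η θ)) ∧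
      η s = (G.op (t - s)).adjoint (η t) -
        ∫ θ in s..t, (G.op (θ - s)).adjoint (hamEta B F₁ F₂ F₃ (v θ) (η θ))

/-- `𝕃_b^+`: the set of all initial values `z₀ = (v(0), η(0))` of bounded solutions on `[0, ∞)` of
the Hamiltonian system. -/
def boundedSubspace (G : C0Semigroup H) (B : U →L[ℝ] H)
    (F₁ : H →L[ℝ] H) (F₂ : H →L[ℝ] U) (F₃ : U →L[ℝ] U) : Set (H × H) :=
  {z₀ | ∃ v η : ℝ → H, IsHamiltonianSolution G B F₁ F₂ F₃ v η ∧ (v 0, η 0) = z₀ ∧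
    ∃ C : ℝ, ∀ t, 0 ≤ t → ‖v t‖ ≤ C ∧ ‖η t‖ ≤ C}

/-- The nonoscillation condition: `𝕃_b^+ = {(v, -P v)}` for a bounded self-adjoint `P`. -/
def Nonoscillating (G : C0Semigroup H) (B : U →L[ℝ] H)
    (F₁ : H →L[ℝ] H) (F₂ : H →L[ℝ] U) (F₃ : U →L[ℝ] U) : Prop :=
  ∃ P : H →L[ℝ] H, IsSelfAdjoint P ∧
    boundedSubspace G B F₁ F₂ F₃ = {z | ∃ v : H, z = (v, -(P v))}

end Hamiltonian

end

/-! On the Fourier side a process through the origin satisfies `v̂ = -(A - iω)⁻¹ B ξ̂`, so by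
Plancherel the frequency condition says that the functional is at least `δ‖ξ‖²`. Since also `‖v‖ ≤
M‖ξ‖`, one has `δ‖ξ‖² ≥ δ/(M² + 1) (‖v‖² + ‖ξ‖²)`. The imaginary axis lies in the resolvent set
because, for one large `t`, the operator `e^{-iωt}G(t) - I` is invertible with a bound independent
of `ω`: it is a perturbation of `-I` on the stable subspace and an injective map on the
finite-dimensional unstable one. The resolvent is then `∫₀ᵗ e^{-iωs}G(s) ds` composed with that
inverse (`exists_isResolventAt_of_bijective`). To have Fourier integrals, processes are damped by
`e^{-εt}`. The transform relation then acquires an error `ε R v̂`, and `ε → 0` gives the sharp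
constant (`FrequencyCondition.le_integralFunctional`).

Coercivity on the processes through 0 makes the affine variational problem solvable for every
initial value. Lax–Milgram and the open mapping theorem give a bounded operator `D` sending `x` to
the unique stationary process through `x`, and `P = D* 𝓐 D`, with `𝓐` the operator of the
functional, represents the polar form on stationary processes (`exists_optimal_value_operator`).
Cutting processes at a finite time turns this into the dynamic programming identity. Tested with
uncontrolled trajectories it says that `η = -Pv` solves the adjoint equation; tested with a constant
control started at 0 over a short interval it gives `F₂v + F₃ξ = B*η` almost everywhere. Hence `(v,
-Pv)` solves the Hamiltonian system, and it is bounded because `v → 0`.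

Conversely, subtracting this solution from a bounded one leaves a bounded solution with `v(0) = 0`.
The energy identity `d/dt (v, η) = 𝓕(v, ξ)` together with coercivity shows that it is
square-integrable, so its functional is the limit of `(v(T), η(T))`, which is 0. Thus `v = 0` and `ξ
= 0`, whence `B*η = 0` and `η(s) = G(t-s)*η(t)`. Such an `η` has constant pairing with every
process; since processes from arbitrary initial values decay to 0, `η(0) = 0`
(`costate_zero_of_bounded`). -/

/-! ### Mild solutions -/

/-- Square-integrable functions on the half-line are integrable on bounded intervals. -/
theorem MeasureTheory.MemLp.intervalIntegrable_of_Ioi {E : Type*} [NormedAddCommGroup E]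
    {f : ℝ → E} (hf : MemLp f 2 (volume.restrict (Ioi 0))) {a b : ℝ} (ha : 0 ≤ a) (hb : 0 ≤ b) :
    IntervalIntegrable f volume a b := by
  have key : ∀ a b : ℝ, 0 ≤ a → IntegrableOn f (Ioc a b) := fun a b ha => by
    have h : MemLp f 2 (volume.restrict (Ioc a b)) :=
      hf.mono_measure (Measure.restrict_mono (fun x hx => ha.trans_lt hx.1) le_rfl)
    exact h.integrable one_le_two
  exact ⟨key a b ha, key b a hb⟩

theorem MeasureTheory.MemLp.integrableOn_norm_sq_Ioi {E : Type*} [NormedAddCommGroup E]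
    {f : ℝ → E} (hf : MemLp f 2 (volume.restrict (Ioi 0))) :
    IntegrableOn (fun t => ‖f t‖ ^ 2) (Ioi 0) :=
  (memLp_two_iff_integrable_sq_norm hf.1).1 hf

theorem IntegrableOn.intervalIntegrable_of_Ioi {E : Type*} [NormedAddCommGroup E]
    {f : ℝ → E} (hf : IntegrableOn f (Ioi 0)) {a b : ℝ} (ha : 0 ≤ a) (hb : 0 ≤ b) :
    IntervalIntegrable f volume a b :=
  ⟨hf.mono_set fun _ hx => ha.trans_lt hx.1, hf.mono_set fun _ hx => hb.trans_lt hx.1⟩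

theorem tendsto_integral_unit_interval_atTop {φ : ℝ → ℝ} (hφ : IntegrableOn φ (Ioi 0)) :
    Tendsto (fun t => ∫ s in (t - 1)..t, φ s) atTop (𝓝 0) := by
  have h1 := intervalIntegral_tendsto_integral_Ioi 0 hφ tendsto_id
  have h2 := intervalIntegral_tendsto_integral_Ioi 0 hφ (tendsto_atTop_add_const_right _ (-1) tendsto_id)
  have h3 := h1.sub h2
  rw [sub_self] at h3
  refine h3.congr' ?_
  filter_upwards [eventually_ge_atTop 1] with t ht
  simp only [id]
  rw [intervalIntegral.integral_interval_sub_left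
    (IntegrableOn.intervalIntegrable_of_Ioi hφ le_rfl (by linarith))
    (IntegrableOn.intervalIntegrable_of_Ioi hφ le_rfl (by linarith))]
  rfl

/-- Cauchy–Schwarz against the constant 1, read off from the nonnegative integral of `((b - a) * g s
- c) ^ 2`. -/
theorem sq_intervalIntegral_le {g : ℝ → ℝ} {a b : ℝ} (hab : a ≤ b)
    (h1 : IntervalIntegrable g volume a b) (h2 : IntervalIntegrable (fun s => g s ^ 2) volume a b) :
    (∫ s in a..b, g s) ^ 2 ≤ (b - a) * ∫ s in a..b, g s ^ 2 := by
  rcases hab.eq_or_lt with rfl | hlt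
  · simp
  set c := ∫ s in a..b, g s with hc
  have h0 : 0 ≤ ∫ s in a..b, ((b - a) * g s - c) ^ 2 :=
    intervalIntegral.integral_nonneg hab fun s _ => sq_nonneg _
  have h3 : ∫ s in a..b, ((b - a) * g s - c) ^ 2 =
      (b - a) * ((b - a) * (∫ s in a..b, g s ^ 2) - c ^ 2) := by
    have e : ∀ s, ((b - a) * g s - c) ^ 2 =
      (b - a) ^ 2 * g s ^ 2 - 2 * (b - a) * c * g s + c ^ 2 := fun s => by ring
    simp_rw [e]
    rw [intervalIntegral.integral_add ((h2.const_mul _).sub (h1.const_mul _)) (by simp),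
      intervalIntegral.integral_sub (h2.const_mul _) (h1.const_mul _),
      intervalIntegral.integral_const_mul, intervalIntegral.integral_const_mul, ← hc]
    simp only [intervalIntegral.integral_const, smul_eq_mul]
    ring
  rw [h3] at h0
  linarith [nonneg_of_mul_nonneg_right h0 (sub_pos.2 hlt)]

theorem tendsto_integral_norm_unit_interval_atTop {E : Type*} [NormedAddCommGroup E]
    {f : ℝ → E} (hf : MemLp f 2 (volume.restrict (Ioi 0))) :
    Tendsto (fun t => ∫ s in (t - 1)..t, ‖f s‖) atTop (𝓝 0) := by
  have h := tendsto_integral_unit_interval_atTop hf.integrableOn_norm_sq_Ioi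
  have h2 : Tendsto (fun t => (∫ s in (t - 1)..t, ‖f s‖) ^ 2) atTop (𝓝 0) := by
    refine tendsto_of_tendsto_of_tendsto_of_le_of_le' tendsto_const_nhds h
      (Eventually.of_forall fun t => sq_nonneg _) ?_
    filter_upwards [eventually_ge_atTop 1] with t ht
    refine (sq_intervalIntegral_le (by linarith)
      (hf.norm.intervalIntegrable_of_Ioi (by linarith) (by linarith)) (IntegrableOn.intervalIntegrable_of_Ioi hf.integrableOn_norm_sq_Ioi
        (by linarith) (by linarith))).trans_eq (by ring)
  have h3 := h2.sqrt
  simp only [Real.sqrt_zero, Real.sqrt_sq_eq_abs] at h3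
  exact tendsto_zero_iff_abs_tendsto_zero _ |>.2 h3

namespace C0Semigroup

variable {H : Type*} [NormedAddCommGroup H] [InnerProductSpace ℝ H]

theorem op_zero_apply (G : C0Semigroup H) (x : H) : G.op 0 x = x := by simp [G.op_zero]

theorem op_add_apply (G : C0Semigroup H) {s t : ℝ} (hs : 0 ≤ s) (ht : 0 ≤ t) (x : H) :
    G.op (s + t) x = G.op s (G.op t x) := by rw [G.op_add s t hs ht]; rfl

/-- Truncating time at 0 replaces the meaningless values of `G` at negative times and gives a
function continuous on the whole line, to which the usual measurability and integration results
apply. -/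
theorem continuous_op_max (G : C0Semigroup H) (x : H) : Continuous fun t => G.op (max t 0) x :=
  (G.continuousOn x).comp_continuous (by fun_prop) fun t => le_max_right t 0

/-- The value at `t` of the mild solution of `v' = A v + f`, `v(0) = x`. -/
noncomputable def mild (G : C0Semigroup H) (x : H) (f : ℝ → H) (t : ℝ) : H :=
  G.op t x + ∫ s in (0 : ℝ)..t, G.op (t - s) (f s)

theorem mild_zero (G : C0Semigroup H) (x : H) (f : ℝ → H) : G.mild x f 0 = x := by
  simp [mild, G.op_zero]

variable [CompleteSpace H]

theorem exists_norm_op_le (G : C0Semigroup H) (T : ℝ) :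
    ∃ M : ℝ, 1 ≤ M ∧ ∀ t, 0 ≤ t → t ≤ T → ‖G.op t‖ ≤ M := by
  obtain ⟨C, hC⟩ := banach_steinhaus (g := fun t : Icc 0 T => G.op t) fun x => by
    obtain ⟨C, hC⟩ := isCompact_Icc.exists_bound_of_continuousOn
      ((G.continuousOn x).mono (Icc_subset_Ici_self : Icc 0 T ⊆ Ici 0))
    exact ⟨C, fun t => hC t t.2⟩
  exact ⟨max 1 C, le_max_left _ _, fun t h0 hT => (hC ⟨t, h0, hT⟩).trans (le_max_right _ _)⟩

/-- Strong continuity and the local uniform bound combine to joint continuity. This makes `s ↦ G(t -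
s) f(s)` measurable for `f` merely strongly measurable. -/
theorem continuous_op_max_uncurry (G : C0Semigroup H) :
    Continuous fun p : ℝ × H => G.op (max p.1 0) p.2 := by
  rw [continuous_iff_continuousAt]
  rintro ⟨t₀, x₀⟩
  obtain ⟨M, hM1, hM⟩ := G.exists_norm_op_le (max (t₀ + 1) 0)
  have e : (fun p : ℝ × H => G.op (max p.1 0) p.2) =
      fun p => G.op (max p.1 0) (p.2 - x₀) + G.op (max p.1 0) x₀ := by
    ext p; simp
  rw [ContinuousAt, e]
  have h2 : Tendsto (fun p : ℝ × H => G.op (max p.1 0) x₀) (𝓝 (t₀, x₀)) (𝓝 (G.op (max t₀ 0) x₀)) :=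
    ((G.continuous_op_max x₀).comp continuous_fst).tendsto (t₀, x₀)
  have h1 : Tendsto (fun p : ℝ × H => G.op (max p.1 0) (p.2 - x₀)) (𝓝 (t₀, x₀)) (𝓝 0) := by
    have h3 : Tendsto (fun p : ℝ × H => M * ‖p.2 - x₀‖) (𝓝 (t₀, x₀)) (𝓝 0) := by
      have : Continuous fun p : ℝ × H => M * ‖p.2 - x₀‖ := by fun_prop
      simpa using this.tendsto (t₀, x₀)
    refine squeeze_zero_norm' ?_ h3
    have : ∀ᶠ p : ℝ × H in 𝓝 (t₀, x₀), p.1 < t₀ + 1 :=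
      continuous_fst.continuousAt.eventually_lt continuousAt_const (by simp)
    filter_upwards [this] with p hp
    exact (G.op _).le_of_opNorm_le (hM _ (le_max_right _ _) (max_le_max_right _ hp.le)) _
  simpa using h1.add h2

theorem aestronglyMeasurable_op (G : C0Semigroup H) {μ : Measure ℝ} {f : ℝ → H}
    (hf : AEStronglyMeasurable f μ) (φ : ℝ → ℝ) (hφ : Continuous φ) :
    AEStronglyMeasurable (fun s => G.op (max (φ s) 0) (f s)) μ :=
  G.continuous_op_max_uncurry.comp_aestronglyMeasurable
    (hφ.aestronglyMeasurable.prodMk hf)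

theorem intervalIntegrable_op (G : C0Semigroup H) {f : ℝ → H} {a b t : ℝ} (hab : a ≤ b) (hbt : b ≤ t)
    (hf : IntervalIntegrable f volume a b) :
    IntervalIntegrable (fun s => G.op (t - s) (f s)) volume a b := by
  obtain ⟨M, -, hM⟩ := G.exists_norm_op_le (t - a)
  rw [intervalIntegrable_iff_integrableOn_Ioc_of_le hab] at hf ⊢
  refine Integrable.mono' (hf.norm.const_mul M) ?_ ?_
  · refine (G.aestronglyMeasurable_op hf.1 (fun s => t - s) (by fun_prop)).congr ?_
    filter_upwards [self_mem_ae_restrict measurableSet_Ioc] with s hs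
    rw [max_eq_left]
    linarith [hs.2]
  · filter_upwards [self_mem_ae_restrict measurableSet_Ioc] with s hs
    exact (G.op _).le_of_opNorm_le (hM _ (by linarith [hs.2]) (by linarith [hs.1])) _

theorem norm_integral_op_le (G : C0Semigroup H) {f : ℝ → H} {a t M : ℝ} (hat : a ≤ t)
    (hM : ∀ r, 0 ≤ r → r ≤ t - a → ‖G.op r‖ ≤ M) (hf : IntervalIntegrable f volume a t) :
    ‖∫ s in a..t, G.op (t - s) (f s)‖ ≤ M * ∫ s in a..t, ‖f s‖ := by
  rw [← intervalIntegral.integral_const_mul]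
  refine intervalIntegral.norm_integral_le_of_norm_le hat ?_ (hf.norm.const_mul M)
  refine Eventually.of_forall fun s hs => ?_
  exact (G.op _).le_of_opNorm_le (hM _ (by linarith [hs.2]) (by linarith [hs.1])) _

theorem op_mild (G : C0Semigroup H) (x : H) {f : ℝ → H} {s t : ℝ} (hs : 0 ≤ s) (hst : s ≤ t)
    (hf : IntervalIntegrable f volume 0 t) :
    G.mild x f t = G.op (t - s) (G.mild x f s) + ∫ θ in s..t, G.op (t - θ) (f θ) := by
  have hf1 : IntervalIntegrable f volume 0 s :=
    hf.mono_set (by rw [uIcc_of_le hs, uIcc_of_le (hs.trans hst)]; exact Icc_subset_Icc_right hst)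
  have hf2 : IntervalIntegrable f volume s t :=
    hf.mono_set (by rw [uIcc_of_le hst, uIcc_of_le (hs.trans hst)]; exact Icc_subset_Icc_left hs)
  rw [mild, mild, map_add, ← G.op_add_apply (by linarith) hs, sub_add_cancel,
    ← ContinuousLinearMap.intervalIntegral_comp_comm _ (G.intervalIntegrable_op hs le_rfl hf1),
    add_assoc, ← intervalIntegral.integral_add_adjacent_intervals
      (G.intervalIntegrable_op hs hst hf1) (G.intervalIntegrable_op hst le_rfl hf2)]
  congr 2
  refine intervalIntegral.integral_congr fun θ hθ => ?_
  rw [uIcc_of_le hs] at hθ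
  rw [← G.op_add_apply (by linarith) (by linarith [hθ.2])]
  congr 2
  ring

theorem mild_add (G : C0Semigroup H) (x : H) {f : ℝ → H} {s t : ℝ} (hs : 0 ≤ s) (ht : 0 ≤ t)
    (hf : IntervalIntegrable f volume 0 (s + t)) :
    G.mild x f (s + t) = G.mild (G.mild x f s) (fun r => f (s + r)) t := by
  rw [G.op_mild x hs (by linarith) hf, mild, add_sub_cancel_left]
  congr 1
  have := intervalIntegral.integral_comp_add_left (a := 0) (b := t)
    (fun θ => G.op (s + t - θ) (f θ)) s
  rw [add_zero] at this
  rw [← this]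
  congr 1
  ext r
  congr 2
  ring

theorem continuousOn_mild (G : C0Semigroup H) (x : H) {f : ℝ → H}
    (hf : ∀ T, 0 ≤ T → IntervalIntegrable f volume 0 T) : ContinuousOn (G.mild x f) (Ici 0) := by
  refine (G.continuousOn x).add fun t₀ ht₀ => ?_
  have ht₀' : (0 : ℝ) ≤ t₀ := ht₀
  set T := t₀ + 1 with hT
  have hT0 : 0 ≤ T := by linarith
  obtain ⟨M, hM1, hM⟩ := G.exists_norm_op_le T
  -- The moving endpoint is moved into an indicator, so that dominated convergence applies on the
  -- fixed interval `(0, T]`; the integrand is continuous in `t` at `t₀` except for the null set `s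
  -- = t₀`.
  set Φ : ℝ → ℝ → H := fun t => (Iic t).indicator fun s => G.op (max (t - s) 0) (f s) with hΦ
  have hint := (intervalIntegrable_iff_integrableOn_Ioc_of_le hT0).1 (hf T hT0)
  have hc : ContinuousAt (fun t => ∫ s in (0 : ℝ)..T, Φ t s) t₀ := by
    refine intervalIntegral.continuousAt_of_dominated_interval (bound := fun s => M * ‖f s‖) ?_ ?_
      ((hf T hT0).norm.const_mul M) ?_
    · refine Eventually.of_forall fun t => ?_
      rw [uIoc_of_le hT0]
      exact (G.aestronglyMeasurable_op hint.1 _ (by fun_prop)).indicator measurableSet_Iic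
    · filter_upwards [Iio_mem_nhds (show t₀ < T by linarith)] with t ht
      refine Eventually.of_forall fun s hs => ?_
      rw [uIoc_of_le hT0] at hs
      refine (norm_indicator_le_norm_self _ _).trans ?_
      refine (G.op _).le_of_opNorm_le (hM _ (le_max_right _ _) (max_le ?_ hT0)) _
      linarith [hs.1, mem_Iio.1 ht]
    · have : ∀ᵐ s : ℝ, s ≠ t₀ := by simp [ae_iff]
      filter_upwards [this] with s hs _
      rcases lt_or_gt_of_ne hs with h | h
      · refine ContinuousAt.congr (f := fun t => G.op (max (t - s) 0) (f s)) ?_ ?_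
        · exact ((G.continuous_op_max (f s)).comp (continuous_id.sub continuous_const)).continuousAt
        · filter_upwards [Ioi_mem_nhds h] with t ht
          rw [hΦ]
          simp only
          rw [indicator_of_mem]
          exact (mem_Ioi.1 ht).le
      · refine ContinuousAt.congr (f := fun t => (0 : H)) continuousAt_const ?_
        filter_upwards [Iio_mem_nhds h] with t ht
        rw [hΦ]
        simp only
        rw [indicator_of_notMem]
        exact not_le.2 (mem_Iio.1 ht)
  refine hc.continuousWithinAt.congr_of_eventuallyEq_of_mem ?_ ht₀
  have : Ici 0 ∩ Iio T ∈ 𝓝[Ici 0] t₀ :=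
    inter_mem_nhdsWithin _ (Iio_mem_nhds (show t₀ < T by linarith))
  filter_upwards [this] with t ht
  have h0 : (0 : ℝ) ≤ t := ht.1
  rw [intervalIntegral.integral_of_le h0, intervalIntegral.integral_of_le hT0, hΦ]
  simp only
  rw [setIntegral_indicator measurableSet_Iic]
  have : Ioc 0 T ∩ Iic t = Ioc 0 t := by
    ext s
    simp only [mem_inter_iff, mem_Ioc, mem_Iic]
    have := mem_Iio.1 ht.2
    constructor
    · rintro ⟨⟨a, b⟩, c⟩; exact ⟨a, c⟩
    · rintro ⟨a, c⟩; exact ⟨⟨a, by linarith⟩, c⟩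
  rw [this]
  refine setIntegral_congr_fun measurableSet_Ioc fun s hs => ?_
  rw [max_eq_left (by linarith [hs.2])]

/-- By the Cauchy formula `v(t)` is controlled by `v(s)` and the integral of `‖f‖` for every `s` in
`[t - 1, t]`. Averaging over `s` leaves only integrals over unit intervals of square-integrable
functions, which tend to 0. -/
theorem tendsto_mild_zero (G : C0Semigroup H) {x : H} {f v : ℝ → H}
    (hv : MemLp v 2 (volume.restrict (Ioi 0))) (hf : MemLp f 2 (volume.restrict (Ioi 0)))
    (h : ∀ t, 0 ≤ t → v t = G.mild x f t) : Tendsto v atTop (𝓝 0) := by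
  obtain ⟨M, hM1, hM⟩ := G.exists_norm_op_le 1
  have hlim : Tendsto (fun t => M * (∫ s in (t - 1)..t, ‖v s‖) + M * ∫ s in (t - 1)..t, ‖f s‖)
      atTop (𝓝 0) := by
    simpa using ((tendsto_integral_norm_unit_interval_atTop hv).const_mul M).add
      ((tendsto_integral_norm_unit_interval_atTop hf).const_mul M)
  refine squeeze_zero_norm' ?_ hlim
  filter_upwards [eventually_ge_atTop 1] with t ht
  have hfi : ∀ T, 0 ≤ T → IntervalIntegrable f volume 0 T := fun T hT =>
    hf.intervalIntegrable_of_Ioi le_rfl hT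
  have hvI : IntervalIntegrable (fun s => M * ‖v s‖) volume (t - 1) t :=
    (hv.norm.intervalIntegrable_of_Ioi (by linarith) (by linarith)).const_mul M
  have hfI : IntervalIntegrable (fun s => ‖f s‖) volume (t - 1) t :=
    hf.norm.intervalIntegrable_of_Ioi (by linarith) (by linarith)
  have key : ∀ s ∈ Icc (t - 1) t, ‖v t‖ ≤ M * ‖v s‖ + M * ∫ s in (t - 1)..t, ‖f s‖ := by
    intro s hs
    rw [h t (by linarith), G.op_mild x (by linarith [hs.1]) hs.2 (hfi t (by linarith)),
      ← h s (by linarith [hs.1])]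
    refine (norm_add_le _ _).trans (add_le_add ?_ ?_)
    · exact (G.op _).le_of_opNorm_le (hM _ (by linarith [hs.2]) (by linarith [hs.1])) _
    · refine (G.norm_integral_op_le hs.2 (M := M) (fun r h0 h1 => hM r h0 (by linarith [hs.1]))
        (hf.intervalIntegrable_of_Ioi (by linarith [hs.1]) (by linarith))).trans ?_
      refine mul_le_mul_of_nonneg_left ?_ (by linarith)
      exact intervalIntegral.integral_mono_interval hs.1 hs.2 le_rfl
        (Eventually.of_forall fun _ => norm_nonneg _) hfI
  -- The interval has length 1, so integrating the constants leaves them unchanged.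
  have := intervalIntegral.integral_mono_on (by linarith) (intervalIntegrable_const (c := ‖v t‖))
    (hvI.add intervalIntegrable_const) key
  rw [intervalIntegral.integral_add hvI intervalIntegrable_const,
    intervalIntegral.integral_const_mul] at this
  simpa using this

theorem exists_norm_le_of_continuousOn_of_tendsto {v : ℝ → H} (hc : ContinuousOn v (Ici 0))
    (h : Tendsto v atTop (𝓝 0)) : ∃ C : ℝ, ∀ t, 0 ≤ t → ‖v t‖ ≤ C := by
  obtain ⟨T, hT⟩ := eventually_atTop.1 ((tendsto_zero_iff_norm_tendsto_zero.1 h).eventually_lt_const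
    zero_lt_one)
  obtain ⟨C, hC⟩ := isCompact_Icc.exists_bound_of_continuousOn
    (hc.mono (Icc_subset_Ici_self : Icc 0 T ⊆ Ici 0))
  refine ⟨max 1 C, fun t ht => ?_⟩
  rcases le_total t T with h | h
  · exact (hC t ⟨ht, h⟩).trans (le_max_right _ _)
  · exact (hT t h).le.trans (le_max_left _ _)

end C0Semigroup


/-! ### The integrated semigroup, the generator and the adjoint semigroup -/

/-- Semigroups and mild solutions give only one-sided difference quotients; right derivatives
suffice for the fundamental theorem of calculus used throughout. -/
theorem hasDerivWithinAt_Ioi_of_tendsto {E : Type*} [NormedAddCommGroup E] [NormedSpace ℝ E]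
    {f : ℝ → E} {f' : E} {t : ℝ}
    (h : Tendsto (fun r : ℝ => r⁻¹ • (f (t + r) - f t)) (𝓝[>] 0) (𝓝 f')) :
    HasDerivWithinAt f f' (Ioi t) t := by
  rw [hasDerivWithinAt_iff_tendsto_slope' self_notMem_Ioi]
  have hm : Tendsto (fun u => u - t) (𝓝[>] t) (𝓝[>] 0) := by
    refine tendsto_nhdsWithin_iff.2 ⟨?_, ?_⟩
    · have : Tendsto (fun u => u - t) (𝓝 t) (𝓝 (t - t)) := (continuous_sub_right t).tendsto t
      rw [sub_self] at this
      exact this.mono_left nhdsWithin_le_nhds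
    · filter_upwards [self_mem_nhdsWithin] with u hu
      exact sub_pos.2 (mem_Ioi.1 hu)
  refine (h.comp hm).congr fun u => ?_
  simp [slope_def_module]

namespace C0Semigroup

variable {H : Type*} [NormedAddCommGroup H] [InnerProductSpace ℝ H] [CompleteSpace H]

/-- The integrated semigroup `x ↦ ∫₀ᵗ G(s) x ds`. -/
noncomputable def integrated (G : C0Semigroup H) (t : ℝ) : H →L[ℝ] H :=
  LinearMap.mkContinuousOfExistsBound
    { toFun := fun x => ∫ s in (0 : ℝ)..t, G.op (max s 0) x
      map_add' := fun x y => by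
        simp only [map_add]
        exact intervalIntegral.integral_add ((G.continuous_op_max x).intervalIntegrable _ _)
          ((G.continuous_op_max y).intervalIntegrable _ _)
      map_smul' := fun c x => by
        simp only [map_smul, RingHom.id_apply]
        exact intervalIntegral.integral_smul _ _ }
    (by
      obtain ⟨M, hM1, hM⟩ := G.exists_norm_op_le |t|
      refine ⟨M * |t - 0|, fun x => ?_⟩
      have := intervalIntegral.norm_integral_le_of_norm_le_const (a := 0) (b := t)
        (f := fun s => G.op (max s 0) x) (C := M * ‖x‖) fun s hs => by
          refine (G.op _).le_of_opNorm_le (hM _ (le_max_right _ _) (max_le ?_ (abs_nonneg _))) _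
          rcases le_total 0 t with h | h
          · rw [uIoc_of_le h] at hs
            exact hs.2.trans (le_abs_self _)
          · rw [uIoc_of_ge h] at hs
            exact hs.2.trans (abs_nonneg _)
      exact this.trans_eq (by ring))

theorem integrated_apply (G : C0Semigroup H) (t : ℝ) (x : H) :
    G.integrated t x = ∫ s in (0 : ℝ)..t, G.op (max s 0) x := rfl

theorem integrated_zero (G : C0Semigroup H) (x : H) : G.integrated 0 x = 0 := by
  simp [integrated_apply]

theorem norm_integrated_le (G : C0Semigroup H) {t M : ℝ} (ht : 0 ≤ t)
    (hM : ∀ s, 0 ≤ s → s ≤ t → ‖G.op s‖ ≤ M) (x : H) : ‖G.integrated t x‖ ≤ t * M * ‖x‖ := by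
  have := intervalIntegral.norm_integral_le_of_norm_le_const (a := 0) (b := t)
    (f := fun s => G.op (max s 0) x) (C := M * ‖x‖) fun s hs => by
      rw [uIoc_of_le ht] at hs
      exact (G.op _).le_of_opNorm_le (hM _ (le_max_right _ _) (max_le hs.2 ht)) _
  rw [sub_zero, abs_of_nonneg ht] at this
  exact this.trans_eq (by ring)

theorem hasDerivAt_integrated (G : C0Semigroup H) {t : ℝ} (ht : 0 ≤ t) (x : H) :
    HasDerivAt (fun s => G.integrated s x) (G.op t x) t := by
  have := (G.continuous_op_max x).integral_hasStrictDerivAt 0 t |>.hasDerivAt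
  rw [max_eq_left ht] at this
  exact this

theorem integrated_add (G : C0Semigroup H) {s t : ℝ} (hs : 0 ≤ s) (ht : 0 ≤ t) (x : H) :
    G.integrated (s + t) x = G.integrated s x + G.op s (G.integrated t x) := by
  have hI := fun a b => (G.continuous_op_max x).intervalIntegrable (μ := volume) a b
  rw [integrated_apply, integrated_apply, integrated_apply,
    ← ContinuousLinearMap.intervalIntegral_comp_comm _ (hI _ _),
    ← intervalIntegral.integral_add_adjacent_intervals (hI 0 s) (hI s (s + t))]
  congr 1
  have := intervalIntegral.integral_comp_add_left (a := 0) (b := t)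
    (fun r => G.op (max r 0) x) s
  rw [add_zero] at this
  rw [← this]
  refine intervalIntegral.integral_congr fun r hr => ?_
  rw [uIcc_of_le ht] at hr
  rw [max_eq_left (by linarith [hr.1]), max_eq_left hr.1, G.op_add_apply hs hr.1]

theorem op_comm (G : C0Semigroup H) {s t : ℝ} (hs : 0 ≤ s) (ht : 0 ≤ t) (x : H) :
    G.op s (G.op t x) = G.op t (G.op s x) := by
  rw [← G.op_add_apply hs ht, add_comm, G.op_add_apply ht hs]

theorem integrated_op (G : C0Semigroup H) {s : ℝ} (t : ℝ) (hs : 0 ≤ s) (x : H) :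
    G.integrated t (G.op s x) = G.op s (G.integrated t x) := by
  rw [integrated_apply, integrated_apply, ← ContinuousLinearMap.intervalIntegral_comp_comm _
    ((G.continuous_op_max x).intervalIntegrable _ _)]
  refine intervalIntegral.integral_congr fun r hr => ?_
  exact G.op_comm (le_max_right _ _) hs x

/-- Both sides equal `V(s + t) - V(s) - V(t)` at `x`, where `V` is the integrated semigroup. The
exchange of `s` and `t` lets a small `s` be moved onto the integral, where it yields a factor of
size `s`. -/
theorem op_integrated_sub (G : C0Semigroup H) {s t : ℝ} (hs : 0 ≤ s) (ht : 0 ≤ t) (x : H) :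
    G.op s (G.integrated t x) - G.integrated t x = G.op t (G.integrated s x) - G.integrated s x := by
  have h1 := G.integrated_add hs ht x
  have h2 := G.integrated_add ht hs x
  rw [add_comm t s] at h2
  rw [sub_eq_sub_iff_add_eq_add, add_comm, ← h1, h2, add_comm]

theorem tendsto_inv_smul_integrated (G : C0Semigroup H) (x : H) :
    Tendsto (fun r : ℝ => r⁻¹ • G.integrated r x) (𝓝[>] 0) (𝓝 x) := by
  have := (G.hasDerivAt_integrated le_rfl x).tendsto_slope_zero_right
  simpa [integrated_zero, G.op_zero] using this

theorem hasGeneratorAt_integrated (G : C0Semigroup H) {t : ℝ} (ht : 0 ≤ t) (x : H) :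
    G.HasGeneratorAt (G.integrated t x) (G.op t x - x) := by
  have h := G.tendsto_inv_smul_integrated x
  have h2 := (((G.op t).continuous.tendsto x).comp h).sub h
  refine h2.congr' ?_
  filter_upwards [self_mem_nhdsWithin] with r hr
  rw [G.op_integrated_sub (le_of_lt hr) ht, smul_sub]
  simp

/-- The right derivative of `s ↦ G(s) x` is `G(s) y`, which is continuous, so the fundamental
theorem of calculus applies. -/
theorem integrated_of_hasGeneratorAt {G : C0Semigroup H} {x y : H} (h : G.HasGeneratorAt x y)
    {t : ℝ} (ht : 0 ≤ t) : G.integrated t y = G.op t x - x := by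
  have := intervalIntegral.integral_eq_sub_of_hasDeriv_right_of_le (f := fun s => G.op s x)
    (f' := fun s => G.op (max s 0) y) ht ((G.continuousOn x).mono Icc_subset_Ici_self)
    (fun s hs => ?_) ((G.continuous_op_max y).intervalIntegrable _ _)
  · rw [integrated_apply, this, G.op_zero_apply]
  · refine hasDerivWithinAt_Ioi_of_tendsto ?_
    have h2 := ((G.op s).continuous.tendsto y).comp h
    rw [max_eq_left hs.1.le]
    refine h2.congr' ?_
    filter_upwards [self_mem_nhdsWithin] with r hr
    rw [G.op_add_apply hs.1.le (le_of_lt hr)]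
    simp

/-- The semigroup of the Hilbert space adjoints `G(t)*`. -/
noncomputable def adjoint (G : C0Semigroup H) : C0Semigroup H where
  op t := (G.op t).adjoint
  op_zero := by
    rw [G.op_zero]
    exact ContinuousLinearMap.adjoint_id
  op_add s t hs ht := by
    rw [add_comm, G.op_add t s ht hs, ContinuousLinearMap.adjoint_comp]
  continuousOn x := by
    -- Strong continuity at 0 holds on a closed subspace `S` containing the ranges of the adjoints
    -- `V(r)*` of the integrated semigroup, `0 ≤ r ≤ 1`. A vector orthogonal to `S` is killed by all
    -- `V(r)`, hence is 0, because `r⁻¹ V(r) y → y`.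
    have key : ∀ x, Tendsto (fun t => (G.op t).adjoint x) (𝓝[≥] 0) (𝓝 x) := by
      obtain ⟨M, hM1, hM⟩ := G.exists_norm_op_le 2
      have hnn : ∀ᶠ t : ℝ in 𝓝[≥] 0, 0 ≤ t := self_mem_nhdsWithin
      have hle : ∀ᶠ t : ℝ in 𝓝[≥] 0, t ≤ 1 :=
        mem_nhdsWithin_of_mem_nhds (Iic_mem_nhds zero_lt_one)
      let S : Submodule ℝ H :=
        { carrier := {x | Tendsto (fun t => (G.op t).adjoint x) (𝓝[≥] 0) (𝓝 x)}
          add_mem' := fun {a b} ha hb => (Tendsto.add ha hb).congr fun t => (map_add _ a b).symm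
          zero_mem' := by simp
          smul_mem' := fun c a ha => (Tendsto.const_smul ha c).congr fun t => (map_smul _ c a).symm }
      have hclosed : IsClosed (S : Set H) := by
        rw [← isSeqClosed_iff_isClosed]
        intro u x hu hx
        change Tendsto (fun t => (G.op t).adjoint x) (𝓝[≥] 0) (𝓝 x)
        rw [Metric.tendsto_nhds]
        intro ε hε
        obtain ⟨n, hn⟩ := (Metric.tendsto_nhds.1 hx (ε / (3 * M)) (by positivity)).exists
        have hun := Metric.tendsto_nhds.1 (hu n) (ε / 3) (by positivity)
        filter_upwards [hun, hnn, hle] with t ht h0 h1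
        rw [dist_eq_norm] at hn ht ⊢
        have e : (G.op t).adjoint x - x =
          (G.op t).adjoint (x - u n) + ((G.op t).adjoint (u n) - u n) + (u n - x) := by
          rw [map_sub]; abel
        have h2 : ‖(G.op t).adjoint (x - u n)‖ ≤ M * ‖x - u n‖ :=
          ContinuousLinearMap.le_of_opNorm_le _
            (by rw [LinearIsometryEquiv.norm_map]; exact hM t h0 (by linarith)) _
        rw [norm_sub_rev x] at h2
        have h3 : M * ‖u n - x‖ < ε / 3 := by
          calc M * ‖u n - x‖ < M * (ε / (3 * M)) := mul_lt_mul_of_pos_left hn (by linarith)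
            _ = ε / 3 := by field_simp
        have h4 : ‖u n - x‖ ≤ M * ‖u n - x‖ := le_mul_of_one_le_left (norm_nonneg _) hM1
        rw [e]
        refine (norm_add_le _ _).trans_lt ((add_le_add_left (norm_add_le _ _) _).trans_lt ?_)
        linarith
      -- `(G(t)* - I) V(r)*` is the adjoint of `V(r) (G(t) - I) = (G(r) - I) V(t)`, whose norm is of
      -- order `t`.
      have hV : ∀ r, 0 ≤ r → r ≤ 1 → ∀ y, (G.integrated r).adjoint y ∈ S := by
        intro r hr hr1 y
        change Tendsto (fun t => (G.op t).adjoint ((G.integrated r).adjoint y)) (𝓝[≥] 0) (𝓝 _)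
        rw [tendsto_iff_norm_sub_tendsto_zero]
        have hlim : Tendsto (fun t : ℝ => (t * M * (M + 1)) * ‖y‖) (𝓝[≥] 0) (𝓝 0) := by
          have : Continuous fun t : ℝ => (t * M * (M + 1)) * ‖y‖ := by fun_prop
          have := this.tendsto 0
          rw [zero_mul, zero_mul, zero_mul] at this
          exact this.mono_left nhdsWithin_le_nhds
        refine squeeze_zero' (Eventually.of_forall fun _ => norm_nonneg _) ?_ hlim
        filter_upwards [hnn, hle] with t h0 h1
        have e : (G.op t).adjoint ((G.integrated r).adjoint y) - (G.integrated r).adjoint y =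
            ((G.integrated r).comp (G.op t) - G.integrated r).adjoint y := by
          rw [map_sub, ContinuousLinearMap.adjoint_comp]; rfl
        rw [e]
        refine ContinuousLinearMap.le_of_opNorm_le _ ?_ _
        rw [LinearIsometryEquiv.norm_map]
        refine ContinuousLinearMap.opNorm_le_bound _ (by positivity) fun z => ?_
        rw [_root_.sub_apply, ContinuousLinearMap.comp_apply, G.integrated_op r h0,
          G.op_integrated_sub h0 hr]
        have h5 := G.norm_integrated_le h0 (M := M) (fun s a b => hM s a (by linarith)) z
        have h6 := (G.op r).le_of_opNorm_le (hM r hr (by linarith)) (G.integrated t z)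
        refine (norm_sub_le _ _).trans ?_
        calc _ ≤ M * (t * M * ‖z‖) + t * M * ‖z‖ := by
              refine add_le_add (h6.trans ?_) h5
              exact mul_le_mul_of_nonneg_left h5 (by linarith)
          _ = _ := by ring
      have htop : Sᗮ = ⊥ := by
        rw [Submodule.eq_bot_iff]
        intro y hy
        have hz : ∀ r, 0 ≤ r → r ≤ 1 → G.integrated r y = 0 := fun r h0 h1 => by
          rw [← inner_self_eq_zero (𝕜 := ℝ), ← ContinuousLinearMap.adjoint_inner_left]
          exact hy _ (hV r h0 h1 _)
        refine tendsto_nhds_unique (G.tendsto_inv_smul_integrated y) ?_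
        refine tendsto_const_nhds.congr' ?_
        filter_upwards [self_mem_nhdsWithin,
          mem_nhdsWithin_of_mem_nhds (Iic_mem_nhds zero_lt_one)] with r h0 h1
        rw [hz r (le_of_lt h0) h1, smul_zero]
      have : CompleteSpace S := hclosed.completeSpace_coe
      have hS : S = ⊤ := Submodule.orthogonal_eq_bot_iff.1 htop
      exact fun x => (hS ▸ Submodule.mem_top : x ∈ S)
    intro t₀ ht₀
    have ht₀' : (0 : ℝ) ≤ t₀ := ht₀
    obtain ⟨M, hM1, hM⟩ := G.exists_norm_op_le (t₀ + 1)
    have hadd : ∀ s t, 0 ≤ s → 0 ≤ t →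
        (G.op (s + t)).adjoint x = (G.op s).adjoint ((G.op t).adjoint x) := fun s t hs ht => by
      rw [add_comm, G.op_add t s ht hs, ContinuousLinearMap.adjoint_comp]; rfl
    rw [ContinuousWithinAt, tendsto_iff_norm_sub_tendsto_zero]
    -- Factoring out the operator at the smaller of the two times reduces continuity at `t₀`, from
    -- either side, to the increment over `|t - t₀|` at time 0.
    have hm : Tendsto (fun t => |t - t₀|) (𝓝 t₀) (𝓝[≥] 0) := by
      refine tendsto_nhdsWithin_iff.2 ⟨?_, Eventually.of_forall fun _ => mem_Ici.2 (abs_nonneg _)⟩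
      have : Continuous fun t => |t - t₀| := by fun_prop
      simpa using this.tendsto t₀
    have h1 := (((key x).sub_const x).norm.const_mul M).comp (hm.mono_left (nhdsWithin_le_nhds (s := Ici 0)))
    rw [sub_self, norm_zero, mul_zero] at h1
    refine squeeze_zero' (Eventually.of_forall fun _ => norm_nonneg _) ?_ h1
    filter_upwards [self_mem_nhdsWithin, mem_nhdsWithin_of_mem_nhds
      (Iic_mem_nhds (show t₀ < t₀ + 1 by linarith))] with t ht ht1
    have hb : ∀ s, 0 ≤ s → s ≤ t₀ + 1 → ∀ y, ‖(G.op s).adjoint y‖ ≤ M * ‖y‖ := fun s h0 h1 y =>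
      ContinuousLinearMap.le_of_opNorm_le _
        (by rw [LinearIsometryEquiv.norm_map]; exact hM s h0 h1) _
    rcases le_total t₀ t with h | h
    · have := hadd t₀ (t - t₀) ht₀' (by linarith)
      rw [add_sub_cancel] at this
      rw [this, ← map_sub]
      simp only [Function.comp, abs_of_nonneg (sub_nonneg.2 h)]
      exact hb _ ht₀' (by linarith) _
    · have := hadd t (t₀ - t) ht (by linarith)
      rw [add_sub_cancel] at this
      rw [this, ← map_sub, map_sub, norm_sub_rev, ← map_sub]
      simp only [Function.comp, abs_of_nonpos (sub_nonpos.2 h), neg_sub]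
      exact hb _ ht ht1 _

theorem adjoint_op (G : C0Semigroup H) (t : ℝ) : G.adjoint.op t = (G.op t).adjoint := rfl

end C0Semigroup


/-! ### The complexified semigroup and its resolvent on the imaginary axis -/

namespace Complexification

variable {E F : Type*} [NormedAddCommGroup E] [InnerProductSpace ℝ E]
  [NormedAddCommGroup F] [InnerProductSpace ℝ F]

/-- `C0Semigroup` is defined over `ℝ`; with the underlying real structure its theory applies to the
complex semigroups `e^{-pt} G(t)`. -/
noncomputable instance : InnerProductSpace ℝ (Complexification E) :=
  InnerProductSpace.rclikeToReal ℂ (Complexification E)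

@[simp] theorem re_neg (z : Complexification E) : (-z).re = -z.re := rfl
@[simp] theorem im_neg (z : Complexification E) : (-z).im = -z.im := rfl
@[simp] theorem re_sub (z w : Complexification E) : (z - w).re = z.re - w.re := rfl
@[simp] theorem im_sub (z w : Complexification E) : (z - w).im = z.im - w.im := rfl

@[simp] theorem re_real_smul (r : ℝ) (z : Complexification E) : (r • z).re = r • z.re := by
  change ((r : ℂ) • z).re = _
  rw [re_smul]
  simp

@[simp] theorem im_real_smul (r : ℝ) (z : Complexification E) : (r • z).im = r • z.im := by
  change ((r : ℂ) • z).im = _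
  rw [im_smul]
  simp

@[simp] theorem re_complexify (T : E →L[ℝ] F) (z : Complexification E) :
    (T.complexify z).re = T z.re := rfl
@[simp] theorem im_complexify (T : E →L[ℝ] F) (z : Complexification E) :
    (T.complexify z).im = T z.im := rfl

theorem continuous_mk : Continuous fun p : E × E => mk p.1 p.2 :=
  WithLp.prod_continuous_toLp 2 E E

theorem tendsto_iff {α : Type*} {l : Filter α} {f : α → Complexification E}
    {z : Complexification E} : Tendsto f l (𝓝 z) ↔
      Tendsto (fun a => (f a).re) l (𝓝 z.re) ∧ Tendsto (fun a => (f a).im) l (𝓝 z.im) := by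
  refine ⟨fun h => ⟨(continuous_re.tendsto z).comp h, (continuous_im.tendsto z).comp h⟩, fun h => ?_⟩
  exact (continuous_mk.tendsto (z.re, z.im)).comp (h.1.prodMk_nhds h.2)

/-- The canonical embedding `x ↦ x + i 0`. -/
def ofReal : E →L[ℝ] Complexification E where
  toFun x := mk x 0
  map_add' x y := by ext <;> simp
  map_smul' c x := by ext <;> simp
  cont := continuous_mk.comp (continuous_id.prodMk continuous_const)

@[simp] theorem re_ofReal (x : E) : (ofReal x).re = x := rfl
@[simp] theorem im_ofReal (x : E) : (ofReal x).im = 0 := rfl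

theorem complexify_ofReal (T : E →L[ℝ] F) (x : E) : T.complexify (ofReal x) = ofReal (T x) := by
  ext <;> simp

theorem norm_ofReal (x : E) : ‖ofReal x‖ = ‖x‖ := by
  have := norm_sq_eq (ofReal x)
  simp only [re_ofReal, im_ofReal, norm_zero] at this
  nlinarith [norm_nonneg x, norm_nonneg (ofReal x)]

theorem norm_le_of_re_im {z : Complexification E} {w : Complexification F} {c : ℝ} (hc : 0 ≤ c)
    (h1 : ‖z.re‖ ≤ c * ‖w.re‖) (h2 : ‖z.im‖ ≤ c * ‖w.im‖) : ‖z‖ ≤ c * ‖w‖ := by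
  refine abs_le_of_sq_le_sq' ?_ (by positivity) |>.2
  rw [mul_pow, norm_sq_eq, norm_sq_eq, mul_add, ← mul_pow, ← mul_pow]
  exact add_le_add (pow_le_pow_left₀ (norm_nonneg _) h1 2) (pow_le_pow_left₀ (norm_nonneg _) h2 2)

theorem norm_complexify_apply_le {T : E →L[ℝ] F} {M : ℝ} (hM0 : 0 ≤ M) (hM : ‖T‖ ≤ M)
    (z : Complexification E) : ‖T.complexify z‖ ≤ M * ‖z‖ :=
  norm_le_of_re_im hM0 (T.le_of_opNorm_le hM _) (T.le_of_opNorm_le hM _)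

end Complexification

namespace C0Semigroup

open Complexification

variable {H : Type*} [NormedAddCommGroup H] [InnerProductSpace ℝ H]

/-- The semigroup `e^{-pt} G(t)` on the complexification. -/
noncomputable def twist (G : C0Semigroup H) (p : ℂ) : C0Semigroup (Complexification H) where
  op t := (Complex.exp (-p * t) • (G.op t).complexify).restrictScalars ℝ
  op_zero := by
    ext z <;> simp [G.op_zero]
  op_add s t hs ht := by
    ext1 z
    change Complex.exp (-p * ↑(s + t)) • (G.op (s + t)).complexify z =
      Complex.exp (-p * s) • (G.op s).complexify (Complex.exp (-p * t) • (G.op t).complexify z)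
    rw [map_smul, smul_smul, ← Complex.exp_add, Complex.ofReal_add, mul_add, G.op_add s t hs ht]
    rfl
  continuousOn z := by
    refine ContinuousOn.smul (f := fun t : ℝ => Complex.exp (-p * t))
      (g := fun t => (G.op t).complexify z) (by fun_prop) ?_
    exact continuous_mk.comp_continuousOn ((G.continuousOn z.re).prodMk (G.continuousOn z.im))

theorem twist_op (G : C0Semigroup H) (p : ℂ) (t : ℝ) (z : Complexification H) :
    (G.twist p).op t z = Complex.exp (-p * t) • (G.op t).complexify z := rfl

theorem twist_op_smul (G : C0Semigroup H) (p : ℂ) (t : ℝ) (c : ℂ) (z : Complexification H) :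
    (G.twist p).op t (c • z) = c • (G.twist p).op t z := by
  rw [twist_op, twist_op, map_smul, smul_comm]

theorem norm_exp_neg_mul (p : ℂ) (t : ℝ) : ‖Complex.exp (-p * t)‖ = Real.exp (-p.re * t) := by
  rw [Complex.norm_exp]
  simp

theorem norm_exp_neg_I_mul (ω t : ℝ) : ‖Complex.exp (-(Complex.I * ω) * t)‖ = 1 := by
  rw [norm_exp_neg_mul]
  simp

/-- The product rule at `t = 0` for `e^{-qt} G(t) = e^{(p-q)t} e^{-pt} G(t)`. It transports
questions at any `p` to `p = 0`, where real and imaginary parts decouple. -/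
theorem HasGeneratorAt.twist_change {G : C0Semigroup H} {p : ℂ} (q : ℂ) {z y : Complexification H}
    (h : (G.twist p).HasGeneratorAt z y) : (G.twist q).HasGeneratorAt z (y + (p - q) • z) := by
  have h1 : Tendsto (fun t : ℝ => Complex.exp ((p - q) * t)) (𝓝[>] 0) (𝓝 1) := by
    have : Continuous fun t : ℝ => Complex.exp ((p - q) * t) := by fun_prop
    have := this.tendsto 0
    simp only [Complex.ofReal_zero, mul_zero, Complex.exp_zero] at this
    exact this.mono_left nhdsWithin_le_nhds
  have h2 : Tendsto (fun t : ℝ => t⁻¹ • (Complex.exp ((p - q) * t) - 1)) (𝓝[>] 0) (𝓝 (p - q)) := by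
    have : HasDerivAt (fun t : ℝ => Complex.exp ((p - q) * t))
        (Complex.exp ((p - q) * (0 : ℝ)) * ((p - q) * 1)) 0 :=
      ((Complex.ofRealCLM.hasDerivAt (x := 0)).const_mul (p - q)).cexp
    simpa using this.tendsto_slope_zero_right
  have h3 := (Tendsto.smul h1 h).add (h2.smul (tendsto_const_nhds (x := z)))
  rw [one_smul] at h3
  refine h3.congr fun t => ?_
  rw [twist_op, twist_op]
  have e : Complex.exp (-q * t) = Complex.exp ((p - q) * t) * Complex.exp (-p * t) := by
    rw [← Complex.exp_add]; congr 1; ring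
  rw [e, smul_comm _ (t⁻¹), smul_assoc, ← smul_add, mul_smul]
  congr 1
  rw [smul_sub, sub_smul, one_smul]
  abel

theorem hasGeneratorAt_twist_zero {G : C0Semigroup H} {z y : Complexification H} :
    (G.twist 0).HasGeneratorAt z y ↔ G.HasGeneratorAt z.re y.re ∧ G.HasGeneratorAt z.im y.im := by
  rw [HasGeneratorAt, Complexification.tendsto_iff]
  simp [twist_op, HasGeneratorAt]

theorem hasGeneratorAt_generator (G : C0Semigroup H) (x : G.generator.domain) :
    G.HasGeneratorAt x (G.generator x) := Exists.choose_spec x.2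

theorem HasGeneratorAt.unique {G : C0Semigroup H} {x y y' : H} (h : G.HasGeneratorAt x y)
    (h' : G.HasGeneratorAt x y') : y = y' := tendsto_nhds_unique h h'

theorem hasGeneratorAt_twist_iff {G : C0Semigroup H} {p : ℂ} {z y : Complexification H} :
    (G.twist p).HasGeneratorAt z y ↔
      ∃ h : z ∈ G.generator.complexify.domain, G.generator.complexify ⟨z, h⟩ - p • z = y := by
  constructor
  · intro h
    have h0 := hasGeneratorAt_twist_zero.1 (h.twist_change 0)
    rw [sub_zero] at h0
    have hd : z ∈ G.generator.complexify.domain := ⟨⟨_, h0.1⟩, ⟨_, h0.2⟩⟩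
    refine ⟨hd, ?_⟩
    rw [sub_eq_iff_eq_add]
    ext
    · exact (G.hasGeneratorAt_generator ⟨z.re, hd.1⟩).unique h0.1
    · exact (G.hasGeneratorAt_generator ⟨z.im, hd.2⟩).unique h0.2
  · rintro ⟨h, rfl⟩
    have h0 : (G.twist 0).HasGeneratorAt z (G.generator.complexify ⟨z, h⟩) :=
      hasGeneratorAt_twist_zero.2
        ⟨G.hasGeneratorAt_generator ⟨z.re, h.1⟩, G.hasGeneratorAt_generator ⟨z.im, h.2⟩⟩
    simpa [sub_eq_add_neg] using h0.twist_change p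

/-- The generator of `e^{-pt} G(t)` is `A - p`, so being its resolvent at `p` can be checked by
right derivatives at 0, without mentioning domains. -/
theorem isResolventAt_iff {G : C0Semigroup H} {p : ℂ}
    {R : Complexification H →L[ℂ] Complexification H} :
    G.generator.complexify.IsResolventAt p R ↔
      (∀ w, (G.twist p).HasGeneratorAt (R w) w) ∧
        ∀ z y, (G.twist p).HasGeneratorAt z y → R y = z := by
  constructor
  · rintro ⟨h1, h2⟩
    refine ⟨fun w => hasGeneratorAt_twist_iff.2 (h1 w), fun z y h => ?_⟩
    obtain ⟨hd, rfl⟩ := hasGeneratorAt_twist_iff.1 h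
    exact h2 ⟨z, hd⟩
  · rintro ⟨h1, h2⟩
    exact ⟨fun w => hasGeneratorAt_twist_iff.1 (h1 w),
      fun v => h2 _ _ (hasGeneratorAt_twist_iff.2 ⟨v.2, rfl⟩)⟩

theorem isResolventAt_unique {G : C0Semigroup H} {p : ℂ}
    {R R' : Complexification H →L[ℂ] Complexification H}
    (h : G.generator.complexify.IsResolventAt p R) (h' : G.generator.complexify.IsResolventAt p R') :
    R = R' := by
  ext1 w
  exact ((isResolventAt_iff.1 h).2 _ _ ((isResolventAt_iff.1 h').1 w)).symm ▸ rfl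

theorem isResolventAt_resolventAt {G : C0Semigroup H} {p : ℂ}
    (h : ∃ R, G.generator.complexify.IsResolventAt p R) :
    G.generator.complexify.IsResolventAt p (G.generator.complexify.resolventAt p) := by
  rw [LinearPMap.resolventAt, dif_pos h]
  exact h.choose_spec

variable [CompleteSpace H]

/-- If `e^{-pt} G(t) - I` is invertible, then `p` belongs to the resolvent set. -/
theorem exists_isResolventAt_of_bijective {G : C0Semigroup H} {p : ℂ} {t c M : ℝ} (ht : 0 ≤ t)
    (hc : 0 ≤ c) (hlow : ∀ z, ‖z‖ ≤ c * ‖(G.twist p).op t z - z‖)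
    (hsurj : Function.Surjective fun z => (G.twist p).op t z - z)
    (hM0 : 0 ≤ M) (hM : ∀ s, 0 ≤ s → s ≤ t → ‖(G.twist p).op s‖ ≤ M) :
    ∃ R, G.generator.complexify.IsResolventAt p R ∧ ‖R‖ ≤ t * M * c := by
  set S := G.twist p with hS
  let D : Complexification H →L[ℂ] Complexification H :=
    Complex.exp (-p * t) • (G.op t).complexify - ContinuousLinearMap.id ℂ _
  have hD : ∀ z, D z = S.op t z - z := fun z => rfl
  have hinj : D.ker = ⊥ := by
    rw [LinearMap.ker_eq_bot']
    intro z hz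
    have hz' : S.op t z - z = 0 := hz
    have := hlow z
    rw [hz', norm_zero, mul_zero] at this
    exact norm_le_zero_iff.1 this
  have hran : D.range = ⊤ := LinearMap.range_eq_top.2 hsurj
  let e := ContinuousLinearEquiv.ofBijective D hinj hran
  have he : ∀ z, e z = S.op t z - z := fun z => rfl
  let V : Complexification H →L[ℂ] Complexification H :=
    { toFun := S.integrated t
      map_add' := map_add _
      map_smul' := fun a z => by
        simp only [integrated_apply, RingHom.id_apply]
        rw [← intervalIntegral.integral_smul]
        refine intervalIntegral.integral_congr fun s _ => ?_
        exact G.twist_op_smul p _ a z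
      cont := (S.integrated t).continuous }
  have hV : ∀ z, V z = S.integrated t z := fun z => rfl
  -- With `V = ∫₀ᵗ e^{-ps} G(s) ds` and `D = e^{-pt} G(t) - I`, one has `(A - p) V = D`, and `V (A -
  -- p) = D` on the domain. Hence `V D⁻¹` is the resolvent; `t * M` bounds `V` and `c` bounds `D⁻¹`.
  refine ⟨V.comp (e.symm : Complexification H →L[ℂ] Complexification H),
    isResolventAt_iff.2 ⟨fun w => ?_, fun z y h => ?_⟩, ?_⟩
  · have := S.hasGeneratorAt_integrated ht (e.symm w)
    rwa [← he, e.apply_symm_apply] at this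
  · have h1 := integrated_of_hasGeneratorAt h ht
    change S.integrated t (e.symm y) = z
    apply e.injective
    rw [he, he, ← h1, ← S.integrated_op t ht, ← map_sub, ← he, e.apply_symm_apply]
  · refine ContinuousLinearMap.opNorm_le_bound _ (by positivity) fun w => ?_
    have h1 := S.norm_integrated_le ht hM (e.symm w)
    have h2 := hlow (e.symm w)
    rw [← he, e.apply_symm_apply] at h2
    refine h1.trans ?_
    calc _ ≤ t * M * (c * ‖w‖) := mul_le_mul_of_nonneg_left h2 (by positivity)
      _ = _ := by ring

/-- On `Ker Q` the operator `S` contracts, so `S - I` is inverted by a Neumann series. On `Ran Q` it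
expands, so `S - I` is injective there, hence surjective by finite dimension. The constant is `2 (1
+ ‖Q‖)` from the stable component plus `‖Q‖` from the unstable one. -/
theorem surjective_sub_of_dichotomy {X : Type*} [NormedAddCommGroup X] [NormedSpace ℝ X]
    [CompleteSpace X] {S Q : X →L[ℝ] X} (hQQ : ∀ x, Q (Q x) = Q x) (hfin : FiniteDimensional ℝ Q.range)
    (hcomm : ∀ x, Q (S x) = S (Q x)) {a : ℝ} (ha0 : 0 ≤ a) (ha : a * (1 + ‖Q‖) ≤ 1 / 2)
    (hst : ∀ x, Q x = 0 → ‖S x‖ ≤ a * ‖x‖) (hun : ∀ x, Q x = x → ‖x‖ ≤ a * ‖S x‖) :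
    (∀ x, ‖x‖ ≤ (2 + 3 * ‖Q‖) * ‖S x - x‖) ∧ Function.Surjective fun x => S x - x := by
  have ha2 : a ≤ 1 / 2 := by nlinarith [norm_nonneg Q]
  have hQ0 : ∀ x, Q (x - Q x) = 0 := fun x => by rw [map_sub, hQQ, sub_self]
  have hlow0 : ∀ x, Q x = 0 → ‖x‖ ≤ 2 * ‖S x - x‖ := fun x hx => by
    have h1 := hst x hx
    have h2 := norm_sub_norm_le x (S x)
    rw [norm_sub_rev] at h2
    nlinarith [norm_nonneg x]
  have hlow1 : ∀ x, Q x = x → ‖x‖ ≤ ‖S x - x‖ := fun x hx => by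
    have h1 := hun x hx
    have h2 := norm_sub_norm_le (S x) x
    nlinarith [norm_nonneg (S x)]
  constructor
  · intro x
    have h1 := hlow1 (Q x) (hQQ x)
    have h0 := hlow0 (x - Q x) (hQ0 x)
    rw [← hcomm, ← map_sub] at h1
    have e : S (x - Q x) - (x - Q x) = (S x - x) - Q (S x - x) := by
      simp only [map_sub, hcomm]; abel
    rw [e] at h0
    have hq := Q.le_opNorm (S x - x)
    have h2 := norm_sub_le (S x - x) (Q (S x - x))
    have h3 := norm_add_le (x - Q x) (Q x)
    rw [sub_add_cancel] at h3
    nlinarith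
  · intro w
    have hs : ∃ z, S z - z = w - Q w := by
      -- Composing with `I - Q` keeps the Neumann series on the whole space; the hypothesis `a * (1
      -- + ‖Q‖) ≤ 1 / 2` is what makes `N` small.
      let N : X →L[ℝ] X := S.comp (ContinuousLinearMap.id ℝ X - Q)
      have hN : ‖N‖ ≤ 1 / 2 := by
        refine ContinuousLinearMap.opNorm_le_bound _ (by norm_num) fun x => ?_
        have h1 := hst (x - Q x) (hQ0 x)
        have h2 := norm_sub_le x (Q x)
        have h3 := Q.le_opNorm x
        change ‖S (x - Q x)‖ ≤ _
        calc _ ≤ a * ‖x - Q x‖ := h1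
          _ ≤ a * ((1 + ‖Q‖) * ‖x‖) := by
            refine mul_le_mul_of_nonneg_left ?_ ha0
            linarith
          _ ≤ _ := by nlinarith [norm_nonneg x]
      have hu : IsUnit (1 - N) := isUnit_one_sub_of_norm_lt_one (by linarith)
      obtain ⟨u, hu⟩ := hu
      refine ⟨(↑u⁻¹ : X →L[ℝ] X) (-(w - Q w)), ?_⟩
      set z := (↑u⁻¹ : X →L[ℝ] X) (-(w - Q w)) with hz
      have h1 : (u : X →L[ℝ] X) z = -(w - Q w) := by
        rw [hz, ← mul_apply_eq_comp, Units.mul_inv]; rfl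
      rw [hu] at h1
      have h2 : z - S (z - Q z) = -(w - Q w) := h1
      -- Applying `Q` to the equation shows that its solution lies in `Ker Q`, where `N` coincides
      -- with `S`.
      have h3 : Q z = 0 := by
        have := congrArg Q h2
        rwa [map_sub, hcomm, hQ0, map_zero, map_neg, hQ0, neg_zero, sub_zero] at this
      rw [h3, sub_zero] at h2
      rw [← neg_sub, h2, neg_neg]
    have hu : ∃ z, S z - z = Q w := by
      let D : X →ₗ[ℝ] X := (S : X →ₗ[ℝ] X) - LinearMap.id
      have hD : ∀ x ∈ Q.range, D x ∈ Q.range := by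
        rintro _ ⟨x, rfl⟩
        refine ⟨S x - x, ?_⟩
        change Q (S x - x) = S (Q x) - Q x
        rw [map_sub, hcomm]
      have hinj : Function.Injective (D.restrict hD) := by
        rw [injective_iff_map_eq_zero]
        rintro ⟨_, ⟨x, rfl⟩⟩ hx
        have hx' : S (Q x) - Q x = 0 := congrArg Subtype.val hx
        have := hlow1 (Q x) (hQQ x)
        rw [hx', norm_zero] at this
        exact Subtype.ext (norm_le_zero_iff.1 this)
      obtain ⟨⟨z, hz⟩, h⟩ := LinearMap.injective_iff_surjective.1 hinj ⟨Q w, ⟨w, rfl⟩⟩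
      exact ⟨z, congrArg Subtype.val h⟩
    obtain ⟨z, hz⟩ := hs
    obtain ⟨z', hz'⟩ := hu
    refine ⟨z + z', ?_⟩
    simp only [map_add]
    calc _ = (S z - z) + (S z' - z') := by abel
      _ = w := by rw [hz, hz']; abel

/-- The factor `e^{-iωt}` has modulus 1 and preserves every norm estimate of the dichotomy. A single
large `t` therefore serves all `ω`, which makes the resolvent bound uniform. -/
theorem HasExponentialDichotomy.exists_isResolventAt {G : C0Semigroup H} {j : ℕ}
    (h : G.HasExponentialDichotomy j) : ∃ C : ℝ, 0 ≤ C ∧ ∀ ω : ℝ,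
      ∃ R, G.generator.complexify.IsResolventAt (Complex.I * ω) R ∧ ‖R‖ ≤ C := by
  obtain ⟨Q, hQQ, hfin, -, hcomm, -, ε, K, hε, hK, hst, hun⟩ := h
  have hQQ' : ∀ x, Q (Q x) = Q x := fun x => congrArg (fun T : H →L[ℝ] H => T x) hQQ
  let P : Complexification H →L[ℝ] Complexification H := Q.complexify.restrictScalars ℝ
  have hP : ∀ z, P z = Q.complexify z := fun z => rfl
  have hPP : ∀ z, P (P z) = P z := fun z => by ext <;> simp [hP, hQQ']
  have hPfin : FiniteDimensional ℝ P.range := by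
    let J : Complexification H →ₗ[ℝ] Complexification H :=
      { toFun := fun z => Complex.I • z
        map_add' := smul_add _
        map_smul' := fun r z => smul_comm _ _ _ }
    -- The real dimension stays finite: the complexified range is spanned by `Ran Q` and `i Ran Q`.
    have hle : P.range ≤ Q.range.map (ofReal : H →L[ℝ] Complexification H).toLinearMap ⊔
        Q.range.map (J ∘ₗ (ofReal : H →L[ℝ] Complexification H).toLinearMap) := by
      rintro _ ⟨z, rfl⟩
      have e : P z = ofReal (Q z.re) + Complex.I • ofReal (Q z.im) := by
        ext <;> simp [hP]
      change P z ∈ _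
      rw [e]
      exact Submodule.add_mem_sup ⟨_, ⟨_, rfl⟩, rfl⟩ ⟨_, ⟨_, rfl⟩, rfl⟩
    exact Submodule.finiteDimensional_of_le hle
  have hlim : Tendsto (fun t : ℝ => K * Real.exp (-ε * t) * (1 + ‖P‖)) atTop (𝓝 0) := by
    have h1 : Tendsto (fun t : ℝ => Real.exp (-ε * t)) atTop (𝓝 0) :=
      Real.tendsto_exp_atBot.comp
        ((tendsto_const_mul_atBot_of_neg (by linarith)).2 tendsto_id)
    simpa using (h1.const_mul K).mul_const (1 + ‖P‖)
  obtain ⟨t, ht, ht0⟩ := ((hlim.eventually_le_const (u := 1 / 2) (by norm_num)).and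
    (eventually_ge_atTop 0)).exists
  obtain ⟨M, hM1, hM⟩ := G.exists_norm_op_le t
  have ha0 : 0 ≤ K * Real.exp (-ε * t) := by positivity
  have hnorm : ∀ (ω s : ℝ) (z : Complexification H),
      ‖(G.twist (Complex.I * ω)).op s z‖ = ‖(G.op s).complexify z‖ := fun ω s z => by
    rw [twist_op, norm_smul, norm_exp_neg_I_mul, one_mul]
  refine ⟨t * M * (2 + 3 * ‖P‖), by positivity, fun ω => ?_⟩
  obtain ⟨hlow, hsurj⟩ := surjective_sub_of_dichotomy (S := (G.twist (Complex.I * ω)).op t) hPP hPfin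
    (fun z => by
      rw [hP, hP, twist_op, twist_op, map_smul]
      congr 1
      have := fun x => congrArg (fun T : H →L[ℝ] H => T x) (hcomm t ht0)
      ext
      · exact this z.re
      · exact this z.im) ha0 ht
    (fun z hz => by
      rw [hnorm]
      exact norm_le_of_re_im ha0 (hst t ht0 _ (congrArg re hz)) (hst t ht0 _ (congrArg im hz)))
    (fun z hz => by
      rw [hnorm]
      exact norm_le_of_re_im ha0 (hun t ht0 _ ⟨z.re, congrArg re hz⟩)
        (hun t ht0 _ ⟨z.im, congrArg im hz⟩))
  refine exists_isResolventAt_of_bijective ht0 (by positivity) hlow hsurj (by linarith) fun s h0 h1 => ?_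
  refine ContinuousLinearMap.opNorm_le_bound _ (by linarith) fun z => ?_
  rw [hnorm]
  exact norm_complexify_apply_le (by linarith) (hM s h0 h1) z

end C0Semigroup


theorem MeasureTheory.MemLp.integrable_inner_of_two {𝕜 E α : Type*} [RCLike 𝕜]
    [NormedAddCommGroup E] [InnerProductSpace 𝕜 E] [MeasurableSpace α] {μ : Measure α} {f g : α → E}
    (hf : MemLp f 2 μ) (hg : MemLp g 2 μ) : Integrable (fun x => inner 𝕜 (f x) (g x)) μ := by
  refine (L2.integrable_inner (𝕜 := 𝕜) (hf.toLp f) (hg.toLp g)).congr ?_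
  filter_upwards [hf.coeFn_toLp, hg.coeFn_toLp] with x h1 h2
  rw [h1, h2]

/-! ### Plancherel's theorem for integrable square-integrable functions -/

section Plancherel

open scoped FourierTransform ContDiff

variable {E F : Type*} [NormedAddCommGroup E] [InnerProductSpace ℂ E] [CompleteSpace E]
  [NormedAddCommGroup F] [InnerProductSpace ℂ F] [CompleteSpace F]

theorem continuous_fourier_of_integrable {f : ℝ → E} (h1 : Integrable f) : Continuous (𝓕 f) :=
  VectorFourier.fourierIntegral_continuous Real.continuous_fourierChar
    (innerSL ℝ).continuous₂ h1

/-- The `L²` Fourier transform of an integrable function is given by the Fourier integral. -/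
theorem coeFn_fourier_toLp {f : ℝ → E} (h1 : Integrable f) (h2 : MemLp f 2) :
    (𝓕 (h2.toLp f) : Lp E 2 (volume : Measure ℝ)) =ᵐ[volume] 𝓕 f := by
  refine ae_eq_of_integral_contDiff_smul_eq
    ((Lp.memLp (𝓕 (h2.toLp f) : Lp E 2 (volume : Measure ℝ))).locallyIntegrable one_le_two)
    (continuous_fourier_of_integrable h1).locallyIntegrable ?_
  intro g hg hgc
  have hg1 : HasCompactSupport (Complex.ofRealCLM ∘ g) := hgc.comp_left rfl
  have hg2 : ContDiff ℝ ∞ (Complex.ofRealCLM ∘ g) := by fun_prop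
  set G : SchwartzMap ℝ ℂ := hg1.toSchwartzMap hg2 with hG
  have hGx : ∀ x, G x = (g x : ℂ) := fun x => by simp [hG]
  -- Both transforms are tested against a smooth compactly supported function. For the `L²`
  -- transform the Fourier transform passes to the test function by the definition on tempered
  -- distributions, for the Fourier integral by Fubini.
  have e1 := congrArg (fun T => T G) (Lp.fourier_toTemperedDistribution_eq (h2.toLp f))
  simp only [TemperedDistribution.fourier_apply, Lp.toTemperedDistribution_apply] at e1
  have e2 : ∫ x, (𝓕 G) x • (h2.toLp f) x = ∫ x, (𝓕 G) x • f x := by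
    refine integral_congr_ae ?_
    filter_upwards [h2.coeFn_toLp] with x hx
    rw [hx]
  have e3 : ∫ x, (𝓕 (G : ℝ → ℂ)) x • f x = ∫ x, G x • 𝓕 f x := by
    have := VectorFourier.integral_fourierIntegral_smul_eq_flip (L := innerₗ ℝ)
      Real.continuous_fourierChar continuous_inner G.integrable h1 (μ := volume) (ν := volume)
    rw [flip_innerₗ] at this
    exact this
  rw [e2, SchwartzMap.fourier_coe, e3] at e1
  simp only [hGx] at e1
  exact e1.symm

theorem memLp_fourier {f : ℝ → E} (h1 : Integrable f) (h2 : MemLp f 2) : MemLp (𝓕 f) 2 :=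
  (memLp_congr_ae (coeFn_fourier_toLp h1 h2)).1 (Lp.memLp _)

theorem integral_inner_fourier {f g : ℝ → E} (hf1 : Integrable f) (hf2 : MemLp f 2)
    (hg1 : Integrable g) (hg2 : MemLp g 2) :
    ∫ w, ⟪𝓕 f w, 𝓕 g w⟫_ℂ = ∫ x, ⟪f x, g x⟫_ℂ := by
  have h := Lp.inner_fourier_eq (hf2.toLp f) (hg2.toLp g)
  rw [L2.inner_def, L2.inner_def] at h
  have e1 : ∫ w, ⟪𝓕 f w, 𝓕 g w⟫_ℂ =
      ∫ w, ⟪(𝓕 (hf2.toLp f) : Lp E 2 (volume : Measure ℝ)) w,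
        (𝓕 (hg2.toLp g) : Lp E 2 (volume : Measure ℝ)) w⟫_ℂ := by
    refine integral_congr_ae ?_
    filter_upwards [coeFn_fourier_toLp hf1 hf2, coeFn_fourier_toLp hg1 hg2] with w h1 h2
    rw [h1, h2]
  have e2 : ∫ x, ⟪f x, g x⟫_ℂ = ∫ x, ⟪(hf2.toLp f) x, (hg2.toLp g) x⟫_ℂ := by
    refine integral_congr_ae ?_
    filter_upwards [hf2.coeFn_toLp, hg2.coeFn_toLp] with w h1 h2
    rw [h1, h2]
  rw [e1, e2, h]

theorem integral_re_inner_fourier {f g : ℝ → E} (hf1 : Integrable f) (hf2 : MemLp f 2)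
    (hg1 : Integrable g) (hg2 : MemLp g 2) :
    ∫ w, (⟪𝓕 f w, 𝓕 g w⟫_ℂ).re = ∫ x, (⟪f x, g x⟫_ℂ).re := by
  have e1 := integral_re (𝕜 := ℂ)
    ((memLp_fourier hf1 hf2).integrable_inner_of_two (𝕜 := ℂ) (memLp_fourier hg1 hg2))
  have e2 := integral_re (𝕜 := ℂ) (hf2.integrable_inner_of_two (𝕜 := ℂ) hg2)
  rw [integral_inner_fourier hf1 hf2 hg1 hg2] at e1
  exact e1.trans e2.symm

theorem fourier_clm_comp (T : E →L[ℂ] F) {f : ℝ → E} (h1 : Integrable f) :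
    𝓕 (fun x => T (f x)) = fun w => T (𝓕 f w) := by
  ext w
  rw [Real.fourier_real_eq, Real.fourier_real_eq, ← ContinuousLinearMap.integral_comp_comm]
  · simp only [Circle.smul_def, map_smul]
  · have := (Real.fourierIntegral_convergent_iff (μ := volume) (f := f) w).2 h1
    refine this.congr (Eventually.of_forall fun v => ?_)
    simp [mul_comm]

theorem integral_norm_sq_fourier_of_integrable {f : ℝ → E} (hf1 : Integrable f) (hf2 : MemLp f 2) :
    ∫ w, ‖𝓕 f w‖ ^ 2 = ∫ x, ‖f x‖ ^ 2 := by
  have := integral_re_inner_fourier hf1 hf2 hf1 hf2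
  have e : ∀ y : E, (⟪y, y⟫_ℂ).re = ‖y‖ ^ 2 := fun y => (norm_sq_eq_re_inner (𝕜 := ℂ) y).symm
  simpa only [e] using this

end Plancherel

/-! ### Integrals of mild solutions -/

namespace C0Semigroup

variable {H : Type*} [NormedAddCommGroup H] [InnerProductSpace ℝ H] [CompleteSpace H]

/-- Fubini on the triangle `0 < s ≤ t ≤ T`: for fixed `s`, integrating `G(t - s) f(s)` over `t` from
`s` to `T` gives the integrated semigroup at `T - s`. -/
theorem integral_mild_zero (G : C0Semigroup H) {f : ℝ → H} {T : ℝ} (hT : 0 ≤ T)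
    (hf : IntervalIntegrable f volume 0 T) :
    ∫ t in (0 : ℝ)..T, G.mild 0 f t = ∫ s in (0 : ℝ)..T, G.integrated (T - s) (f s) := by
  obtain ⟨M, hM1, hM⟩ := G.exists_norm_op_le T
  have hf' := (intervalIntegrable_iff_integrableOn_Ioc_of_le hT).1 hf
  set μ : Measure ℝ := volume.restrict (Ioc 0 T) with hμ
  let Φ : ℝ → ℝ → H := fun t s => (Iic t).indicator (fun s => G.op (max (t - s) 0) (f s)) s
  have h1 : ∀ t ∈ Ioc 0 T, G.mild 0 f t = ∫ s, Φ t s ∂μ := fun t ht => by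
    rw [mild, map_zero, zero_add, intervalIntegral.integral_of_le ht.1.le,
      setIntegral_indicator measurableSet_Iic]
    have : Ioc 0 T ∩ Iic t = Ioc 0 t := by
      ext s
      simp only [mem_inter_iff, mem_Ioc, mem_Iic]
      have := ht.2
      constructor
      · rintro ⟨⟨a, b⟩, c⟩; exact ⟨a, c⟩
      · rintro ⟨a, c⟩; exact ⟨⟨a, by linarith⟩, c⟩
    rw [this]
    refine setIntegral_congr_fun measurableSet_Ioc fun s hs => ?_
    rw [max_eq_left (by linarith [hs.2])]
  have h2 : ∀ s ∈ Ioc 0 T, ∫ t, Φ t s ∂μ = G.integrated (T - s) (f s) := fun s hs => by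
    have e : (fun t => Φ t s) = (Ici s).indicator fun t => G.op (max (t - s) 0) (f s) := by
      ext t
      by_cases h : s ≤ t
      · simp only [Φ]
        rw [indicator_of_mem (show s ∈ Iic t from h), indicator_of_mem (show t ∈ Ici s from h)]
      · simp only [Φ]
        rw [indicator_of_notMem (show s ∉ Iic t from h), indicator_of_notMem (show t ∉ Ici s from h)]
    rw [e, setIntegral_indicator measurableSet_Ici]
    have : Ioc 0 T ∩ Ici s = Icc s T := by
      ext t
      simp only [mem_inter_iff, mem_Ioc, mem_Ici, mem_Icc]
      have := hs.1
      constructor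
      · rintro ⟨⟨a, b⟩, c⟩; exact ⟨c, b⟩
      · rintro ⟨a, c⟩; exact ⟨⟨by linarith, c⟩, a⟩
    rw [this, integral_Icc_eq_integral_Ioc, ← intervalIntegral.integral_of_le hs.2,
      intervalIntegral.integral_comp_sub_right (fun t => G.op (max t 0) (f s)), sub_self]
    rfl
  rw [intervalIntegral.integral_of_le hT, intervalIntegral.integral_of_le hT,
    setIntegral_congr_fun measurableSet_Ioc h1, ← setIntegral_congr_fun measurableSet_Ioc h2]
  refine integral_integral_swap ?_
  refine Integrable.mono' (g := fun p : ℝ × ℝ => M * ‖f p.2‖)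
    (((integrable_const M).mul_prod hf'.norm)) ?_ ?_
  · have e : Function.uncurry Φ =
        {p : ℝ × ℝ | p.2 ≤ p.1}.indicator fun p => G.op (max (p.1 - p.2) 0) (f p.2) := by
      ext ⟨t, s⟩
      by_cases h : s ≤ t
      · simp only [Φ, Function.uncurry]
        rw [indicator_of_mem (show s ∈ Iic t from h),
          indicator_of_mem (show (t, s) ∈ {p : ℝ × ℝ | p.2 ≤ p.1} from h)]
      · simp only [Φ, Function.uncurry]
        rw [indicator_of_notMem (show s ∉ Iic t from h),
          indicator_of_notMem (show (t, s) ∉ {p : ℝ × ℝ | p.2 ≤ p.1} from h)]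
    rw [e]
    refine AEStronglyMeasurable.indicator ?_ (measurableSet_le measurable_snd measurable_fst)
    refine G.continuous_op_max_uncurry.comp_aestronglyMeasurable
      (f := fun p : ℝ × ℝ => (p.1 - p.2, f p.2)) ?_
    exact (continuous_fst.sub continuous_snd).aestronglyMeasurable.prodMk hf'.1.comp_snd
  · have : ∀ᵐ p ∂(μ.prod μ), p ∈ Ioc 0 T ×ˢ Ioc 0 T := by
      rw [hμ, Measure.prod_restrict]
      exact self_mem_ae_restrict (measurableSet_Ioc.prod measurableSet_Ioc)
    filter_upwards [this] with p hp
    obtain ⟨⟨h1, h2⟩, h3, h4⟩ := hp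
    refine (norm_indicator_le_norm_self (s := Iic p.1)
      (fun s => G.op (max (p.1 - s) 0) (f s)) p.2).trans ?_
    exact (G.op _).le_of_opNorm_le (hM _ (le_max_right _ _) (max_le (by linarith) hT)) _

end C0Semigroup

/-! ### The transform of an admissible pair -/

namespace C0Semigroup

open Complexification

variable {H U : Type*} [NormedAddCommGroup H] [InnerProductSpace ℝ H] [CompleteSpace H]
  [NormedAddCommGroup U] [InnerProductSpace ℝ U] [CompleteSpace U]

/-- The resolvent is taken at `q` while the semigroup is damped by `p`. With `q` on the imaginary
axis and `p = q + ε`, no resolvent off the axis is needed. -/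
theorem integrated_twist_eq_resolvent {G : C0Semigroup H} {p q : ℂ}
    {R : Complexification H →L[ℂ] Complexification H}
    (hR : G.generator.complexify.IsResolventAt q R) {t : ℝ} (ht : 0 ≤ t) (z : Complexification H) :
    (G.twist p).integrated t z =
      R ((G.twist p).op t z - z + (p - q) • (G.twist p).integrated t z) :=
  ((isResolventAt_iff.1 hR).2 _ _
    (((G.twist p).hasGeneratorAt_integrated ht z).twist_change q)).symm

theorem integral_mild_twist_eq_resolvent {G : C0Semigroup H} {p q : ℂ}
    {R : Complexification H →L[ℂ] Complexification H}
    (hR : G.generator.complexify.IsResolventAt q R) {f : ℝ → Complexification H} {T : ℝ} (hT : 0 ≤ T)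
    (hf : IntervalIntegrable f volume 0 T) :
    ∫ t in (0 : ℝ)..T, (G.twist p).mild 0 f t =
      R ((G.twist p).mild 0 f T - (∫ s in (0 : ℝ)..T, f s) +
        (p - q) • ∫ t in (0 : ℝ)..T, (G.twist p).mild 0 f t) := by
  set S := G.twist p
  have hS := S.intervalIntegrable_op hT le_rfl hf
  have hV : IntervalIntegrable (fun s => S.integrated (T - s) (f s)) volume 0 T := by
    obtain ⟨M, hM1, hM⟩ := S.exists_norm_op_le T
    rw [intervalIntegrable_iff_integrableOn_Ioc_of_le hT] at hf ⊢
    have hcont : Continuous fun q : ℝ × Complexification H =>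
        ∫ r in (0 : ℝ)..q.1, S.op (max r 0) q.2 := by
      refine intervalIntegral.continuous_parametric_intervalIntegral_of_continuous
        (f := fun (q : ℝ × Complexification H) r => S.op (max r 0) q.2) ?_ continuous_fst
      exact S.continuous_op_max_uncurry.comp
        (continuous_snd.prodMk (continuous_snd.comp continuous_fst))
    refine Integrable.mono' (hf.norm.const_mul (T * M)) ?_ ?_
    · exact hcont.comp_aestronglyMeasurable (f := fun s => (T - s, f s))
        ((continuous_const.sub continuous_id).aestronglyMeasurable.prodMk hf.1)
    · filter_upwards [self_mem_ae_restrict measurableSet_Ioc] with s hs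
      refine (S.norm_integrated_le (by linarith [hs.2]) (M := M)
        (fun r h0 h1 => hM r h0 (by linarith [hs.1])) (f s)).trans ?_
      have : T - s ≤ T := by linarith [hs.1]
      gcongr
  have e : ∫ s in (0 : ℝ)..T, S.integrated (T - s) (f s) =
      ∫ s in (0 : ℝ)..T, R (S.op (T - s) (f s) - f s + (p - q) • S.integrated (T - s) (f s)) := by
    refine intervalIntegral.integral_congr fun s hs => ?_
    rw [uIcc_of_le hT] at hs
    exact integrated_twist_eq_resolvent hR (by linarith [hs.2]) (f s)
  rw [S.integral_mild_zero hT hf]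
  conv_lhs => rw [e]
  have hV' : IntervalIntegrable (fun s => (p - q) • S.integrated (T - s) (f s)) volume 0 T :=
    hV.smul (p - q)
  rw [ContinuousLinearMap.intervalIntegral_comp_comm _ ((hS.sub hf).add hV'),
    intervalIntegral.integral_add (hS.sub hf) hV',
    intervalIntegral.integral_sub hS hf, intervalIntegral.integral_smul, mild, map_zero, zero_add]

/-- Integrability is Hölder's inequality, as the exponential is itself in `L²`; square-integrability
holds because its modulus is at most 1 on the half-line. -/
theorem integrable_exp_smul_ofReal {E : Type*} [NormedAddCommGroup E] [InnerProductSpace ℝ E]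
    {v : ℝ → E} (hv : MemLp v 2 (volume.restrict (Ioi 0))) {p : ℂ} (hp : 0 < p.re) :
    IntegrableOn (fun t : ℝ => Complex.exp (-p * t) • ofReal (v t)) (Ioi 0) ∧
    MemLp (fun t : ℝ => Complex.exp (-p * t) • ofReal (v t)) 2 (volume.restrict (Ioi 0)) := by
  have hof : MemLp (fun t => ofReal (v t)) 2 (volume.restrict (Ioi 0)) :=
    (ofReal : E →L[ℝ] Complexification E).comp_memLp' hv
  have hmeas : AEStronglyMeasurable (fun t : ℝ => Complex.exp (-p * t)) (volume.restrict (Ioi 0)) :=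
    (by fun_prop : Continuous fun t : ℝ => Complex.exp (-p * t)).aestronglyMeasurable
  have hexp : MemLp (fun t : ℝ => Complex.exp (-p * t)) 2 (volume.restrict (Ioi 0)) := by
    rw [memLp_two_iff_integrable_sq_norm hmeas]
    have := integrableOn_exp_mul_Ioi (a := -2 * p.re) (by linarith) 0
    refine this.congr (Eventually.of_forall fun t => ?_)
    simp only
    rw [norm_exp_neg_mul, ← Real.exp_nat_mul]
    congr 1
    push_cast
    ring
  constructor
  · have := hof.smul (r := 1) hexp
    exact memLp_one_iff_integrable.1 this
  · refine hof.of_le_mul (c := 1) (hmeas.smul hof.1) ?_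
    filter_upwards [self_mem_ae_restrict measurableSet_Ioi] with t ht
    rw [norm_smul, norm_exp_neg_mul]
    refine mul_le_mul_of_nonneg_right ?_ (norm_nonneg _)
    rw [Real.exp_le_one_iff]
    nlinarith [mem_Ioi.1 ht]

/-- The Laplace transform of an admissible pair through the origin. -/
theorem IsAdmissiblePair.laplace_eq {G : C0Semigroup H} {B : U →L[ℝ] H} {v : ℝ → H} {ξ : ℝ → U}
    (h : G.IsAdmissiblePair B 0 v ξ) {p q : ℂ} (hp : 0 < p.re)
    {R : Complexification H →L[ℂ] Complexification H}
    (hR : G.generator.complexify.IsResolventAt q R) :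
    ∫ t in Ioi (0 : ℝ), Complex.exp (-p * t) • ofReal (v t) =
      R ((p - q) • (∫ t in Ioi (0 : ℝ), Complex.exp (-p * t) • ofReal (v t)) -
        B.complexify (∫ t in Ioi (0 : ℝ), Complex.exp (-p * t) • ofReal (ξ t))) := by
  obtain ⟨hv, hξ, hm⟩ := h
  have hBξ : MemLp (fun s => B (ξ s)) 2 (volume.restrict (Ioi 0)) := B.comp_memLp' hξ
  obtain ⟨hvi, -⟩ := integrable_exp_smul_ofReal hv hp
  obtain ⟨hξi, -⟩ := integrable_exp_smul_ofReal hξ hp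
  obtain ⟨hfi, -⟩ := integrable_exp_smul_ofReal hBξ hp
  set f : ℝ → Complexification H := fun t => Complex.exp (-p * t) • ofReal (B (ξ t)) with hf
  have hfeq : ∫ t in Ioi (0 : ℝ), f t =
      B.complexify (∫ t in Ioi (0 : ℝ), Complex.exp (-p * t) • ofReal (ξ t)) := by
    rw [← ContinuousLinearMap.integral_comp_comm _ hξi]
    refine setIntegral_congr_fun measurableSet_Ioi fun t _ => ?_
    simp only [hf]
    rw [map_smul, complexify_ofReal]
  have hfT : ∀ T, 0 ≤ T → IntervalIntegrable f volume 0 T := fun T hT =>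
    IntegrableOn.intervalIntegrable_of_Ioi hfi le_rfl hT
  -- The damped process is the mild solution for the damped semigroup with damped control.
  have hmild : ∀ t, 0 ≤ t → (G.twist p).mild 0 f t = Complex.exp (-p * t) • ofReal (v t) := by
    intro t ht
    rw [hm t ht, mild, map_zero, map_zero, zero_add, zero_add,
      ← ContinuousLinearMap.intervalIntegral_comp_comm _
        (G.intervalIntegrable_op ht le_rfl (hBξ.intervalIntegrable_of_Ioi le_rfl ht)),
      ← intervalIntegral.integral_smul]
    refine intervalIntegral.integral_congr fun s hs => ?_
    simp only [hf]
    rw [twist_op, map_smul, smul_smul, ← Complex.exp_add, complexify_ofReal]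
    congr 2
    push_cast
    ring
  have hZ : ∀ T, 0 ≤ T → ∫ t in (0 : ℝ)..T, (G.twist p).mild 0 f t =
      ∫ t in (0 : ℝ)..T, Complex.exp (-p * t) • ofReal (v t) := fun T hT =>
    intervalIntegral.integral_congr fun t ht => hmild t (by rw [uIcc_of_le hT] at ht; exact ht.1)
  have hv0 : Tendsto v atTop (𝓝 0) := G.tendsto_mild_zero hv hBξ hm
  have hw0 : Tendsto (fun T : ℝ => Complex.exp (-p * T) • ofReal (v T)) atTop (𝓝 0) := by
    refine squeeze_zero_norm' ?_ (tendsto_zero_iff_norm_tendsto_zero.1 hv0)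
    filter_upwards [eventually_ge_atTop 0] with T hT
    rw [norm_smul, norm_exp_neg_mul, norm_ofReal]
    refine mul_le_of_le_one_left (norm_nonneg _) ?_
    rw [Real.exp_le_one_iff]
    nlinarith
  have hlimZ := intervalIntegral_tendsto_integral_Ioi 0 hvi tendsto_id
  have hlimf := intervalIntegral_tendsto_integral_Ioi 0 hfi tendsto_id
  rw [← hfeq]
  refine tendsto_nhds_unique hlimZ ?_
  -- The finite-time identity contains the boundary value of the damped process at `T`; it vanishes
  -- in the limit because `v(T) → 0`.
  have hrhs := (R.continuous.tendsto _).comp ((hw0.sub hlimf).add (hlimZ.const_smul (p - q)))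
  rw [zero_sub, neg_add_eq_sub] at hrhs
  refine hrhs.congr' ?_
  filter_upwards [eventually_ge_atTop 0] with T hT
  have := integral_mild_twist_eq_resolvent (p := p) hR hT (hfT T hT)
  rw [hZ T hT, hmild T hT] at this
  exact this.symm

end C0Semigroup


/-! ### Coercivity of the quadratic functional -/

section QuadFormC

open Complexification

variable {H U : Type*} [NormedAddCommGroup H] [InnerProductSpace ℝ H]
  [NormedAddCommGroup U] [InnerProductSpace ℝ U]

/-- In this form every term is a complex inner product, to which Plancherel's identity applies. -/
theorem quadFormC_eq_re_inner (F₁ : H →L[ℝ] H) (F₂ : H →L[ℝ] U) (F₃ : U →L[ℝ] U)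
    (z : Complexification H) (ξ : Complexification U) :
    quadFormC F₁ F₂ F₃ z ξ = (⟪F₁.complexify z, z⟫_ℂ).re + 2 * (⟪F₂.complexify z, ξ⟫_ℂ).re +
      (⟪F₃.complexify ξ, ξ⟫_ℂ).re := by
  simp only [quadFormC, quadForm, inner_def, re_complexify, im_complexify]
  ring

theorem re_inner_complexify_le (T : H →L[ℝ] U) (z : Complexification H) (w : Complexification U) :
    (⟪T.complexify z, w⟫_ℂ).re ≤ ‖T‖ * ‖z‖ * ‖w‖ :=
  have h : (⟪T.complexify z, w⟫_ℂ).re ≤ ‖T.complexify z‖ * ‖w‖ :=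
    (Complex.re_le_norm _).trans (norm_inner_le_norm _ _)
  h.trans (mul_le_mul_of_nonneg_right
    (norm_complexify_apply_le (norm_nonneg _) le_rfl z) (norm_nonneg _))

/-- Used to replace the exact value `x = -(A - iω)⁻¹ B ξ` by the transform `z` of a damped process,
at a cost linear in `‖z - x‖`. -/
theorem quadFormC_le_add (F₁ : H →L[ℝ] H) (F₂ : H →L[ℝ] U) (F₃ : U →L[ℝ] U)
    (x z : Complexification H) (ξ : Complexification U) :
    quadFormC F₁ F₂ F₃ x ξ ≤ quadFormC F₁ F₂ F₃ z ξ +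
      (‖F₁‖ * ‖z - x‖ * (‖z‖ + ‖x‖) + 2 * (‖F₂‖ * ‖z - x‖ * ‖ξ‖)) := by
  have h1 := re_inner_complexify_le F₁ (x - z) x
  have h2 := re_inner_complexify_le F₁ z (x - z)
  have h3 := re_inner_complexify_le F₂ (x - z) ξ
  have h4 := re_inner_complexify_le F₁ (x - z) z
  rw [norm_sub_rev] at h1 h2 h3
  have e1 : (⟪F₁.complexify x, x⟫_ℂ).re = (⟪F₁.complexify z, z⟫_ℂ).re +
      (⟪F₁.complexify (x - z), x⟫_ℂ).re + (⟪F₁.complexify z, x - z⟫_ℂ).re := by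
    rw [map_sub, inner_sub_left, inner_sub_right, Complex.sub_re, Complex.sub_re]
    ring
  have e2 : (⟪F₂.complexify x, ξ⟫_ℂ).re = (⟪F₂.complexify z, ξ⟫_ℂ).re +
      (⟪F₂.complexify (x - z), ξ⟫_ℂ).re := by
    rw [map_sub, inner_sub_left, Complex.sub_re]
    ring
  rw [quadFormC_eq_re_inner, quadFormC_eq_re_inner, e1, e2]
  linarith

end QuadFormC

/-- Here `α`, `β` are the norms of the transforms of `v`, `ξ`, while `χ` is the norm of the exact
transfer value and `d` its distance to the transform of `v`. Up to terms of order `ε`, `α² ≤ M²β²`,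
so `δ/(M² + 1) (α² + β²) ≤ δβ² ≤ q`. The condition `ε ≤ 1` absorbs `ε²` into `ε`. -/
theorem frequency_estimate_aux {α β χ d ε δ C M f₁ f₂ q q' : ℝ} (hα : 0 ≤ α) (hβ : 0 ≤ β)
    (hχ : 0 ≤ χ) (hε : 0 ≤ ε) (hε1 : ε ≤ 1) (hδ : 0 ≤ δ) (hC : 0 ≤ C) (hM : 0 ≤ M)
    (hf₁ : 0 ≤ f₁) (hf₂ : 0 ≤ f₂) (h1 : d ≤ ε * C * α) (h2 : χ ≤ M * β) (h3 : α ≤ χ + d)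
    (h4 : χ ≤ α + d) (hq : δ * β ^ 2 ≤ q) (hq' : q ≤ q' + (f₁ * d * (α + χ) + 2 * (f₂ * d * β))) :
    δ / (M ^ 2 + 1) * (α ^ 2 + β ^ 2) ≤ q' + ε * (δ / (M ^ 2 + 1) * (M * C + C ^ 2) +
      f₁ * C * (2 + C) + f₂ * C) * (α ^ 2 + β ^ 2) := by
  set κ := δ / (M ^ 2 + 1) with hκ
  have hκ0 : 0 ≤ κ := by positivity
  have hκδ : κ * (M ^ 2 + 1) = δ := by rw [hκ]; field_simp
  have hab : 2 * (α * β) ≤ α ^ 2 + β ^ 2 := by nlinarith [sq_nonneg (α - β)]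
  have hεα : ε * C * α ≤ C * α := by
    have : 0 ≤ C * α := by positivity
    nlinarith
  have a1 : α ^ 2 ≤ M ^ 2 * β ^ 2 + ε * (M * C + C ^ 2) * (α ^ 2 + β ^ 2) := by
    have h5 : α ≤ M * β + ε * C * α := by linarith
    have h6 : α ^ 2 ≤ (M * β + ε * C * α) ^ 2 := pow_le_pow_left₀ hα h5 2
    have h7 : (M * β + ε * C * α) ^ 2 =
        M ^ 2 * β ^ 2 + ε * (M * C) * (2 * (α * β)) + ε * (ε * (C ^ 2 * α ^ 2)) := by ring
    have h8 : ε * (M * C) * (2 * (α * β)) ≤ ε * (M * C) * (α ^ 2 + β ^ 2) := by gcongr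
    have h9 : ε * (ε * (C ^ 2 * α ^ 2)) ≤ ε * (1 * (C ^ 2 * (α ^ 2 + β ^ 2))) := by
      gcongr
      nlinarith
    calc _ ≤ _ := h6
      _ = _ := h7
      _ ≤ _ := add_le_add (add_le_add le_rfl h8) h9
      _ = _ := by ring
  have a2 : f₁ * d * (α + χ) ≤ ε * (f₁ * C * (2 + C)) * (α ^ 2 + β ^ 2) := by
    have : α + χ ≤ (2 + C) * α := by linarith
    calc f₁ * d * (α + χ) ≤ f₁ * (ε * C * α) * ((2 + C) * α) := by gcongr
      _ = ε * (f₁ * C * (2 + C)) * α ^ 2 := by ring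
      _ ≤ _ := by
        gcongr
        nlinarith
  have a3 : 2 * (f₂ * d * β) ≤ ε * (f₂ * C) * (α ^ 2 + β ^ 2) := by
    calc 2 * (f₂ * d * β) ≤ 2 * (f₂ * (ε * C * α) * β) := by gcongr
      _ = ε * (f₂ * C) * (2 * (α * β)) := by ring
      _ ≤ _ := by gcongr
  calc κ * (α ^ 2 + β ^ 2)
      ≤ κ * ((M ^ 2 * β ^ 2 + ε * (M * C + C ^ 2) * (α ^ 2 + β ^ 2)) + β ^ 2) := by gcongr
    _ = κ * (M ^ 2 + 1) * β ^ 2 + ε * (κ * (M * C + C ^ 2)) * (α ^ 2 + β ^ 2) := by ring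
    _ = δ * β ^ 2 + ε * (κ * (M * C + C ^ 2)) * (α ^ 2 + β ^ 2) := by rw [hκδ]
    _ ≤ _ := by linarith

namespace C0Semigroup

open Complexification
open scoped FourierTransform

variable {H U : Type*} [NormedAddCommGroup H] [InnerProductSpace ℝ H] [CompleteSpace H]
  [NormedAddCommGroup U] [InnerProductSpace ℝ U] [CompleteSpace U]

theorem HasExponentialDichotomy.bddAbove_norm_transfer {G : C0Semigroup H} {j : ℕ}
    (h : G.HasExponentialDichotomy j) (B : U →L[ℝ] H) :
    BddAbove (Set.range fun ω : ℝ => ‖G.transfer B ω‖) := by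
  obtain ⟨C, hC0, hC⟩ := h.exists_isResolventAt
  refine ⟨C * ‖B.complexify‖, ?_⟩
  rintro _ ⟨ω, rfl⟩
  obtain ⟨R, hR, hRC⟩ := hC ω
  have e := isResolventAt_unique (isResolventAt_resolventAt ⟨R, hR⟩) hR
  simp only [transfer]
  rw [e]
  exact (ContinuousLinearMap.opNorm_comp_le _ _).trans (by gcongr)

/-- The function `e^{-εt} v(t)` on `(0, ∞)`, extended by zero, with values in the
complexification. -/
noncomputable def damped {E : Type*} [NormedAddCommGroup E] [InnerProductSpace ℝ E]
    (ε : ℝ) (v : ℝ → E) : ℝ → Complexification E :=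
  (Ioi (0 : ℝ)).indicator fun t => Complex.exp (-(ε : ℂ) * t) • ofReal (v t)

section Damped

variable {E : Type*} [NormedAddCommGroup E] [InnerProductSpace ℝ E] {v : ℝ → E} {ε : ℝ}

theorem integrable_damped (hv : MemLp v 2 (volume.restrict (Ioi 0))) (hε : 0 < ε) :
    Integrable (damped ε v) :=
  (integrable_indicator_iff measurableSet_Ioi).2
    (integrable_exp_smul_ofReal hv (p := ε) (by simpa using hε)).1

theorem memLp_damped (hv : MemLp v 2 (volume.restrict (Ioi 0))) (hε : 0 < ε) :
    MemLp (damped ε v) 2 :=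
  (memLp_indicator_iff_restrict measurableSet_Ioi).2
    (integrable_exp_smul_ofReal hv (p := ε) (by simpa using hε)).2

theorem fourier_damped (w : ℝ) : 𝓕 (damped ε v) w =
    ∫ t in Ioi (0 : ℝ), Complex.exp (-(ε + Complex.I * (2 * Real.pi * w : ℝ)) * t) • ofReal (v t) := by
  rw [Real.fourier_real_eq_integral_exp_smul, ← integral_indicator measurableSet_Ioi]
  congr 1
  ext1 t
  by_cases ht : t ∈ Ioi (0 : ℝ)
  · rw [damped, indicator_of_mem ht, indicator_of_mem ht, smul_smul, ← Complex.exp_add]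
    congr 2
    push_cast
    ring
  · rw [damped, indicator_of_notMem ht, indicator_of_notMem ht, smul_zero]

theorem integral_norm_sq_damped :
    ∫ t, ‖damped ε v t‖ ^ 2 = ∫ t in Ioi (0 : ℝ), Real.exp (-(2 * ε) * t) * ‖v t‖ ^ 2 := by
  rw [← integral_indicator measurableSet_Ioi]
  congr 1
  ext1 t
  by_cases ht : t ∈ Ioi (0 : ℝ)
  · rw [damped, indicator_of_mem ht, indicator_of_mem ht, norm_smul, norm_exp_neg_mul, norm_ofReal,
      mul_pow, ← Real.exp_nat_mul]
    congr 2
    simp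
    ring
  · rw [damped, indicator_of_notMem ht, indicator_of_notMem ht]
    simp

end Damped

variable {F₁ : H →L[ℝ] H} {F₂ : H →L[ℝ] U} {F₃ : U →L[ℝ] U}

theorem integrable_re_inner {E : Type*} [NormedAddCommGroup E] [InnerProductSpace ℂ E]
    {f g : ℝ → E} (hf : MemLp f 2) (hg : MemLp g 2) : Integrable (fun t => (⟪f t, g t⟫_ℂ).re) :=
  (hf.integrable_inner_of_two (𝕜 := ℂ) hg).re

/-- Plancherel for each of the three inner products, since bounded operators commute with the
Fourier transform. -/
theorem integral_quadFormC_fourier {a : ℝ → Complexification H} {b : ℝ → Complexification U}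
    (ha1 : Integrable a) (ha2 : MemLp a 2) (hb1 : Integrable b) (hb2 : MemLp b 2) :
    Integrable (fun w => quadFormC F₁ F₂ F₃ (𝓕 a w) (𝓕 b w)) ∧
    ∫ w, quadFormC F₁ F₂ F₃ (𝓕 a w) (𝓕 b w) = ∫ t, quadFormC F₁ F₂ F₃ (a t) (b t) := by
  have hF1 := F₁.complexify.integrable_comp ha1
  have hF1' := F₁.complexify.comp_memLp' ha2
  have hF2 := F₂.complexify.integrable_comp ha1
  have hF2' := F₂.complexify.comp_memLp' ha2
  have hF3 := F₃.complexify.integrable_comp hb1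
  have hF3' := F₃.complexify.comp_memLp' hb2
  have e1 := integral_re_inner_fourier hF1 hF1' ha1 ha2
  have e2 := integral_re_inner_fourier hF2 hF2' hb1 hb2
  have e3 := integral_re_inner_fourier hF3 hF3' hb1 hb2
  have i1 := integrable_re_inner (memLp_fourier hF1 hF1') (memLp_fourier ha1 ha2)
  have i2 := (integrable_re_inner (memLp_fourier hF2 hF2') (memLp_fourier hb1 hb2)).const_mul 2
  have i3 := integrable_re_inner (memLp_fourier hF3 hF3') (memLp_fourier hb1 hb2)
  have j1 := integrable_re_inner hF1' ha2
  have j2 := (integrable_re_inner hF2' hb2).const_mul 2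
  have j3 := integrable_re_inner hF3' hb2
  rw [fourier_clm_comp _ ha1] at e1 e2 i1 i2
  rw [fourier_clm_comp _ hb1] at e3 i3
  simp only [quadFormC_eq_re_inner]
  refine ⟨(i1.add i2).add i3, ?_⟩
  have key : ∀ {f g h : ℝ → ℝ}, Integrable f → Integrable (fun t => 2 * g t) → Integrable h →
      ∫ t, (f t + 2 * g t + h t) = (∫ t, f t) + 2 * (∫ t, g t) + ∫ t, h t := fun hf hg hh => by
    rw [← integral_const_mul, ← integral_add hf hg]
    exact integral_add (hf.add hg) hh
  rw [key i1 i2 i3, e1, e2, e3]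
  exact (key j1 j2 j3).symm

theorem quadFormC_damped (ε : ℝ) (v : ℝ → H) (ξ : ℝ → U) (t : ℝ) :
    quadFormC F₁ F₂ F₃ (damped ε v t) (damped ε ξ t) =
      (Ioi (0 : ℝ)).indicator (fun t => Real.exp (-(2 * ε) * t) * quadForm F₁ F₂ F₃ (v t) (ξ t)) t := by
  by_cases ht : t ∈ Ioi (0 : ℝ)
  · rw [damped, damped, indicator_of_mem ht, indicator_of_mem ht, indicator_of_mem ht]
    have e : Complex.exp (-(ε : ℂ) * t) = (Real.exp (-ε * t) : ℂ) := by push_cast; rfl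
    have e2 : Real.exp (-(2 * ε) * t) = Real.exp (-ε * t) * Real.exp (-ε * t) := by
      rw [← Real.exp_add]; congr 1; ring
    rw [e, e2]
    simp only [quadFormC, quadForm, re_smul, im_smul, Complex.ofReal_re, Complex.ofReal_im,
      re_ofReal, im_ofReal, smul_zero, zero_smul, sub_zero, add_zero, map_smul, map_zero,
      inner_smul_left, inner_smul_right, inner_zero_left, conj_trivial]
    ring
  · rw [damped, damped, indicator_of_notMem ht, indicator_of_notMem ht, indicator_of_notMem ht]
    simp [quadFormC, quadForm]

theorem integrableOn_quadForm {v : ℝ → H} {ξ : ℝ → U} (hv : MemLp v 2 (volume.restrict (Ioi 0)))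
    (hξ : MemLp ξ 2 (volume.restrict (Ioi 0))) :
    IntegrableOn (fun t => quadForm F₁ F₂ F₃ (v t) (ξ t)) (Ioi 0) :=
  (((F₁.comp_memLp' hv).integrable_inner_of_two (𝕜 := ℝ) hv).add
    (((F₂.comp_memLp' hv).integrable_inner_of_two (𝕜 := ℝ) hξ).const_mul 2)).add
      ((F₃.comp_memLp' hξ).integrable_inner_of_two (𝕜 := ℝ) hξ)

theorem tendsto_integral_exp_mul {φ : ℝ → ℝ} (hφ : IntegrableOn φ (Ioi 0)) :
    Tendsto (fun ε : ℝ => ∫ t in Ioi (0 : ℝ), Real.exp (-(2 * ε) * t) * φ t) (𝓝[>] 0)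
      (𝓝 (∫ t in Ioi (0 : ℝ), φ t)) := by
  refine tendsto_integral_filter_of_dominated_convergence (fun t => ‖φ t‖) ?_ ?_ hφ.norm ?_
  · exact Eventually.of_forall fun ε => (by fun_prop : Continuous fun t : ℝ =>
      Real.exp (-(2 * ε) * t)).aestronglyMeasurable.mul hφ.1
  · filter_upwards [self_mem_nhdsWithin] with ε hε
    filter_upwards [self_mem_ae_restrict measurableSet_Ioi] with t ht
    rw [norm_mul, Real.norm_eq_abs (Real.exp _), abs_of_pos (Real.exp_pos _)]
    refine mul_le_of_le_one_left (norm_nonneg _) ?_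
    rw [Real.exp_le_one_iff]
    nlinarith [mem_Ioi.1 ht, mem_Ioi.1 hε]
  · refine Eventually.of_forall fun t => ?_
    have : Continuous fun ε : ℝ => Real.exp (-(2 * ε) * t) * φ t := by fun_prop
    have := this.tendsto 0
    simp only [mul_zero, neg_zero, zero_mul, Real.exp_zero, one_mul] at this
    exact this.mono_left nhdsWithin_le_nhds

/-- Under the frequency condition the quadratic functional is coercive on the processes through the
origin. -/
theorem FrequencyCondition.le_integralFunctional {G : C0Semigroup H} {j : ℕ}
    (hdich : G.HasExponentialDichotomy j) {B : U →L[ℝ] H} {δ : ℝ} (hδ : 0 < δ)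
    (hfreq : FrequencyCondition G B F₁ F₂ F₃ δ) {v : ℝ → H} {ξ : ℝ → U}
    (h : G.IsAdmissiblePair B 0 v ξ) :
    δ / ((⨆ ω : ℝ, ‖G.transfer B ω‖) ^ 2 + 1) *
        ((∫ t in Ioi (0 : ℝ), ‖v t‖ ^ 2) + ∫ t in Ioi (0 : ℝ), ‖ξ t‖ ^ 2) ≤
      integralFunctional F₁ F₂ F₃ v ξ := by
  have hbdd := hdich.bddAbove_norm_transfer B
  obtain ⟨C, hC0, hC⟩ := hdich.exists_isResolventAt
  set M := ⨆ ω : ℝ, ‖G.transfer B ω‖ with hM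
  have hM0 : 0 ≤ M := Real.iSup_nonneg fun _ => norm_nonneg _
  set κ := δ / (M ^ 2 + 1) with hκ
  set D := κ * (M * C + C ^ 2) + ‖F₁‖ * C * (2 + C) + ‖F₂‖ * C with hD
  have hv := h.1
  have hξ := h.2.1
  -- The coercivity estimate for the damped process. Its error is `ε` times a fixed constant, so it
  -- disappears as `ε → 0`.
  have key : ∀ ε : ℝ, 0 < ε → ε ≤ 1 →
      κ * ((∫ t in Ioi (0 : ℝ), Real.exp (-(2 * ε) * t) * ‖v t‖ ^ 2) +
        ∫ t in Ioi (0 : ℝ), Real.exp (-(2 * ε) * t) * ‖ξ t‖ ^ 2) ≤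
      (∫ t in Ioi (0 : ℝ), Real.exp (-(2 * ε) * t) * quadForm F₁ F₂ F₃ (v t) (ξ t)) +
      ε * D * ((∫ t in Ioi (0 : ℝ), Real.exp (-(2 * ε) * t) * ‖v t‖ ^ 2) +
        ∫ t in Ioi (0 : ℝ), Real.exp (-(2 * ε) * t) * ‖ξ t‖ ^ 2) := by
    intro ε hε hε1
    have ha1 := integrable_damped hv hε
    have ha2 := memLp_damped hv hε
    have hb1 := integrable_damped hξ hε
    have hb2 := memLp_damped hξ hε
    set a := 𝓕 (damped ε v) with ha
    set b := 𝓕 (damped ε ξ) with hb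
    have hpt : ∀ w, κ * (‖a w‖ ^ 2 + ‖b w‖ ^ 2) ≤
        quadFormC F₁ F₂ F₃ (a w) (b w) + ε * D * (‖a w‖ ^ 2 + ‖b w‖ ^ 2) := by
      intro w
      -- The Fourier kernel is `e^{-2πiwt}`, so the frequency `w` corresponds to `2πw` on the
      -- imaginary axis. Taking `p = ε + iω` and `q = iω` below makes the transform of `v` differ
      -- from the transfer value by `ε R (a w)`.
      set ω : ℝ := 2 * Real.pi * w with hω
      obtain ⟨R, hR, hRC⟩ := hC ω
      have hRe := isResolventAt_unique (isResolventAt_resolventAt ⟨R, hR⟩) hR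
      have hlap := h.laplace_eq (p := ε + Complex.I * ω) (by simpa using hε) hR
      rw [← fourier_damped, ← fourier_damped, ← ha, ← hb, add_sub_cancel_right] at hlap
      have hx : -(G.transfer B ω (b w)) = -(R (B.complexify (b w))) := by
        rw [transfer, hRe]; rfl
      have hax : a w - -(G.transfer B ω (b w)) = (ε : ℂ) • R (a w) := by
        rw [hx]
        conv_lhs => rw [hlap]
        rw [map_sub, map_smul]
        abel
      have hd : ‖a w - -(G.transfer B ω (b w))‖ ≤ ε * C * ‖a w‖ := by
        rw [hax, norm_smul, Complex.norm_real, Real.norm_eq_abs, abs_of_pos hε, mul_assoc]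
        exact mul_le_mul_of_nonneg_left (R.le_of_opNorm_le hRC _) hε.le
      refine frequency_estimate_aux (norm_nonneg _) (norm_nonneg _)
        (norm_nonneg (-(G.transfer B ω (b w)))) hε.le hε1 hδ.le hC0 hM0
        (norm_nonneg _) (norm_nonneg _) hd ?_ ?_ ?_ (hfreq ω (b w)) (quadFormC_le_add F₁ F₂ F₃ _ _ _)
      · rw [norm_neg]
        exact (G.transfer B ω).le_of_opNorm_le (le_ciSup hbdd ω) _
      · have := norm_add_le (-(G.transfer B ω (b w))) (a w - -(G.transfer B ω (b w)))
        rwa [add_sub_cancel] at this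
      · have := norm_sub_le (a w) (a w - -(G.transfer B ω (b w)))
        rwa [sub_sub_cancel] at this
    obtain ⟨hqi, hq⟩ := integral_quadFormC_fourier (F₁ := F₁) (F₂ := F₂) (F₃ := F₃) ha1 ha2 hb1 hb2
    have hai : Integrable fun w => ‖a w‖ ^ 2 :=
      (memLp_two_iff_integrable_sq_norm (memLp_fourier ha1 ha2).1).1 (memLp_fourier ha1 ha2)
    have hbi : Integrable fun w => ‖b w‖ ^ 2 :=
      (memLp_two_iff_integrable_sq_norm (memLp_fourier hb1 hb2).1).1 (memLp_fourier hb1 hb2)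
    have habi : Integrable fun w => ‖a w‖ ^ 2 + ‖b w‖ ^ 2 := hai.add hbi
    have hint := integral_mono (habi.const_mul κ) (hqi.add (habi.const_mul (ε * D))) hpt
    simp only [Pi.add_apply] at hint
    rw [integral_const_mul, integral_add hqi (habi.const_mul (ε * D)), integral_const_mul,
      integral_add hai hbi, hq, ha, hb, integral_norm_sq_fourier_of_integrable ha1 ha2,
      integral_norm_sq_fourier_of_integrable hb1 hb2, integral_norm_sq_damped,
      integral_norm_sq_damped] at hint
    simp only [quadFormC_damped] at hint
    rwa [integral_indicator measurableSet_Ioi] at hint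
  have hl1 := (tendsto_integral_exp_mul hv.integrableOn_norm_sq_Ioi).add
    (tendsto_integral_exp_mul hξ.integrableOn_norm_sq_Ioi)
  have hl2 := tendsto_integral_exp_mul
    (integrableOn_quadForm (F₁ := F₁) (F₂ := F₂) (F₃ := F₃) hv hξ)
  have hεD : Tendsto (fun ε : ℝ => ε * D) (𝓝[>] 0) (𝓝 0) := by
    have : Continuous fun ε : ℝ => ε * D := by fun_prop
    have := this.tendsto 0
    rw [zero_mul] at this
    exact this.mono_left nhdsWithin_le_nhds
  have hl3 := hl2.add (hεD.mul hl1)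
  rw [zero_mul, add_zero] at hl3
  refine le_of_tendsto_of_tendsto (hl1.const_mul κ) hl3 ?_
  filter_upwards [self_mem_nhdsWithin, mem_nhdsWithin_of_mem_nhds (Iic_mem_nhds zero_lt_one)]
    with ε h0 h1
  exact key ε h0 h1

end C0Semigroup


/-! ### Minimisation of a quadratic functional over a family of affine subspaces -/

/-- Let `N` be a closed linear relation with full domain and `b` a bounded bilinear form that is
coercive on the multivalued part `N(0)`. Then every `x` has a unique `D x ∈ N(x)` that is
`b`-orthogonal to `N(0)`, and `D` is a bounded operator. -/
theorem exists_minimizing_operator {X Z : Type*} [NormedAddCommGroup X] [NormedSpace ℝ X]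
    [CompleteSpace X] [NormedAddCommGroup Z] [InnerProductSpace ℝ Z] [CompleteSpace Z]
    (N : Submodule ℝ (X × Z)) (hN : IsClosed (N : Set (X × Z))) (hdom : ∀ x, ∃ z, (x, z) ∈ N)
    (b : Z →L[ℝ] Z →L[ℝ] ℝ) {κ : ℝ} (hκ : 0 < κ)
    (hb : ∀ z, ((0 : X), z) ∈ N → κ * ‖z‖ ^ 2 ≤ b z z) :
    ∃ D : X →L[ℝ] Z, (∀ x, (x, D x) ∈ N) ∧ (∀ x z, ((0 : X), z) ∈ N → b (D x) z = 0) ∧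
      ∀ x z, (x, z) ∈ N → (∀ m, ((0 : X), m) ∈ N → b z m = 0) → z = D x := by
  let N₀ : Submodule ℝ Z := N.comap (LinearMap.inr ℝ X Z)
  have hN₀ : IsClosed (N₀ : Set Z) := hN.preimage (continuous_const.prodMk continuous_id)
  have : CompleteSpace N₀ := hN₀.completeSpace_coe
  let b₀ : N₀ →L[ℝ] N₀ →L[ℝ] ℝ := (b.comp N₀.subtypeL).flip.comp N₀.subtypeL |>.flip
  have hb₀ : ∀ u w : N₀, b₀ u w = b u w := fun u w => rfl
  have hco : IsCoercive b₀ := ⟨κ, hκ, fun u => by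
    have := hb u u.2
    rw [hb₀, mul_assoc, ← sq]
    exact this⟩
  have huniq : ∀ z, ((0 : X), z) ∈ N → (∀ m, ((0 : X), m) ∈ N → b z m = 0) → z = 0 := by
    intro z hz h
    have h1 := hb z hz
    rw [h z hz] at h1
    have h2 : ‖z‖ ^ 2 ≤ 0 := by nlinarith
    exact norm_eq_zero.1 (by nlinarith [norm_nonneg z])
  -- `O` is the graph of the sought operator. It is closed, and its projection to `X` is bijective,
  -- so the inverse is bounded by the open mapping theorem.
  let O : Submodule ℝ (X × Z) :=
    { carrier := {p | p ∈ N ∧ ∀ m, ((0 : X), m) ∈ N → b p.2 m = 0}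
      add_mem' := fun {p q} hp hq => ⟨N.add_mem hp.1 hq.1, fun m hm => by
        simp [hp.2 m hm, hq.2 m hm]⟩
      zero_mem' := ⟨N.zero_mem, fun m _ => by simp⟩
      smul_mem' := fun c p hp => ⟨N.smul_mem c hp.1, fun m hm => by simp [hp.2 m hm]⟩ }
  have hO : IsClosed (O : Set (X × Z)) := by
    have : (O : Set (X × Z)) = (N : Set (X × Z)) ∩ ⋂ m ∈ {m | ((0 : X), m) ∈ N}, {p : X × Z | b p.2 m = 0} := by
      ext p
      simp [O]
    rw [this]
    refine hN.inter (isClosed_biInter fun m _ => ?_)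
    exact isClosed_eq (by fun_prop) continuous_const
  have : CompleteSpace O := hO.completeSpace_coe
  let π : O →L[ℝ] X := (ContinuousLinearMap.fst ℝ X Z).comp O.subtypeL
  have hker : π.ker = ⊥ := by
    rw [LinearMap.ker_eq_bot']
    rintro ⟨⟨x, z⟩, hp⟩ h
    obtain rfl : x = 0 := h
    have := huniq z hp.1 hp.2
    subst this
    rfl
  have hran : π.range = ⊤ := by
    rw [LinearMap.range_eq_top]
    intro x
    obtain ⟨z, hz⟩ := hdom x
    let ℓ : N₀ →L[ℝ] ℝ := (b z).comp N₀.subtypeL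
    -- Lax–Milgram on the multivalued part: `m` has the same `b`-pairings with it as `z`, so `z - m`
    -- is the orthogonal representative.
    let m : N₀ := hco.continuousLinearEquivOfBilin.symm ((InnerProductSpace.toDual ℝ N₀).symm ℓ)
    have hm : ∀ u : N₀, b m u = b z u := fun u => by
      rw [← hb₀, ← hco.continuousLinearEquivOfBilin_apply, ContinuousLinearEquiv.apply_symm_apply,
        InnerProductSpace.toDual_symm_apply]
      rfl
    refine ⟨⟨(x, z - m), ?_, fun u hu => ?_⟩, rfl⟩
    · have := N.sub_mem hz m.2
      rwa [LinearMap.inr_apply, Prod.mk_sub_mk, sub_zero] at this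
    · have := hm ⟨u, hu⟩
      simp only [map_sub, _root_.sub_apply]
      exact sub_eq_zero.2 this.symm
  let e := ContinuousLinearEquiv.ofBijective π hker hran
  have he : ∀ x, ((e.symm x : O) : X × Z).1 = x := fun x => e.apply_symm_apply x
  let D : X →L[ℝ] Z :=
    (ContinuousLinearMap.snd ℝ X Z).comp (O.subtypeL.comp (e.symm : X →L[ℝ] O))
  have hD : ∀ x, ((e.symm x : O) : X × Z) = (x, D x) := fun x => Prod.ext (he x) rfl
  have hDO : ∀ x, (x, D x) ∈ O := fun x => hD x ▸ (e.symm x).2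
  refine ⟨D, fun x => (hDO x).1, fun x => (hDO x).2, fun x z hz h => ?_⟩
  have h1 : (x, z) ∈ O := ⟨hz, h⟩
  have h2 := O.sub_mem h1 (hDO x)
  rw [Prod.mk_sub_mk, sub_self] at h2
  exact sub_eq_zero.1 (huniq _ h2.1 h2.2)

/-! ### Dependence of mild solutions on the data -/

theorem ae_restrict_Ioc_of_Ioi {p : ℝ → Prop} (h : ∀ᵐ t ∂volume.restrict (Ioi (0 : ℝ)), p t) (T : ℝ) :
    ∀ᵐ t ∂volume.restrict (Ioc 0 T), p t :=
  ae_restrict_of_ae_restrict_of_subset (fun _ hx => hx.1) h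

namespace C0Semigroup

variable {H : Type*} [NormedAddCommGroup H] [InnerProductSpace ℝ H] [CompleteSpace H]

theorem mild_congr_ae (G : C0Semigroup H) (x : H) {f g : ℝ → H}
    (h : f =ᵐ[volume.restrict (Ioi 0)] g) {t : ℝ} (ht : 0 ≤ t) : G.mild x f t = G.mild x g t := by
  rw [mild, mild, intervalIntegral.integral_of_le ht, intervalIntegral.integral_of_le ht]
  congr 1
  refine integral_congr_ae ?_
  filter_upwards [ae_restrict_Ioc_of_Ioi h t] with s hs
  rw [hs]

theorem mild_congr_Ioc (G : C0Semigroup H) (x : H) {f g : ℝ → H} {t : ℝ} (ht : 0 ≤ t)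
    (h : ∀ s ∈ Ioc 0 t, f s = g s) : G.mild x f t = G.mild x g t := by
  rw [mild, mild, intervalIntegral.integral_of_le ht, intervalIntegral.integral_of_le ht]
  congr 1
  exact setIntegral_congr_fun measurableSet_Ioc fun s hs => by simp only [h s hs]

theorem mild_add_add (G : C0Semigroup H) (x y : H) {f g : ℝ → H} {t : ℝ} (ht : 0 ≤ t)
    (hf : IntervalIntegrable f volume 0 t) (hg : IntervalIntegrable g volume 0 t) :
    G.mild (x + y) (fun s => f s + g s) t = G.mild x f t + G.mild y g t := by
  simp only [mild, map_add]
  rw [intervalIntegral.integral_add (G.intervalIntegrable_op ht le_rfl hf)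
    (G.intervalIntegrable_op ht le_rfl hg)]
  abel

theorem mild_smul (G : C0Semigroup H) (c : ℝ) (x : H) (f : ℝ → H) (t : ℝ) :
    G.mild (c • x) (fun s => c • f s) t = c • G.mild x f t := by
  simp only [mild, map_smul]
  rw [intervalIntegral.integral_smul, smul_add]

theorem mild_sub_sub (G : C0Semigroup H) (x y : H) {f g : ℝ → H} {t : ℝ} (ht : 0 ≤ t)
    (hf : IntervalIntegrable f volume 0 t) (hg : IntervalIntegrable g volume 0 t) :
    G.mild (x - y) (fun s => f s - g s) t = G.mild x f t - G.mild y g t := by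
  simp only [mild, map_sub]
  rw [intervalIntegral.integral_sub (G.intervalIntegrable_op ht le_rfl hf)
    (G.intervalIntegrable_op ht le_rfl hg)]
  abel

/-- Evaluation of a mild solution at a fixed time is continuous in the initial value and, by
Cauchy–Schwarz, in the `L²` norm of the forcing. -/
theorem exists_norm_mild_le (G : C0Semigroup H) {t : ℝ} (ht : 0 ≤ t) :
    ∃ C : ℝ, 0 ≤ C ∧ ∀ x f, MemLp f 2 (volume.restrict (Ioi 0)) →
      ‖G.mild x f t‖ ≤ C * (‖x‖ + √(∫ s in Ioi (0 : ℝ), ‖f s‖ ^ 2)) := by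
  obtain ⟨M, hM1, hM⟩ := G.exists_norm_op_le t
  refine ⟨M * (1 + √t), by positivity, fun x f hf => ?_⟩
  have hfi := hf.intervalIntegrable_of_Ioi le_rfl ht
  have hsq := IntegrableOn.intervalIntegrable_of_Ioi hf.integrableOn_norm_sq_Ioi le_rfl ht
  have h1 : ‖G.op t x‖ ≤ M * ‖x‖ := (G.op t).le_of_opNorm_le (hM t ht le_rfl) x
  have h2 := G.norm_integral_op_le ht (M := M) (fun r h0 h1 => hM r h0 (by linarith)) hfi
  have h3 := sq_intervalIntegral_le ht hfi.norm hsq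
  rw [sub_zero] at h3
  have h4 : ∫ s in (0 : ℝ)..t, ‖f s‖ ^ 2 ≤ ∫ s in Ioi (0 : ℝ), ‖f s‖ ^ 2 := by
    rw [intervalIntegral.integral_of_le ht]
    exact setIntegral_mono_set hf.integrableOn_norm_sq_Ioi
      (Eventually.of_forall fun s => sq_nonneg _) (Eventually.of_forall fun s hs => hs.1)
  have h5 : ∫ s in (0 : ℝ)..t, ‖f s‖ ≤ √t * √(∫ s in Ioi (0 : ℝ), ‖f s‖ ^ 2) := by
    rw [← Real.sqrt_mul ht]
    exact Real.le_sqrt_of_sq_le (h3.trans (mul_le_mul_of_nonneg_left h4 ht))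
  rw [mild]
  refine (norm_add_le _ _).trans ?_
  have h6 : M * ∫ s in (0 : ℝ)..t, ‖f s‖ ≤ M * (√t * √(∫ s in Ioi (0 : ℝ), ‖f s‖ ^ 2)) :=
    mul_le_mul_of_nonneg_left h5 (by linarith)
  have h7 : 0 ≤ M * √t * ‖x‖ := by positivity
  have h8 : 0 ≤ M * √(∫ s in Ioi (0 : ℝ), ‖f s‖ ^ 2) := by positivity
  calc _ ≤ M * ‖x‖ + M * (√t * √(∫ s in Ioi (0 : ℝ), ‖f s‖ ^ 2)) := add_le_add h1 (h2.trans h6)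
    _ ≤ _ := by linarith

end C0Semigroup

/-! ### The space of processes -/

theorem L2_norm_sq_eq_integral {α E : Type*} [MeasurableSpace α] {μ : Measure α}
    [NormedAddCommGroup E] [InnerProductSpace ℝ E] (f : Lp E 2 μ) :
    ‖f‖ ^ 2 = ∫ x, ‖f x‖ ^ 2 ∂μ := by
  rw [← real_inner_self_eq_norm_sq, L2.inner_def]
  simp only [real_inner_self_eq_norm_sq]

section Trajectories

variable {H U : Type*} [NormedAddCommGroup H] [InnerProductSpace ℝ H] [CompleteSpace H]
  [NormedAddCommGroup U] [InnerProductSpace ℝ U] [CompleteSpace U]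

/-- The symmetric bilinear form whose diagonal is `quadForm`. -/
noncomputable def polarForm (F₁ : H →L[ℝ] H) (F₂ : H →L[ℝ] U) (F₃ : U →L[ℝ] U)
    (v : H) (ξ : U) (w : H) (ζ : U) : ℝ :=
  ⟪F₁ v + F₂.adjoint ξ, w⟫_ℝ + ⟪F₂ v + F₃ ξ, ζ⟫_ℝ

theorem polarForm_self (F₁ : H →L[ℝ] H) (F₂ : H →L[ℝ] U) (F₃ : U →L[ℝ] U) (v : H) (ξ : U) :
    polarForm F₁ F₂ F₃ v ξ v ξ = quadForm F₁ F₂ F₃ v ξ := by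
  rw [polarForm, quadForm, inner_add_left, inner_add_left, ContinuousLinearMap.adjoint_inner_left,
    real_inner_comm (F₂ v) ξ]
  ring

theorem polarForm_comm {F₁ : H →L[ℝ] H} {F₃ : U →L[ℝ] U} (hF₁ : IsSelfAdjoint F₁)
    (F₂ : H →L[ℝ] U) (hF₃ : IsSelfAdjoint F₃) (v : H) (ξ : U) (w : H) (ζ : U) :
    polarForm F₁ F₂ F₃ v ξ w ζ = polarForm F₁ F₂ F₃ w ζ v ξ := by
  have h1 := hF₁.isSymmetric v w
  have h3 := hF₃.isSymmetric ξ ζ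
  simp only [ContinuousLinearMap.coe_coe] at h1 h3
  rw [polarForm, polarForm, inner_add_left, inner_add_left, inner_add_left, inner_add_left,
    ContinuousLinearMap.adjoint_inner_left, ContinuousLinearMap.adjoint_inner_left, h1, h3,
    real_inner_comm (F₂ w) ξ, real_inner_comm ζ (F₂ v), real_inner_comm v (F₁ w),
    real_inner_comm ξ (F₃ ζ)]
  ring

/-- The Hilbert space `L²(0, ∞; E)`. -/
abbrev HalfLineL2 (E : Type*) [NormedAddCommGroup E] : Type _ :=
  Lp E 2 (volume.restrict (Ioi (0 : ℝ)))

variable (H U) in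
/-- The Hilbert space `L²(0, ∞; H) × L²(0, ∞; U)`. -/
abbrev TrajectorySpace : Type _ := WithLp 2 (HalfLineL2 H × HalfLineL2 U)

/-- The self-adjoint operator of the integral quadratic functional. -/
noncomputable def formOperator (F₁ : H →L[ℝ] H) (F₂ : H →L[ℝ] U) (F₃ : U →L[ℝ] U) :
    TrajectorySpace H U →L[ℝ] TrajectorySpace H U :=
  ((WithLp.prodContinuousLinearEquiv 2 ℝ (HalfLineL2 H) (HalfLineL2 U)).symm :
    HalfLineL2 H × HalfLineL2 U →L[ℝ] TrajectorySpace H U).comp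
    (ContinuousLinearMap.prod
      ((F₁.compLpL 2 (volume.restrict (Ioi (0 : ℝ)))).comp
          (WithLp.fstL 2 ℝ (HalfLineL2 H) (HalfLineL2 U)) +
        (F₂.adjoint.compLpL 2 (volume.restrict (Ioi (0 : ℝ)))).comp
          (WithLp.sndL 2 ℝ (HalfLineL2 H) (HalfLineL2 U)))
      ((F₂.compLpL 2 (volume.restrict (Ioi (0 : ℝ)))).comp
          (WithLp.fstL 2 ℝ (HalfLineL2 H) (HalfLineL2 U)) +
        (F₃.compLpL 2 (volume.restrict (Ioi (0 : ℝ)))).comp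
          (WithLp.sndL 2 ℝ (HalfLineL2 H) (HalfLineL2 U))))

theorem inner_formOperator (F₁ : H →L[ℝ] H) (F₂ : H →L[ℝ] U) (F₃ : U →L[ℝ] U)
    (z z' : TrajectorySpace H U) : ⟪formOperator F₁ F₂ F₃ z, z'⟫_ℝ =
      ∫ t in Ioi (0 : ℝ), polarForm F₁ F₂ F₃ (z.fst t) (z.snd t) (z'.fst t) (z'.snd t) := by
  rw [WithLp.prod_inner_apply]
  change ⟪F₁.compLpL 2 _ z.fst + F₂.adjoint.compLpL 2 _ z.snd, z'.fst⟫_ℝ +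
    ⟪F₂.compLpL 2 _ z.fst + F₃.compLpL 2 _ z.snd, z'.snd⟫_ℝ = _
  rw [L2.inner_def, L2.inner_def, ← integral_add (L2.integrable_inner _ _) (L2.integrable_inner _ _)]
  refine integral_congr_ae ?_
  filter_upwards [Lp.coeFn_add (F₁.compLpL 2 _ z.fst) (F₂.adjoint.compLpL 2 _ z.snd),
    Lp.coeFn_add (F₂.compLpL 2 _ z.fst) (F₃.compLpL 2 _ z.snd),
    F₁.coeFn_compLpL z.fst, F₂.adjoint.coeFn_compLpL z.snd, F₂.coeFn_compLpL z.fst,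
    F₃.coeFn_compLpL z.snd] with t h1 h2 h3 h4 h5 h6
  rw [h1, h2, Pi.add_apply, Pi.add_apply, h3, h4, h5, h6]
  rfl

namespace C0Semigroup

/-- The closed linear relation between initial values and processes. -/
noncomputable def trajectoryRelation (G : C0Semigroup H) (B : U →L[ℝ] H) :
    Submodule ℝ (H × TrajectorySpace H U) where
  carrier := {p | ∀ᵐ t ∂volume.restrict (Ioi (0 : ℝ)),
    p.2.fst t = G.mild p.1 (fun s => B (p.2.snd s)) t}
  add_mem' {p q} hp hq := by
    have hcongr : (fun s => B ((p + q).2.snd s)) =ᵐ[volume.restrict (Ioi (0 : ℝ))]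
        fun s => B (p.2.snd s) + B (q.2.snd s) := by
      filter_upwards [Lp.coeFn_add p.2.snd q.2.snd] with s hs
      rw [← map_add]
      exact congrArg B hs
    filter_upwards [hp, hq, Lp.coeFn_add p.2.fst q.2.fst, self_mem_ae_restrict measurableSet_Ioi]
      with t h1 h2 h3 ht
    have ht0 : (0 : ℝ) ≤ t := le_of_lt ht
    have hI := fun y : Lp U 2 (volume.restrict (Ioi (0 : ℝ))) =>
      MemLp.intervalIntegrable_of_Ioi (B.comp_memLp' (Lp.memLp y)) le_rfl ht0
    rw [G.mild_congr_ae _ hcongr ht0]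
    exact (h3.trans (congrArg₂ (· + ·) h1 h2)).trans (G.mild_add_add _ _ ht0 (hI _) (hI _)).symm
  zero_mem' := by
    have hcongr : (fun s => B ((0 : TrajectorySpace H U).snd s)) =ᵐ[volume.restrict (Ioi (0 : ℝ))]
        fun _ => 0 := by
      filter_upwards [Lp.coeFn_zero U 2 (volume.restrict (Ioi (0 : ℝ)))] with s hs
      rw [← map_zero B]
      exact congrArg B hs
    filter_upwards [Lp.coeFn_zero H 2 (volume.restrict (Ioi (0 : ℝ))),
      self_mem_ae_restrict measurableSet_Ioi] with t h1 ht
    refine h1.trans ?_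
    refine Eq.trans ?_ (G.mild_congr_ae _ hcongr (le_of_lt ht)).symm
    simp [mild]
  smul_mem' c p hp := by
    have hcongr : (fun s => B ((c • p).2.snd s)) =ᵐ[volume.restrict (Ioi (0 : ℝ))]
        fun s => c • B (p.2.snd s) := by
      filter_upwards [Lp.coeFn_smul c p.2.snd] with s hs
      rw [← map_smul]
      exact congrArg B hs
    filter_upwards [hp, Lp.coeFn_smul c p.2.fst, self_mem_ae_restrict measurableSet_Ioi]
      with t h1 h3 ht
    rw [G.mild_congr_ae _ hcongr (le_of_lt ht)]
    exact (h3.trans (congrArg (c • ·) h1)).trans (G.mild_smul _ _ _ _).symm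

variable {G : C0Semigroup H} {B : U →L[ℝ] H}

theorem mem_trajectoryRelation {x : H} {z : TrajectorySpace H U} : (x, z) ∈ G.trajectoryRelation B ↔
    ∀ᵐ t ∂volume.restrict (Ioi (0 : ℝ)), z.fst t = G.mild x (fun s => B (z.snd s)) t := Iff.rfl

/-- An `L²` class satisfies the Cauchy formula only almost everywhere; passing to the mild solution
as representative makes it hold at every time. -/
theorem isAdmissiblePair_of_mem {x : H} {z : TrajectorySpace H U} (h : (x, z) ∈ G.trajectoryRelation B) :
    G.IsAdmissiblePair B x (G.mild x fun s => B (z.snd s)) z.snd :=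
  ⟨(memLp_congr_ae (mem_trajectoryRelation.1 h)).1 (Lp.memLp _), Lp.memLp _, fun _ _ => rfl⟩

/-- The class of an admissible pair in the space of processes. -/
noncomputable def IsAdmissiblePair.toTrajectory {x : H} {v : ℝ → H} {ξ : ℝ → U}
    (h : G.IsAdmissiblePair B x v ξ) : TrajectorySpace H U :=
  WithLp.toLp 2 (h.1.toLp v, h.2.1.toLp ξ)

theorem IsAdmissiblePair.toTrajectory_mem {x : H} {v : ℝ → H} {ξ : ℝ → U}
    (h : G.IsAdmissiblePair B x v ξ) : (x, h.toTrajectory) ∈ G.trajectoryRelation B := by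
  rw [mem_trajectoryRelation]
  have hcongr : (fun s => B (h.toTrajectory.snd s)) =ᵐ[volume.restrict (Ioi (0 : ℝ))]
      fun s => B (ξ s) := by
    filter_upwards [h.2.1.coeFn_toLp] with s hs
    exact congrArg B hs
  filter_upwards [h.1.coeFn_toLp, self_mem_ae_restrict measurableSet_Ioi] with t ht h0
  rw [G.mild_congr_ae x hcongr (le_of_lt h0)]
  exact ht.trans (h.2.2 t (le_of_lt h0))

theorem inner_formOperator_toTrajectory (F₁ : H →L[ℝ] H) (F₂ : H →L[ℝ] U) (F₃ : U →L[ℝ] U)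
    {x y : H} {v w : ℝ → H} {ξ ζ : ℝ → U} (h : G.IsAdmissiblePair B x v ξ)
    (h' : G.IsAdmissiblePair B y w ζ) : ⟪formOperator F₁ F₂ F₃ h.toTrajectory, h'.toTrajectory⟫_ℝ =
      ∫ t in Ioi (0 : ℝ), polarForm F₁ F₂ F₃ (v t) (ξ t) (w t) (ζ t) := by
  rw [inner_formOperator]
  refine integral_congr_ae ?_
  filter_upwards [h.1.coeFn_toLp, h.2.1.coeFn_toLp, h'.1.coeFn_toLp, h'.2.1.coeFn_toLp]
    with t h1 h2 h3 h4
  exact congr (congr (congr (congrArg _ h1) h2) h3) h4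

theorem toTrajectory_isAdmissiblePair_of_mem {x : H} {z : TrajectorySpace H U}
    (h : (x, z) ∈ G.trajectoryRelation B) : (isAdmissiblePair_of_mem h).toTrajectory = z := by
  have h1 : MemLp.toLp _ (isAdmissiblePair_of_mem h).1 = z.fst := by
    refine Lp.ext ?_
    filter_upwards [(isAdmissiblePair_of_mem h).1.coeFn_toLp, mem_trajectoryRelation.1 h] with t h1 h2
    rw [h1, h2]
  have h2 : MemLp.toLp _ (isAdmissiblePair_of_mem h).2.1 = z.snd := Lp.toLp_coeFn _ _
  exact WithLp.ofLp_injective 2 (Prod.ext h1 h2)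

/-- Along a subsequence the `L²` limit of the states is an almost everywhere limit, while the mild
solutions converge at every fixed time. -/
theorem isClosed_trajectoryRelation (G : C0Semigroup H) (B : U →L[ℝ] H) :
    IsClosed (G.trajectoryRelation B : Set (H × TrajectorySpace H U)) := by
  rw [← isSeqClosed_iff_isClosed]
  rintro p ⟨x, z⟩ hp hlim
  have hx : Tendsto (fun n => (p n).1) atTop (𝓝 x) := (continuous_fst.tendsto _).comp hlim
  have hz : Tendsto (fun n => (p n).2) atTop (𝓝 z) := (continuous_snd.tendsto _).comp hlim
  have hz1 : Tendsto (fun n => (p n).2.fst) atTop (𝓝 z.fst) :=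
    ((WithLp.prod_continuous_ofLp 2 _ _).fst.tendsto _).comp hz
  have hz2 : Tendsto (fun n => (p n).2.snd) atTop (𝓝 z.snd) :=
    ((WithLp.prod_continuous_ofLp 2 _ _).snd.tendsto _).comp hz
  obtain ⟨φ, hφ, hae⟩ := (tendstoInMeasure_of_tendsto_Lp hz1).exists_seq_tendsto_ae
  have hall : ∀ᵐ t ∂volume.restrict (Ioi (0 : ℝ)), ∀ n,
      (p n).2.fst t = G.mild (p n).1 (fun s => B ((p n).2.snd s)) t := ae_all_iff.2 fun n => hp n
  filter_upwards [hae, hall, self_mem_ae_restrict measurableSet_Ioi] with t h1 h2 h0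
  have ht : (0 : ℝ) ≤ t := le_of_lt h0
  refine tendsto_nhds_unique h1 ?_
  simp only [h2]
  refine Tendsto.comp (g := fun n => G.mild (p n).1 (fun s => B ((p n).2.snd s)) t) ?_ hφ.tendsto_atTop
  obtain ⟨C, hC0, hC⟩ := G.exists_norm_mild_le ht
  rw [tendsto_iff_norm_sub_tendsto_zero]
  have hb : Tendsto (fun n => C * (‖(p n).1 - x‖ + ‖B‖ * ‖(p n).2.snd - z.snd‖)) atTop (𝓝 0) := by
    have h3 := (tendsto_iff_norm_sub_tendsto_zero.1 hx).add
      ((tendsto_iff_norm_sub_tendsto_zero.1 hz2).const_mul ‖B‖)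
    simpa using h3.const_mul C
  refine squeeze_zero (fun _ => norm_nonneg _) (fun n => ?_) hb
  have hI := fun y : Lp U 2 (volume.restrict (Ioi (0 : ℝ))) =>
    MemLp.intervalIntegrable_of_Ioi (B.comp_memLp' (Lp.memLp y)) le_rfl ht
  have e : G.mild (p n).1 (fun s => B ((p n).2.snd s)) t - G.mild x (fun s => B (z.snd s)) t =
      G.mild ((p n).1 - x) (fun s => B (((p n).2.snd - z.snd : Lp U 2 _) s)) t := by
    refine (G.mild_sub_sub _ _ ht (hI _) (hI _)).symm.trans (G.mild_congr_ae _ ?_ ht)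
    filter_upwards [Lp.coeFn_sub (p n).2.snd z.snd] with s hs
    rw [hs, Pi.sub_apply, map_sub]
    rfl
  have hmem : MemLp (fun s => B (((p n).2.snd - z.snd : Lp U 2 _) s)) 2 (volume.restrict (Ioi 0)) :=
    B.comp_memLp' (Lp.memLp _)
  change ‖G.mild (p n).1 (fun s => B ((p n).2.snd s)) t - G.mild x (fun s => B (z.snd s)) t‖ ≤ _
  rw [e]
  refine (hC _ _ hmem).trans (mul_le_mul_of_nonneg_left (add_le_add le_rfl ?_) hC0)
  refine Real.sqrt_le_iff.2 ⟨by positivity, ?_⟩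
  rw [mul_pow, L2_norm_sq_eq_integral, ← integral_const_mul]
  refine integral_mono hmem.integrableOn_norm_sq_Ioi
    (MemLp.integrableOn_norm_sq_Ioi (Lp.memLp _) |>.const_mul _) fun s => ?_
  simp only
  rw [← mul_pow]
  exact pow_le_pow_left₀ (norm_nonneg _) (B.le_opNorm _) 2

/-- `(v, ξ)` is a process through `x` at which the quadratic functional, restricted to the processes
through `x`, is stationary. -/
def IsOptimalPair (G : C0Semigroup H) (B : U →L[ℝ] H) (F₁ : H →L[ℝ] H) (F₂ : H →L[ℝ] U)
    (F₃ : U →L[ℝ] U) (x : H) (v : ℝ → H) (ξ : ℝ → U) : Prop :=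
  G.IsAdmissiblePair B x v ξ ∧ ∀ w ζ, G.IsAdmissiblePair B 0 w ζ →
    ∫ t in Ioi (0 : ℝ), polarForm F₁ F₂ F₃ (v t) (ξ t) (w t) (ζ t) = 0

/-- The quadratic functional has a unique stationary process through every point, and its polar form
on such processes is given by a bounded self-adjoint operator `P`. -/
theorem exists_optimal_value_operator (hctrl : G.L2Controllable B) {F₁ : H →L[ℝ] H}
    (hF₁ : IsSelfAdjoint F₁) (F₂ : H →L[ℝ] U) {F₃ : U →L[ℝ] U} (hF₃ : IsSelfAdjoint F₃) {κ : ℝ}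
    (hκ : 0 < κ) (hco : ∀ (v : ℝ → H) (ξ : ℝ → U), G.IsAdmissiblePair B 0 v ξ →
      κ * ((∫ t in Ioi (0 : ℝ), ‖v t‖ ^ 2) + ∫ t in Ioi (0 : ℝ), ‖ξ t‖ ^ 2) ≤
        integralFunctional F₁ F₂ F₃ v ξ) :
    ∃ P : H →L[ℝ] H, IsSelfAdjoint P ∧ (∀ x, ∃ v ξ, IsOptimalPair G B F₁ F₂ F₃ x v ξ) ∧
      ∀ x v ξ y w ζ, IsOptimalPair G B F₁ F₂ F₃ x v ξ → G.IsAdmissiblePair B y w ζ →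
        ∫ t in Ioi (0 : ℝ), polarForm F₁ F₂ F₃ (v t) (ξ t) (w t) (ζ t) = ⟪P x, y⟫_ℝ := by
  set A := formOperator F₁ F₂ F₃ with hA
  have hAsymm : ∀ z z', ⟪A z, z'⟫_ℝ = ⟪A z', z⟫_ℝ := fun z z' => by
    rw [hA, inner_formOperator, inner_formOperator]
    refine integral_congr_ae (Eventually.of_forall fun t => ?_)
    exact polarForm_comm hF₁ F₂ hF₃ _ _ _ _
  obtain ⟨D, hD1, hD2, hD3⟩ := exists_minimizing_operator (G.trajectoryRelation B)
    (G.isClosed_trajectoryRelation B)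
    (fun x => by
      obtain ⟨v, ξ, h⟩ := hctrl x
      exact ⟨_, h.toTrajectory_mem⟩)
    ((innerSL ℝ).comp A) hκ (fun z hz => by
      have h := isAdmissiblePair_of_mem hz
      have h1 := hco _ _ h
      have h2 := inner_formOperator_toTrajectory F₁ F₂ F₃ h h
      rw [toTrajectory_isAdmissiblePair_of_mem hz] at h2
      simp only [polarForm_self] at h2
      change κ * ‖z‖ ^ 2 ≤ ⟪A z, z⟫_ℝ
      rw [hA, h2]
      refine le_trans (le_of_eq ?_) h1
      rw [WithLp.prod_norm_sq_eq_of_L2, L2_norm_sq_eq_integral, L2_norm_sq_eq_integral]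
      congr 2
      refine integral_congr_ae ?_
      filter_upwards [mem_trajectoryRelation.1 hz] with t ht
      exact congrArg (fun y : H => ‖y‖ ^ 2) ht)
  have hD2' : ∀ x z, ((0 : H), z) ∈ G.trajectoryRelation B → ⟪A (D x), z⟫_ℝ = 0 := hD2
  -- The operator is `P = D* 𝓐 D`, self-adjoint because the form is symmetric.
  refine ⟨D.adjoint.comp (A.comp D), ?_, fun x => ?_, fun x v ξ y w ζ h h' => ?_⟩
  · rw [ContinuousLinearMap.isSelfAdjoint_iff_isSymmetric]
    intro x y
    change ⟪D.adjoint (A (D x)), y⟫_ℝ = ⟪x, D.adjoint (A (D y))⟫_ℝ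
    rw [ContinuousLinearMap.adjoint_inner_left, ContinuousLinearMap.adjoint_inner_right, hAsymm,
      real_inner_comm]
  · refine ⟨_, _, isAdmissiblePair_of_mem (hD1 x), fun w ζ h => ?_⟩
    rw [← inner_formOperator_toTrajectory F₁ F₂ F₃ (isAdmissiblePair_of_mem (hD1 x)) h,
      toTrajectory_isAdmissiblePair_of_mem (hD1 x)]
    exact hD2' x _ h.toTrajectory_mem
  · have hz : h.1.toTrajectory = D x := by
      refine hD3 x _ h.1.toTrajectory_mem fun m hm => ?_
      have h2 := inner_formOperator_toTrajectory F₁ F₂ F₃ h.1 (isAdmissiblePair_of_mem hm)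
      rw [toTrajectory_isAdmissiblePair_of_mem hm, h.2 _ _ (isAdmissiblePair_of_mem hm)] at h2
      exact h2
    rw [← inner_formOperator_toTrajectory F₁ F₂ F₃ h.1 h', hz]
    change _ = ⟪D.adjoint (A (D x)), y⟫_ℝ
    rw [ContinuousLinearMap.adjoint_inner_left]
    -- Two processes through `y` differ by one through 0, to which `D x` is orthogonal. The pairing
    -- therefore depends on `y` only, and the stationary process through `y` may be used to compute
    -- it.
    have h3 := (G.trajectoryRelation B).sub_mem h'.toTrajectory_mem (hD1 y)
    rw [Prod.mk_sub_mk, sub_self] at h3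
    have h4 := hD2' x _ h3
    rw [inner_sub_right] at h4
    exact sub_eq_zero.1 h4

end C0Semigroup

end Trajectories


/-! ### Concatenation and translation of processes -/

theorem setIntegral_Ioi_comp_add {E : Type*} [NormedAddCommGroup E] [NormedSpace ℝ E]
    (φ : ℝ → E) (a : ℝ) : ∫ t in Ioi (0 : ℝ), φ (a + t) = ∫ t in Ioi a, φ t := by
  have h := (measurePreserving_add_left (volume : Measure ℝ) a).setIntegral_preimage_emb
    (measurableEmbedding_addLeft a) φ (Ioi a)
  have e : (fun x => a + x) ⁻¹' Ioi a = Ioi (0 : ℝ) := by ext; simp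
  rwa [e] at h

theorem integral_Ioi_eq_add {E : Type*} [NormedAddCommGroup E] [NormedSpace ℝ E] {φ : ℝ → E}
    (hφ : IntegrableOn φ (Ioi 0)) {a : ℝ} (ha : 0 ≤ a) :
    ∫ t in Ioi (0 : ℝ), φ t = (∫ t in (0 : ℝ)..a, φ t) + ∫ t in Ioi (0 : ℝ), φ (a + t) := by
  rw [setIntegral_Ioi_comp_add,
    intervalIntegral.integral_interval_add_Ioi hφ (hφ.mono_set (Ioi_subset_Ioi ha))]

theorem MeasureTheory.MemLp.comp_add_Ioi {E : Type*} [NormedAddCommGroup E] {f : ℝ → E} {p : ENNReal}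
    (hf : MemLp f p (volume.restrict (Ioi 0))) {a : ℝ} (ha : 0 ≤ a) :
    MemLp (fun t => f (a + t)) p (volume.restrict (Ioi 0)) := by
  have h := (measurePreserving_add_left (volume : Measure ℝ) a).restrict_preimage
    (measurableSet_Ioi (a := a))
  have e : (fun x => a + x) ⁻¹' Ioi a = Ioi (0 : ℝ) := by ext; simp
  rw [e] at h
  exact (hf.mono_measure (Measure.restrict_mono (Ioi_subset_Ioi ha) le_rfl)).comp_measurePreserving h

/-- The function equal to `f` up to time `a` and to the translate of `g` afterwards. -/
noncomputable def concat {E : Type*} (a : ℝ) (f g : ℝ → E) (t : ℝ) : E :=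
  if t ≤ a then f t else g (t - a)

section Concat

variable {E : Type*} {a : ℝ} {f g : ℝ → E}

theorem concat_of_le {t : ℝ} (h : t ≤ a) : concat a f g t = f t := if_pos h

theorem concat_add {t : ℝ} (h : 0 < t) : concat a f g (a + t) = g t := by
  rw [concat, if_neg (by linarith), add_sub_cancel_left]

theorem memLp_concat [NormedAddCommGroup E] {p : ENNReal} (hf : MemLp f p (volume.restrict (Ioc 0 a)))
    (hg : MemLp g p (volume.restrict (Ioi 0))) (ha : 0 ≤ a) :
    MemLp (concat a f g) p (volume.restrict (Ioi 0)) := by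
  classical
  have e : concat a f g = (Iic a).piecewise f fun t => g (t - a) := by
    ext t
    simp [concat, piecewise]
  rw [e]
  refine MemLp.piecewise measurableSet_Iic ?_ ?_
  · rwa [Measure.restrict_restrict measurableSet_Iic, inter_comm, Ioi_inter_Iic]
  · have h := (measurePreserving_sub_right (volume : Measure ℝ) a).restrict_preimage
      (measurableSet_Ioi (a := (0 : ℝ)))
    have e : (fun x => x - a) ⁻¹' Ioi 0 = Ioi a := by ext; simp
    rw [e] at h
    rw [Measure.restrict_restrict measurableSet_Iic.compl, compl_Iic, Ioi_inter_Ioi,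
      sup_eq_left.2 ha]
    exact hg.comp_measurePreserving h

end Concat

theorem ContinuousOn.memLp_Ioc {E : Type*} [NormedAddCommGroup E] {f : ℝ → E} {p : ENNReal}
    (hf : ContinuousOn f (Ici 0)) (a : ℝ) : MemLp f p (volume.restrict (Ioc 0 a)) := by
  obtain ⟨C, hC⟩ := isCompact_Icc.exists_bound_of_continuousOn
    (hf.mono (Icc_subset_Ici_self : Icc 0 a ⊆ Ici 0))
  refine MemLp.of_bound ((hf.mono fun _ hx => hx.1.le).aestronglyMeasurable
    measurableSet_Ioc) C ?_
  filter_upwards [self_mem_ae_restrict measurableSet_Ioc] with x hx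
  exact hC x ⟨hx.1.le, hx.2⟩

theorem ContinuousOn.intervalIntegrable_Ici {E : Type*} [NormedAddCommGroup E] {f : ℝ → E}
    (hf : ContinuousOn f (Ici 0)) {a b : ℝ} (ha : 0 ≤ a) (hb : 0 ≤ b) :
    IntervalIntegrable f volume a b :=
  (hf.mono fun _ hx => (le_inf ha hb).trans hx.1).intervalIntegrable

namespace C0Semigroup

variable {H U : Type*} [NormedAddCommGroup H] [InnerProductSpace ℝ H] [CompleteSpace H]
  [NormedAddCommGroup U] [InnerProductSpace ℝ U] [CompleteSpace U]
  {G : C0Semigroup H} {B : U →L[ℝ] H} {F₁ : H →L[ℝ] H} {F₂ : H →L[ℝ] U} {F₃ : U →L[ℝ] U}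

theorem IsAdmissiblePair.continuousOn {x : H} {v : ℝ → H} {ξ : ℝ → U}
    (h : G.IsAdmissiblePair B x v ξ) : ContinuousOn v (Ici 0) :=
  (G.continuousOn_mild x fun _ hT => (B.comp_memLp' h.2.1).intervalIntegrable_of_Ioi le_rfl hT).congr
    h.2.2

theorem IsAdmissiblePair.tendsto_zero {x : H} {v : ℝ → H} {ξ : ℝ → U}
    (h : G.IsAdmissiblePair B x v ξ) : Tendsto v atTop (𝓝 0) :=
  G.tendsto_mild_zero h.1 (B.comp_memLp' h.2.1) h.2.2

theorem IsAdmissiblePair.apply_zero {x : H} {v : ℝ → H} {ξ : ℝ → U}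
    (h : G.IsAdmissiblePair B x v ξ) : v 0 = x := by
  rw [h.2.2 0 le_rfl]
  exact G.mild_zero _ _

theorem IsAdmissiblePair.shift {x : H} {v : ℝ → H} {ξ : ℝ → U}
    (h : G.IsAdmissiblePair B x v ξ) {a : ℝ} (ha : 0 ≤ a) :
    G.IsAdmissiblePair B (v a) (fun t => v (a + t)) fun t => ξ (a + t) := by
  refine ⟨h.1.comp_add_Ioi ha, h.2.1.comp_add_Ioi ha, fun t ht => ?_⟩
  have hI : IntervalIntegrable (fun s => B (ξ s)) volume 0 (a + t) :=
    (B.comp_memLp' h.2.1).intervalIntegrable_of_Ioi le_rfl (by linarith)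
  have h1 := G.mild_add x ha ht hI
  have h2 : v a = G.mild x (fun s => B (ξ s)) a := h.2.2 a ha
  rw [← h2] at h1
  exact (h.2.2 (a + t) (by linarith)).trans h1

/-- A trajectory on a finite interval becomes admissible once a square-integrable process is
attached at its end; this extracts finite-horizon information from the functional on the half-line.
-/
theorem isAdmissiblePair_concat {x : H} {v w : ℝ → H} {ξ ζ : ℝ → U} {a : ℝ} (ha : 0 ≤ a)
    (hξ : ContinuousOn ξ (Ici 0)) (hv : ∀ t, 0 ≤ t → v t = G.mild x (fun s => B (ξ s)) t)
    (h : G.IsAdmissiblePair B (v a) w ζ) :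
    G.IsAdmissiblePair B x (concat a v w) (concat a ξ ζ) := by
  have hBξ : ContinuousOn (fun s => B (ξ s)) (Ici 0) := B.continuous.comp_continuousOn hξ
  have hvc : ContinuousOn v (Ici 0) :=
    (G.continuousOn_mild x fun T hT => hBξ.intervalIntegrable_Ici le_rfl hT).congr hv
  have hζ := memLp_concat (hξ.memLp_Ioc a) h.2.1 ha
  refine ⟨memLp_concat (hvc.memLp_Ioc a) h.1 ha, hζ, fun t ht => ?_⟩
  have hfirst : ∀ t, 0 ≤ t → t ≤ a → G.mild x (fun s => B (concat a ξ ζ s)) t = v t := by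
    intro t h0 h1
    rw [hv t h0]
    exact G.mild_congr_Ioc x h0 fun s hs => by rw [concat_of_le (hs.2.trans h1)]
  change _ = G.mild x (fun s => B (concat a ξ ζ s)) t
  rcases le_or_gt t a with hta | hta
  · rw [hfirst t ht hta, concat_of_le hta]
  · obtain ⟨r, hr, rfl⟩ : ∃ r, 0 < r ∧ t = a + r := ⟨t - a, by linarith, by ring⟩
    have hI : IntervalIntegrable (fun s => B (concat a ξ ζ s)) volume 0 (a + r) :=
      (B.comp_memLp' hζ).intervalIntegrable_of_Ioi le_rfl ht
    rw [concat_add hr, G.mild_add x ha hr.le hI, hfirst a ha le_rfl]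
    refine (h.2.2 r hr.le).trans (G.mild_congr_Ioc _ hr.le fun s hs => ?_)
    rw [concat_add hs.1]

theorem integrableOn_polarForm {v w : ℝ → H} {ξ ζ : ℝ → U}
    (hv : MemLp v 2 (volume.restrict (Ioi 0))) (hξ : MemLp ξ 2 (volume.restrict (Ioi 0)))
    (hw : MemLp w 2 (volume.restrict (Ioi 0))) (hζ : MemLp ζ 2 (volume.restrict (Ioi 0))) :
    IntegrableOn (fun t => polarForm F₁ F₂ F₃ (v t) (ξ t) (w t) (ζ t)) (Ioi 0) :=
  (((F₁.comp_memLp' hv).add (F₂.adjoint.comp_memLp' hξ)).integrable_inner_of_two (𝕜 := ℝ) hw).add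
    (((F₂.comp_memLp' hv).add (F₃.comp_memLp' hξ)).integrable_inner_of_two (𝕜 := ℝ) hζ)

theorem integral_polarForm_concat {x y : H} {v w w' : ℝ → H} {ξ ζ ζ' : ℝ → U} {a : ℝ} (ha : 0 ≤ a)
    (h : G.IsAdmissiblePair B x v ξ)
    (h' : G.IsAdmissiblePair B y (concat a w w') (concat a ζ ζ')) :
    ∫ t in Ioi (0 : ℝ), polarForm F₁ F₂ F₃ (v t) (ξ t) (concat a w w' t) (concat a ζ ζ' t) =
      (∫ t in (0 : ℝ)..a, polarForm F₁ F₂ F₃ (v t) (ξ t) (w t) (ζ t)) +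
        ∫ t in Ioi (0 : ℝ), polarForm F₁ F₂ F₃ (v (a + t)) (ξ (a + t)) (w' t) (ζ' t) := by
  rw [integral_Ioi_eq_add (integrableOn_polarForm h.1 h.2.1 h'.1 h'.2.1) ha]
  congr 1
  · refine intervalIntegral.integral_congr fun t ht => ?_
    rw [uIcc_of_le ha] at ht
    simp only [concat_of_le ht.2]
  · refine setIntegral_congr_fun measurableSet_Ioi fun t ht => ?_
    simp only [concat_add (mem_Ioi.1 ht)]

theorem mild_zero_zero (G : C0Semigroup H) (t : ℝ) : G.mild 0 (fun _ => 0) t = 0 := by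
  simp [mild]

/-- The restriction of an optimal process to a later half-line is optimal. -/
theorem IsOptimalPair.shift {x : H} {v : ℝ → H} {ξ : ℝ → U}
    (h : IsOptimalPair G B F₁ F₂ F₃ x v ξ) {a : ℝ} (ha : 0 ≤ a) :
    IsOptimalPair G B F₁ F₂ F₃ (v a) (fun t => v (a + t)) fun t => ξ (a + t) := by
  refine ⟨h.1.shift ha, fun w ζ hw => ?_⟩
  -- A test process for the shifted problem is preceded by rest on `[0, a]`, which contributes
  -- nothing to the pairing.
  have hc : G.IsAdmissiblePair B 0 (concat a (fun _ => 0) w) (concat a (fun _ => 0) ζ) :=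
    isAdmissiblePair_concat (v := fun _ => 0) ha continuousOn_const
      (fun t _ => by simp only [map_zero]; rw [G.mild_zero_zero]) hw
  have h1 := h.2 _ _ hc
  rw [integral_polarForm_concat ha h.1 hc] at h1
  simpa [polarForm] using h1

/-- Dynamic programming identity. -/
theorem IsOptimalPair.dynamic_programming {P : H →L[ℝ] H}
    (hex : ∀ x, ∃ v ξ, IsOptimalPair G B F₁ F₂ F₃ x v ξ)
    (hP : ∀ x v ξ y w ζ, IsOptimalPair G B F₁ F₂ F₃ x v ξ → G.IsAdmissiblePair B y w ζ →
        ∫ t in Ioi (0 : ℝ), polarForm F₁ F₂ F₃ (v t) (ξ t) (w t) (ζ t) = ⟪P x, y⟫_ℝ)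
    {x y : H} {v w : ℝ → H} {ξ ζ : ℝ → U} (h : IsOptimalPair G B F₁ F₂ F₃ x v ξ)
    (hζ : ContinuousOn ζ (Ici 0)) (hw : ∀ t, 0 ≤ t → w t = G.mild y (fun s => B (ζ s)) t)
    {a : ℝ} (ha : 0 ≤ a) :
    (∫ t in (0 : ℝ)..a, polarForm F₁ F₂ F₃ (v t) (ξ t) (w t) (ζ t)) + ⟪P (v a), w a⟫_ℝ =
      ⟪P x, y⟫_ℝ := by
  -- The trajectory `w` need not be square-integrable, so after time `a` it is continued by a
  -- stationary process from `w a`.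
  obtain ⟨w', ζ', hw'⟩ := hex (w a)
  have hc := isAdmissiblePair_concat ha hζ hw hw'.1
  rw [← hP _ _ _ _ _ _ h hc, integral_polarForm_concat ha h.1 hc,
    hP _ _ _ _ _ _ (h.shift ha) hw'.1]

end C0Semigroup


/-! ### Optimal processes solve the Hamiltonian system -/

/-- The integrand may depend on the endpoint `r`, as in the Cauchy formula with `G(t + r - θ)`. -/
theorem tendsto_inv_smul_intervalIntegral {E : Type*} [NormedAddCommGroup E] [NormedSpace ℝ E]
    [CompleteSpace E] {φ : ℝ → ℝ → E} {y : E}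
    (hI : ∀ r, 0 ≤ r → IntervalIntegrable (φ r) volume 0 r)
    (h : ∀ ε > 0, ∀ᶠ r in 𝓝[>] (0 : ℝ), ∀ s, 0 < s → s ≤ r → ‖φ r s - y‖ ≤ ε) :
    Tendsto (fun r : ℝ => r⁻¹ • ∫ s in (0 : ℝ)..r, φ r s) (𝓝[>] 0) (𝓝 y) := by
  rw [Metric.tendsto_nhds]
  intro ε hε
  filter_upwards [h (ε / 2) (by positivity), self_mem_nhdsWithin] with r hr hr0
  have hr0 : 0 < r := hr0
  have e : r⁻¹ • (∫ s in (0 : ℝ)..r, φ r s) - y = r⁻¹ • ∫ s in (0 : ℝ)..r, (φ r s - y) := by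
    rw [intervalIntegral.integral_sub (hI r hr0.le) intervalIntegrable_const,
      intervalIntegral.integral_const, sub_zero, smul_sub, smul_smul, inv_mul_cancel₀ hr0.ne',
      one_smul]
  rw [dist_eq_norm, e, norm_smul, norm_inv, Real.norm_of_nonneg hr0.le, inv_mul_lt_iff₀ hr0]
  have := intervalIntegral.norm_integral_le_of_norm_le_const (a := 0) (b := r)
    (f := fun s => φ r s - y) (C := ε / 2) fun s hs => by
      rw [uIoc_of_le hr0.le] at hs
      exact hr s hs.1 hs.2
  rw [sub_zero, abs_of_pos hr0] at this
  nlinarith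

/-- Lebesgue differentiation of the vanishing primitive. -/
theorem ae_eq_zero_of_forall_intervalIntegral_eq_zero {E : Type*} [NormedAddCommGroup E]
    [NormedSpace ℝ E] [CompleteSpace E] {f : ℝ → E}
    (hf : ∀ T, 0 ≤ T → IntervalIntegrable f volume 0 T)
    (h : ∀ T, 0 ≤ T → ∫ t in (0 : ℝ)..T, f t = 0) : ∀ᵐ t ∂volume, 0 < t → f t = 0 := by
  have h1 := ae_all_iff.2 fun n : ℕ => (hf n n.cast_nonneg).ae_hasDerivAt_integral
  filter_upwards [h1] with t ht h0
  obtain ⟨n, hn⟩ := exists_nat_gt t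
  have h2 := ht n (by rw [uIcc_of_le n.cast_nonneg]; exact ⟨h0.le, hn.le⟩) 0 left_mem_uIcc
  refine h2.unique ((hasDerivAt_const t (0 : E)).congr_of_eventuallyEq ?_)
  filter_upwards [lt_mem_nhds h0] with x hx using h x hx.le

/-! ### Inverse of a coercive self-adjoint operator -/

section Coercive

variable {U : Type*} [NormedAddCommGroup U] [InnerProductSpace ℝ U] [CompleteSpace U]

theorem ContinuousLinearMap.isInvertible_of_coercive {F : U →L[ℝ] U}
    (h : ∃ c : ℝ, 0 < c ∧ ∀ ξ : U, c * ‖ξ‖ ^ 2 ≤ ⟪F ξ, ξ⟫_ℝ) : F.IsInvertible := by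
  obtain ⟨c, hc, h⟩ := h
  have hcoer : IsCoercive ((innerSL ℝ).comp F : U →L[ℝ] U →L[ℝ] ℝ) :=
    ⟨c, hc, fun u => by
      have := h u
      rw [pow_two, ← mul_assoc] at this
      exact this⟩
  refine ⟨hcoer.continuousLinearEquivOfBilin, ?_⟩
  ext u
  exact (hcoer.unique_continuousLinearEquivOfBilin fun w => rfl).symm

theorem ContinuousLinearMap.inner_inverse_left {F : U →L[ℝ] U} (hF : IsSelfAdjoint F)
    (h : F.IsInvertible) (a b : U) : ⟪F.inverse a, b⟫_ℝ = ⟪a, F.inverse b⟫_ℝ := by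
  have h1 := hF.isSymmetric (F.inverse a) (F.inverse b)
  simp only [ContinuousLinearMap.coe_coe] at h1
  rw [h.self_apply_inverse, h.self_apply_inverse] at h1
  exact h1.symm

end Coercive

section OptimalProcesses

variable {H U : Type*} [NormedAddCommGroup H] [InnerProductSpace ℝ H] [CompleteSpace H]
  [NormedAddCommGroup U] [InnerProductSpace ℝ U] [CompleteSpace U]

/-- The control `F₃⁻¹ (B* η - F₂ v)` attached to a state of the Hamiltonian system. -/
noncomputable def hamControl (B : U →L[ℝ] H) (F₂ : H →L[ℝ] U) (F₃ : U →L[ℝ] U) (v η : H) : U :=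
  F₃.inverse (B.adjoint η - F₂ v)

theorem hamV_eq (B : U →L[ℝ] H) (F₂ : H →L[ℝ] U) (F₃ : U →L[ℝ] U) (v η : H) :
    hamV B F₂ F₃ v η = B (hamControl B F₂ F₃ v η) := by
  rw [hamV, hamControl, map_sub, map_sub]
  abel

/-- Together with `hamV_eq` this brings the system to the form `v' = Av + Bξ`, `η' = -A*η + F₁v +
F₂*ξ`, in which its solutions can be compared with processes. -/
theorem hamEta_eq (B : U →L[ℝ] H) (F₁ : H →L[ℝ] H) (F₂ : H →L[ℝ] U) {F₃ : U →L[ℝ] U}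
    (hF₃ : IsSelfAdjoint F₃) (hinv : F₃.IsInvertible) (v η : H) :
    hamEta B F₁ F₂ F₃ v η = F₁ v + F₂.adjoint (hamControl B F₂ F₃ v η) := by
  have e : (B.comp (F₃.inverse.comp F₂)).adjoint η = F₂.adjoint (F₃.inverse (B.adjoint η)) := by
    refine ext_inner_right ℝ fun w => ?_
    rw [ContinuousLinearMap.adjoint_inner_left, ContinuousLinearMap.adjoint_inner_left,
      F₃.inner_inverse_left hF₃ hinv, ContinuousLinearMap.adjoint_inner_left]
    rfl
  rw [hamEta, e, hamControl, map_sub, map_sub]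
  abel

namespace C0Semigroup

variable {G : C0Semigroup H} {B : U →L[ℝ] H} {F₁ : H →L[ℝ] H} {F₂ : H →L[ℝ] U} {F₃ : U →L[ℝ] U}

theorem intervalIntegrable_op_sub (G : C0Semigroup H) {f : ℝ → H} {s t : ℝ} (hst : s ≤ t)
    (hf : IntervalIntegrable f volume s t) :
    IntervalIntegrable (fun θ => G.op (θ - s) (f θ)) volume s t := by
  obtain ⟨M, -, hM⟩ := G.exists_norm_op_le (t - s)
  rw [intervalIntegrable_iff_integrableOn_Ioc_of_le hst] at hf ⊢
  refine Integrable.mono' (hf.norm.const_mul M) ?_ ?_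
  · refine (G.aestronglyMeasurable_op hf.1 (fun θ => θ - s) (by fun_prop)).congr ?_
    filter_upwards [self_mem_ae_restrict measurableSet_Ioc] with θ hθ
    rw [max_eq_left (by linarith [hθ.1])]
  · filter_upwards [self_mem_ae_restrict measurableSet_Ioc] with θ hθ
    exact (G.op _).le_of_opNorm_le (hM _ (by linarith [hθ.1]) (by linarith [hθ.2])) _

theorem inner_integral_adjoint (G : C0Semigroup H) {g : ℝ → H} {s t : ℝ} (hst : s ≤ t)
    (hg : IntervalIntegrable g volume s t) (y : H) :
    ⟪∫ θ in s..t, (G.op (θ - s)).adjoint (g θ), y⟫_ℝ = ∫ θ in s..t, ⟪g θ, G.op (θ - s) y⟫_ℝ := by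
  have hI := G.adjoint.intervalIntegrable_op_sub hst hg
  simp only [adjoint_op] at hI
  rw [real_inner_comm, ← innerSL_apply_apply ℝ, ← (innerSL ℝ y).intervalIntegral_comp_comm hI]
  refine intervalIntegral.integral_congr fun θ _ => ?_
  simp only [innerSL_apply_apply]
  rw [ContinuousLinearMap.adjoint_inner_right, real_inner_comm]

theorem mild_const (G : C0Semigroup H) (y : H) {t : ℝ} (ht : 0 ≤ t) :
    G.mild 0 (fun _ => y) t = G.integrated t y := by
  rw [mild, map_zero, zero_add, integrated_apply,
    intervalIntegral.integral_comp_sub_left (fun s => G.op s y) t, sub_self, sub_zero]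
  refine intervalIntegral.integral_congr fun s hs => ?_
  rw [uIcc_of_le ht] at hs
  simp only [max_eq_left hs.1]

section Optimal

variable {P : H →L[ℝ] H} (hex : ∀ x, ∃ v ξ, IsOptimalPair G B F₁ F₂ F₃ x v ξ)
  (hP : ∀ x v ξ y w ζ, IsOptimalPair G B F₁ F₂ F₃ x v ξ → G.IsAdmissiblePair B y w ζ →
    ∫ t in Ioi (0 : ℝ), polarForm F₁ F₂ F₃ (v t) (ξ t) (w t) (ζ t) = ⟪P x, y⟫_ℝ)
  {x : H} {v : ℝ → H} {ξ : ℝ → U} (h : IsOptimalPair G B F₁ F₂ F₃ x v ξ)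

include hex hP h

/-- The costate `-P v` of an optimal process solves the adjoint equation. -/
theorem IsOptimalPair.adjoint_equation {s t : ℝ} (hs : 0 ≤ s) (hst : s ≤ t) :
    -P (v s) = (G.op (t - s)).adjoint (-P (v t)) -
      ∫ θ in s..t, (G.op (θ - s)).adjoint (F₁ (v θ) + F₂.adjoint (ξ θ)) := by
  have hg : IntervalIntegrable (fun θ => F₁ (v θ) + F₂.adjoint (ξ θ)) volume s t :=
    ((F₁.comp_memLp' h.1.1).add (F₂.adjoint.comp_memLp' h.1.2.1)).intervalIntegrable_of_Ioi hs
      (hs.trans hst)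
  refine ext_inner_right ℝ fun y => ?_
  -- The comparison trajectory `G(r) y` has zero control, so only the component `F₁v + F₂*ξ` of the
  -- polar form survives.
  have h1 := (h.shift hs).dynamic_programming hex hP (y := y) (w := fun r => G.op r y)
    (ζ := fun _ => 0) continuousOn_const (fun r _ => by simp [mild]) (sub_nonneg.2 hst)
  have h2 := intervalIntegral.integral_comp_add_left (a := 0) (b := t - s)
    (fun θ => ⟪F₁ (v θ) + F₂.adjoint (ξ θ), G.op (θ - s) y⟫_ℝ) s
  simp only [polarForm, inner_zero_right, add_zero, add_sub_cancel_left, add_sub_cancel] at h1 h2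
  rw [inner_sub_left, G.inner_integral_adjoint hst hg, ContinuousLinearMap.adjoint_inner_left,
    inner_neg_left, inner_neg_left, ← h2]
  linarith

/-- Dynamic programming on `[a, a + r]` against the constant control `u` started from 0, whose state
is the integrated semigroup applied to `B u`. Divided by `r`, this state tends to `B u`, which
produces `B*(-P v(a))`. -/
theorem IsOptimalPair.hasDerivWithinAt_integral (u : U) {a : ℝ} (ha : 0 ≤ a) :
    HasDerivWithinAt (fun T => ∫ t in (0 : ℝ)..T, ⟪F₂ (v t) + F₃ (ξ t), u⟫_ℝ)
      ⟪B.adjoint (-P (v a)), u⟫_ℝ (Ioi a) a := by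
  have hk : MemLp (fun t => F₂ (v t) + F₃ (ξ t)) 2 (volume.restrict (Ioi 0)) :=
    (F₂.comp_memLp' h.1.1).add (F₃.comp_memLp' h.1.2.1)
  have hg : MemLp (fun t => F₁ (v t) + F₂.adjoint (ξ t)) 2 (volume.restrict (Ioi 0)) :=
    (F₁.comp_memLp' h.1.1).add (F₂.adjoint.comp_memLp' h.1.2.1)
  have hga := hg.comp_add_Ioi ha
  have hka := hk.comp_add_Ioi ha
  have hku : ∀ b c, 0 ≤ b → 0 ≤ c →
      IntervalIntegrable (fun t => ⟪F₂ (v t) + F₃ (ξ t), u⟫_ℝ) volume b c := fun b c hb hc => by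
    refine (((innerSL ℝ u).comp_memLp' hk).intervalIntegrable_of_Ioi hb hc).congr
      fun t _ => ?_
    exact real_inner_comm _ _
  have hWc : ContinuousOn (fun r => G.integrated r (B u)) (Ici 0) :=
    (G.continuousOn_mild 0 (f := fun _ => B u) fun T _ => intervalIntegrable_const).congr
      fun r hr => (G.mild_const (B u) hr).symm
  have hgw : ∀ r, 0 ≤ r → IntervalIntegrable
      (fun t => ⟪F₁ (v (a + t)) + F₂.adjoint (ξ (a + t)), G.integrated t (B u)⟫_ℝ) volume 0 r := by
    intro r hr
    rw [intervalIntegrable_iff_integrableOn_Ioc_of_le hr]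
    exact (hga.mono_measure (Measure.restrict_mono (fun t ht => ht.1) le_rfl)).integrable_inner_of_two
      (𝕜 := ℝ) (hWc.memLp_Ioc r)
  have hdp : ∀ r, 0 < r → (∫ t in (0 : ℝ)..(a + r), ⟪F₂ (v t) + F₃ (ξ t), u⟫_ℝ) -
      (∫ t in (0 : ℝ)..a, ⟪F₂ (v t) + F₃ (ξ t), u⟫_ℝ) =
      ⟪-P (v (a + r)), G.integrated r (B u)⟫_ℝ - ∫ t in (0 : ℝ)..r,
        ⟪F₁ (v (a + t)) + F₂.adjoint (ξ (a + t)), G.integrated t (B u)⟫_ℝ := by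
    intro r hr
    have h1 := (h.shift ha).dynamic_programming hex hP (y := 0)
      (w := fun r => G.integrated r (B u)) (ζ := fun _ => u) continuousOn_const
      (fun r hr => (G.mild_const (B u) hr).symm) hr.le
    have h2 := intervalIntegral.integral_comp_add_left (a := 0) (b := r)
      (fun t => ⟪F₂ (v t) + F₃ (ξ t), u⟫_ℝ) a
    have h3 := intervalIntegral.integral_add (hgw r hr.le)
      (g := fun t => ⟪F₂ (v (a + t)) + F₃ (ξ (a + t)), u⟫_ℝ) (by
        refine (((innerSL ℝ u).comp_memLp' hka).intervalIntegrable_of_Ioi le_rfl hr.le).congr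
          fun t _ => ?_
        exact real_inner_comm _ _)
    rw [add_zero] at h2
    simp only [polarForm, inner_zero_right] at h1
    rw [intervalIntegral.integral_interval_sub_left (hku _ _ le_rfl (by linarith))
      (hku _ _ le_rfl ha), ← h2, inner_neg_left]
    rw [h3] at h1
    linarith
  refine hasDerivWithinAt_Ioi_of_tendsto ?_
  have hcont : Tendsto (fun r => -P (v (a + r))) (𝓝[>] 0) (𝓝 (-P (v a))) := by
    have h1 : Tendsto (fun r => a + r) (𝓝[>] 0) (𝓝[Ici 0] a) := by
      refine tendsto_nhdsWithin_iff.2 ⟨?_, ?_⟩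
      · have : Tendsto (fun r => a + r) (𝓝 0) (𝓝 (a + 0)) := (continuous_const_add a).tendsto 0
        rw [add_zero] at this
        exact this.mono_left nhdsWithin_le_nhds
      · filter_upwards [self_mem_nhdsWithin] with r hr
        exact add_nonneg ha (mem_Ioi.1 hr).le
    exact ((P.continuous.tendsto _).comp ((h.1.continuousOn a ha).tendsto.comp h1)).neg
  have hmain := hcont.inner (𝕜 := ℝ) (G.tendsto_inv_smul_integrated (B u))
  obtain ⟨M, hM1, hM⟩ := G.exists_norm_op_le 1
  have hint : Tendsto (fun r => ∫ t in (0 : ℝ)..r, ‖F₁ (v (a + t)) + F₂.adjoint (ξ (a + t))‖)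
      (𝓝[>] 0) (𝓝 0) := by
    have h1 := intervalIntegral.continuousOn_primitive_interval (μ := volume) (a := 0) (b := 1)
      (f := fun t => ‖F₁ (v (a + t)) + F₂.adjoint (ξ (a + t))‖) (by
        rw [uIcc_of_le zero_le_one, integrableOn_Icc_iff_integrableOn_Ioc,
          ← intervalIntegrable_iff_integrableOn_Ioc_of_le zero_le_one]
        exact (hga.intervalIntegrable_of_Ioi le_rfl zero_le_one).norm)
    have h2 := (h1 0 left_mem_uIcc).tendsto
    rw [intervalIntegral.integral_same, uIcc_of_le zero_le_one] at h2
    refine h2.mono_left ?_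
    rw [← nhdsWithin_Ioc_eq_nhdsGT zero_lt_one]
    exact nhdsWithin_mono _ Ioc_subset_Icc_self
  -- The comparison state is at most `r M ‖B u‖` in norm, which cancels `r⁻¹`; what remains is the
  -- integral of an integrable function over a shrinking interval.
  have herr : Tendsto (fun r => r⁻¹ • ∫ t in (0 : ℝ)..r,
      ⟪F₁ (v (a + t)) + F₂.adjoint (ξ (a + t)), G.integrated t (B u)⟫_ℝ) (𝓝[>] 0) (𝓝 0) := by
    refine squeeze_zero_norm' ?_ (by simpa using hint.const_mul (M * ‖B u‖))
    filter_upwards [self_mem_nhdsWithin, Ioc_mem_nhdsGT (zero_lt_one (α := ℝ))] with r hr hr1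
    have hr : 0 < r := hr
    rw [norm_smul, norm_inv, Real.norm_of_nonneg hr.le, inv_mul_le_iff₀ hr, ← mul_assoc,
      ← intervalIntegral.integral_const_mul]
    refine intervalIntegral.norm_integral_le_of_norm_le hr.le (Eventually.of_forall fun t ht => ?_)
      ((hga.intervalIntegrable_of_Ioi le_rfl hr.le).norm.const_mul _)
    refine (norm_inner_le_norm _ _).trans ?_
    rw [mul_comm]
    refine mul_le_mul_of_nonneg_right ?_ (norm_nonneg _)
    refine (G.norm_integrated_le ht.1.le (fun s h0 hs => hM s h0 (hs.trans (ht.2.trans hr1.2)))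
      (B u)).trans ?_
    rw [← mul_assoc]
    gcongr
    exact ht.2
  have := hmain.sub herr
  rw [sub_zero] at this
  rw [ContinuousLinearMap.adjoint_inner_left]
  refine this.congr' ?_
  filter_upwards [self_mem_nhdsWithin] with r hr
  rw [hdp r hr, smul_sub, inner_smul_right, smul_eq_mul, smul_eq_mul]

/-- The stationarity condition in the control. The primitive of the left side has the continuous
right side as its right derivative at every point, so all integrals over `[0, T]` agree and the
integrands coincide almost everywhere. -/
theorem IsOptimalPair.ae_adjoint_eq :
    ∀ᵐ t ∂volume, 0 < t → F₂ (v t) + F₃ (ξ t) = B.adjoint (-P (v t)) := by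
  have hk : MemLp (fun t => F₂ (v t) + F₃ (ξ t)) 2 (volume.restrict (Ioi 0)) :=
    (F₂.comp_memLp' h.1.1).add (F₃.comp_memLp' h.1.2.1)
  have hc : ContinuousOn (fun t => B.adjoint (-P (v t))) (Ici 0) :=
    B.adjoint.continuous.comp_continuousOn (P.continuous.comp_continuousOn h.1.continuousOn).neg
  have hI : ∀ T, 0 ≤ T → IntervalIntegrable (fun t => F₂ (v t) + F₃ (ξ t)) volume 0 T :=
    fun T hT => hk.intervalIntegrable_of_Ioi le_rfl hT
  have hI' : ∀ T, 0 ≤ T → IntervalIntegrable (fun t => B.adjoint (-P (v t))) volume 0 T :=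
    fun T hT => hc.intervalIntegrable_Ici le_rfl hT
  have key := ae_eq_zero_of_forall_intervalIntegral_eq_zero (fun T hT => (hI T hT).sub (hI' T hT))
    fun T hT => by
      refine ext_inner_left ℝ fun u => ?_
      rw [intervalIntegral.integral_sub (hI T hT) (hI' T hT), inner_zero_right, inner_sub_right,
        sub_eq_zero, ← innerSL_apply_apply ℝ u, ← innerSL_apply_apply ℝ u,
        ← (innerSL ℝ u).intervalIntegral_comp_comm (hI T hT),
        ← (innerSL ℝ u).intervalIntegral_comp_comm (hI' T hT)]
      have hIu := ((innerSL ℝ u).comp_memLp' hk).intervalIntegrable_of_Ioi le_rfl hT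
      have h1 := intervalIntegral.integral_eq_sub_of_hasDeriv_right_of_le hT
        (f := fun T => ∫ t in (0 : ℝ)..T, ⟪F₂ (v t) + F₃ (ξ t), u⟫_ℝ)
        (f' := fun t => ⟪B.adjoint (-P (v t)), u⟫_ℝ) (by
          have := intervalIntegral.continuousOn_primitive_interval (μ := volume) (a := 0) (b := T)
            (f := fun t => ⟪F₂ (v t) + F₃ (ξ t), u⟫_ℝ) (by
              rw [uIcc_of_le hT, integrableOn_Icc_iff_integrableOn_Ioc,
                ← intervalIntegrable_iff_integrableOn_Ioc_of_le hT]
              exact hIu.congr fun t _ => real_inner_comm _ _)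
          rwa [uIcc_of_le hT] at this)
        (fun t ht => h.hasDerivWithinAt_integral hex hP u ht.1.le)
        ((hc.inner continuousOn_const).intervalIntegrable_Ici le_rfl hT)
      rw [intervalIntegral.integral_same, sub_zero] at h1
      simp only [innerSL_apply_apply]
      simp only [real_inner_comm u] at h1
      exact h1.symm
  filter_upwards [key] with t ht h0
  exact sub_eq_zero.1 (ht h0)

theorem IsOptimalPair.isHamiltonianSolution (hF₃ : IsSelfAdjoint F₃) (hinv : F₃.IsInvertible) :
    IsHamiltonianSolution G B F₁ F₂ F₃ v fun t => -P (v t) := by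
  have hξ : ∀ᵐ t ∂volume, 0 < t → hamControl B F₂ F₃ (v t) (-P (v t)) = ξ t := by
    filter_upwards [h.ae_adjoint_eq hex hP] with t ht h0
    rw [hamControl, ← ht h0, add_sub_cancel_left, hinv.inverse_apply_self]
  refine ⟨h.1.continuousOn, (P.continuous.comp_continuousOn h.1.continuousOn).neg,
    fun s t hs hst => ⟨?_, ?_⟩⟩
  · have hI : IntervalIntegrable (fun s => B (ξ s)) volume 0 t :=
      (B.comp_memLp' h.1.2.1).intervalIntegrable_of_Ioi le_rfl (hs.trans hst)
    have h1 := G.op_mild x hs hst hI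
    have e : ∀ r, 0 ≤ r → G.mild x (fun s => B (ξ s)) r = v r := fun r hr => (h.1.2.2 r hr).symm
    rw [e t (hs.trans hst), e s hs] at h1
    rw [h1]
    congr 1
    refine intervalIntegral.integral_congr_ae ?_
    filter_upwards [hξ] with θ hθ hm
    rw [uIoc_of_le hst] at hm
    rw [hamV_eq, hθ (hs.trans_lt hm.1)]
  · refine (h.adjoint_equation hex hP hs hst).trans ?_
    congr 1
    refine intervalIntegral.integral_congr_ae ?_
    filter_upwards [hξ] with θ hθ hm
    rw [uIoc_of_le hst] at hm
    rw [hamEta_eq B F₁ F₂ hF₃ hinv, hθ (hs.trans_lt hm.1)]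

theorem IsOptimalPair.mem_boundedSubspace (hF₃ : IsSelfAdjoint F₃) (hinv : F₃.IsInvertible) :
    (x, -P x) ∈ boundedSubspace G B F₁ F₂ F₃ := by
  obtain ⟨C, hC⟩ := exists_norm_le_of_continuousOn_of_tendsto h.1.continuousOn h.1.tendsto_zero
  refine ⟨v, fun t => -P (v t), h.isHamiltonianSolution hex hP hF₃ hinv, by
    simp only [h.1.apply_zero], max C (‖P‖ * C), fun t ht => ⟨?_, ?_⟩⟩
  · exact (hC t ht).trans (le_max_left _ _)
  · rw [norm_neg]
    exact (P.le_opNorm_of_le (hC t ht)).trans (le_max_right _ _)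

end Optimal

end C0Semigroup

end OptimalProcesses


/-! ### Bounded solutions of the Hamiltonian system -/

section BoundedSolutions

variable {H U : Type*} [NormedAddCommGroup H] [InnerProductSpace ℝ H] [CompleteSpace H]
  [NormedAddCommGroup U] [InnerProductSpace ℝ U] [CompleteSpace U]
  {G : C0Semigroup H} {B : U →L[ℝ] H} {F₁ : H →L[ℝ] H} {F₂ : H →L[ℝ] U} {F₃ : U →L[ℝ] U}

namespace C0Semigroup

theorem eventually_norm_op_sub_le (G : C0Semigroup H) {f : ℝ → H} (hf : ContinuousOn f (Ici 0))
    {t : ℝ} (ht : 0 ≤ t) {ε : ℝ} (hε : 0 < ε) :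
    ∀ᶠ r in 𝓝[>] (0 : ℝ), ∀ τ s, 0 ≤ τ → τ ≤ r → 0 ≤ s → s ≤ r →
      ‖G.op τ (f (t + s)) - f t‖ ≤ ε := by
  have h1 := Metric.continuousAt_iff.1
    (G.continuous_op_max_uncurry.continuousAt (x := ((0 : ℝ), f t))) ε hε
  obtain ⟨ρ, hρ, h1⟩ := h1
  obtain ⟨ρ', hρ', h2⟩ := Metric.continuousWithinAt_iff.1 (hf t ht) ρ hρ
  filter_upwards [Ioo_mem_nhdsGT (lt_min hρ hρ')] with r hr τ s hτ hτr hs hsr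
  have h3 := h2 (x := t + s) (add_nonneg ht hs) (by
    rw [dist_eq_norm, add_sub_cancel_left, Real.norm_of_nonneg hs]
    exact hsr.trans_lt (hr.2.trans_le (min_le_right _ _)))
  have h4 := h1 (x := (τ, f (t + s))) (by
    rw [Prod.dist_eq, max_lt_iff]
    refine ⟨?_, h3⟩
    rw [dist_zero_right, Real.norm_of_nonneg hτ]
    exact hτr.trans_lt (hr.2.trans_le (min_le_left _ _)))
  simp only [max_self, max_eq_left hτ, G.op_zero_apply, dist_eq_norm] at h4
  exact h4.le

theorem tendsto_inv_smul_integral_op (G : C0Semigroup H) {f : ℝ → H} (hf : ContinuousOn f (Ici 0))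
    {t : ℝ} (ht : 0 ≤ t) :
    Tendsto (fun r : ℝ => r⁻¹ • ∫ θ in t..(t + r), G.op (t + r - θ) (f θ)) (𝓝[>] 0) (𝓝 (f t)) := by
  have hI : ∀ r, 0 ≤ r → IntervalIntegrable (fun s => f (t + s)) volume 0 r := fun r hr =>
    (hf.comp (by fun_prop : Continuous fun s => t + s).continuousOn fun s hs =>
      mem_Ici.2 (add_nonneg ht (mem_Ici.1 hs))).intervalIntegrable_Ici le_rfl hr
  have h := tendsto_inv_smul_intervalIntegral (φ := fun r s => G.op (r - s) (f (t + s))) (y := f t)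
    (fun r hr => G.intervalIntegrable_op hr le_rfl (hI r hr)) fun ε hε => by
      filter_upwards [G.eventually_norm_op_sub_le hf ht hε] with r hr s h0 hs
      exact hr _ _ (sub_nonneg.2 hs) (by linarith) h0.le hs
  refine h.congr fun r => ?_
  have := intervalIntegral.integral_comp_add_left (a := 0) (b := r)
    (fun θ => G.op (t + r - θ) (f θ)) t
  rw [add_zero] at this
  rw [← this]
  simp only [add_sub_add_left_eq_sub]

theorem tendsto_inv_smul_integral_op' (G : C0Semigroup H) {f : ℝ → H} (hf : ContinuousOn f (Ici 0))
    {t : ℝ} (ht : 0 ≤ t) :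
    Tendsto (fun r : ℝ => r⁻¹ • ∫ θ in t..(t + r), G.op (θ - t) (f θ)) (𝓝[>] 0) (𝓝 (f t)) := by
  have hI : ∀ r, 0 ≤ r → IntervalIntegrable (fun s => f (t + s)) volume 0 r := fun r hr =>
    (hf.comp (by fun_prop : Continuous fun s => t + s).continuousOn fun s hs =>
      mem_Ici.2 (add_nonneg ht (mem_Ici.1 hs))).intervalIntegrable_Ici le_rfl hr
  have h := tendsto_inv_smul_intervalIntegral (φ := fun _ s => G.op s (f (t + s))) (y := f t)
    (fun r hr => by simpa using G.intervalIntegrable_op_sub hr (hI r hr)) fun ε hε => by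
      filter_upwards [G.eventually_norm_op_sub_le hf ht hε] with r hr s h0 hs
      exact hr _ _ h0.le hs h0.le hs
  refine h.congr fun r => ?_
  have := intervalIntegral.integral_comp_add_left (a := 0) (b := r)
    (fun θ => G.op (θ - t) (f θ)) t
  rw [add_zero] at this
  rw [← this]
  simp only [add_sub_cancel_left]

end C0Semigroup

namespace IsHamiltonianSolution

open C0Semigroup

variable {v η : ℝ → H}

theorem continuousOn_hamControl (h : IsHamiltonianSolution G B F₁ F₂ F₃ v η) :
    ContinuousOn (fun t => hamControl B F₂ F₃ (v t) (η t)) (Ici 0) :=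
  F₃.inverse.continuous.comp_continuousOn
    ((B.adjoint.continuous.comp_continuousOn h.2.1).sub (F₂.continuous.comp_continuousOn h.1))

theorem continuousOn_hamV (h : IsHamiltonianSolution G B F₁ F₂ F₃ v η) :
    ContinuousOn (fun t => hamV B F₂ F₃ (v t) (η t)) (Ici 0) := by
  simp only [hamV_eq]
  exact B.continuous.comp_continuousOn h.continuousOn_hamControl

theorem continuousOn_hamEta (h : IsHamiltonianSolution G B F₁ F₂ F₃ v η) :
    ContinuousOn (fun t => hamEta B F₁ F₂ F₃ (v t) (η t)) (Ici 0) := by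
  have hc : Continuous fun p : H × H => hamEta B F₁ F₂ F₃ p.1 p.2 := by
    unfold hamEta
    fun_prop
  exact hc.comp_continuousOn (h.1.prodMk h.2.1)

theorem sub (h : IsHamiltonianSolution G B F₁ F₂ F₃ v η) {v' η' : ℝ → H}
    (h' : IsHamiltonianSolution G B F₁ F₂ F₃ v' η') :
    IsHamiltonianSolution G B F₁ F₂ F₃ (fun t => v t - v' t) fun t => η t - η' t := by
  refine ⟨h.1.sub h'.1, h.2.1.sub h'.2.1, fun s t hs hst => ⟨?_, ?_⟩⟩
  · have e : ∀ θ, G.op (t - θ) (hamV B F₂ F₃ (v θ - v' θ) (η θ - η' θ)) =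
        G.op (t - θ) (hamV B F₂ F₃ (v θ) (η θ)) - G.op (t - θ) (hamV B F₂ F₃ (v' θ) (η' θ)) := by
      intro θ
      simp only [hamV, map_sub, map_add, map_neg]
      abel
    simp only [e]
    rw [intervalIntegral.integral_sub
      (G.intervalIntegrable_op hst le_rfl
        (h.continuousOn_hamV.intervalIntegrable_Ici hs (hs.trans hst)))
      (G.intervalIntegrable_op hst le_rfl
        (h'.continuousOn_hamV.intervalIntegrable_Ici hs (hs.trans hst))), map_sub,
      (h.2.2 s t hs hst).1, (h'.2.2 s t hs hst).1]
    abel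
  · have e : ∀ θ, (G.op (θ - s)).adjoint (hamEta B F₁ F₂ F₃ (v θ - v' θ) (η θ - η' θ)) =
        (G.op (θ - s)).adjoint (hamEta B F₁ F₂ F₃ (v θ) (η θ)) -
          (G.op (θ - s)).adjoint (hamEta B F₁ F₂ F₃ (v' θ) (η' θ)) := by
      intro θ
      simp only [hamEta, map_sub, map_add]
      abel
    have hI := G.adjoint.intervalIntegrable_op_sub hst
      (h.continuousOn_hamEta.intervalIntegrable_Ici hs (hs.trans hst))
    have hI' := G.adjoint.intervalIntegrable_op_sub hst
      (h'.continuousOn_hamEta.intervalIntegrable_Ici hs (hs.trans hst))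
    simp only [adjoint_op] at hI hI'
    simp only [e]
    rw [intervalIntegral.integral_sub hI hI', map_sub,
      (h.2.2 s t hs hst).2, (h'.2.2 s t hs hst).2]
    abel

theorem eq_mild (h : IsHamiltonianSolution G B F₁ F₂ F₃ v η) {t : ℝ} (ht : 0 ≤ t) :
    v t = G.mild (v 0) (fun s => B (hamControl B F₂ F₃ (v s) (η s))) t := by
  have h1 := (h.2.2 0 t le_rfl ht).1
  simp only [hamV_eq, sub_zero] at h1
  exact h1

/-- Formally the terms with `A` and `A*` cancel, but mild solutions need not be differentiable. The
cancellation is made on increments instead: `G(r)` is moved from `v(t)` onto `η(t + r)`, where the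
backward Cauchy formula absorbs it. -/
theorem hasDerivWithinAt_inner (h : IsHamiltonianSolution G B F₁ F₂ F₃ v η)
    (hF₃ : IsSelfAdjoint F₃) (hinv : F₃.IsInvertible) {t : ℝ} (ht : 0 ≤ t) :
    HasDerivWithinAt (fun t => ⟪v t, η t⟫_ℝ)
      (quadForm F₁ F₂ F₃ (v t) (hamControl B F₂ F₃ (v t) (η t))) (Ioi t) t := by
  refine hasDerivWithinAt_Ioi_of_tendsto ?_
  have hη : Tendsto (fun r => η (t + r)) (𝓝[>] 0) (𝓝 (η t)) := by
    have h1 : Tendsto (fun r => t + r) (𝓝[>] 0) (𝓝[Ici 0] t) := by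
      refine tendsto_nhdsWithin_iff.2 ⟨?_, ?_⟩
      · have : Tendsto (fun r => t + r) (𝓝 0) (𝓝 (t + 0)) := (continuous_const_add t).tendsto 0
        rw [add_zero] at this
        exact this.mono_left nhdsWithin_le_nhds
      · filter_upwards [self_mem_nhdsWithin] with r hr
        exact add_nonneg ht (mem_Ioi.1 hr).le
    exact (h.2.1 t ht).tendsto.comp h1
  have h1 := (tendsto_const_nhds (x := v t)).inner (𝕜 := ℝ)
    (G.adjoint.tendsto_inv_smul_integral_op' h.continuousOn_hamEta ht)
  have h2 := (G.tendsto_inv_smul_integral_op h.continuousOn_hamV ht).inner (𝕜 := ℝ) hη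
  -- Since `B*η = F₃ξ + F₂v`, the bounded terms add up to `(v, F₁v + F₂*ξ) + (ξ, F₃ξ + F₂v) = 𝓕(v,
  -- ξ)`.
  have e : ⟪v t, hamEta B F₁ F₂ F₃ (v t) (η t)⟫_ℝ + ⟪hamV B F₂ F₃ (v t) (η t), η t⟫_ℝ =
      quadForm F₁ F₂ F₃ (v t) (hamControl B F₂ F₃ (v t) (η t)) := by
    have e1 : B.adjoint (η t) = F₃ (hamControl B F₂ F₃ (v t) (η t)) + F₂ (v t) := by
      rw [hamControl, hinv.self_apply_inverse, sub_add_cancel]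
    rw [hamV_eq, hamEta_eq B F₁ F₂ hF₃ hinv, ← ContinuousLinearMap.adjoint_inner_right, e1,
      inner_add_right, inner_add_right, ContinuousLinearMap.adjoint_inner_right, quadForm,
      real_inner_comm _ (F₃ _), real_inner_comm _ (F₁ _), real_inner_comm _ (F₂ _)]
    ring
  rw [← e]
  refine (h1.add h2).congr' ?_
  filter_upwards [self_mem_nhdsWithin] with r hr
  have hr : 0 < r := hr
  have h3 := (h.2.2 t (t + r) ht (by linarith)).1
  have h4 := (h.2.2 t (t + r) ht (by linarith)).2
  rw [add_sub_cancel_left] at h3 h4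
  have h5 : ⟪v (t + r), η (t + r)⟫_ℝ = ⟪v t, (G.op r).adjoint (η (t + r))⟫_ℝ +
      ⟪∫ θ in t..(t + r), G.op (t + r - θ) (hamV B F₂ F₃ (v θ) (η θ)), η (t + r)⟫_ℝ := by
    conv_lhs => rw [h3]
    rw [inner_add_left, ContinuousLinearMap.adjoint_inner_right]
  have h6 : (G.op r).adjoint (η (t + r)) = η t +
      ∫ θ in t..(t + r), (G.op (θ - t)).adjoint (hamEta B F₁ F₂ F₃ (v θ) (η θ)) := by
    rw [h4]; abel
  rw [h5, h6, inner_add_right, inner_smul_right, real_inner_smul_left, smul_eq_mul]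
  simp only [adjoint_op]
  ring

theorem continuousOn_quadForm (h : IsHamiltonianSolution G B F₁ F₂ F₃ v η) :
    ContinuousOn (fun t => quadForm F₁ F₂ F₃ (v t) (hamControl B F₂ F₃ (v t) (η t))) (Ici 0) := by
  have hξ := h.continuousOn_hamControl
  have hv := h.1
  exact (((F₁.continuous.comp_continuousOn hv).inner hv).add
    (continuousOn_const.mul ((F₂.continuous.comp_continuousOn hv).inner hξ))).add
      ((F₃.continuous.comp_continuousOn hξ).inner hξ)

/-- The energy identity. -/
theorem integral_quadForm (h : IsHamiltonianSolution G B F₁ F₂ F₃ v η)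
    (hF₃ : IsSelfAdjoint F₃) (hinv : F₃.IsInvertible) {T : ℝ} (hT : 0 ≤ T) :
    ∫ t in (0 : ℝ)..T, quadForm F₁ F₂ F₃ (v t) (hamControl B F₂ F₃ (v t) (η t)) =
      ⟪v T, η T⟫_ℝ - ⟪v 0, η 0⟫_ℝ :=
  intervalIntegral.integral_eq_sub_of_hasDeriv_right_of_le hT
    ((h.1.inner h.2.1).mono Icc_subset_Ici_self)
    (fun _ ht => h.hasDerivWithinAt_inner hF₃ hinv ht.1.le)
    (h.continuousOn_quadForm.intervalIntegrable_Ici le_rfl hT)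

theorem adjoint_apply_of_eq_zero (h : IsHamiltonianSolution G B F₁ F₂ F₃ v η)
    (hF₃ : IsSelfAdjoint F₃) (hinv : F₃.IsInvertible) (hv : ∀ t, 0 ≤ t → v t = 0)
    (hξ : ∀ t, 0 ≤ t → hamControl B F₂ F₃ (v t) (η t) = 0) {t : ℝ} (ht : 0 ≤ t) :
    B.adjoint (η t) = 0 ∧ ∀ s, 0 ≤ s → s ≤ t → η s = (G.op (t - s)).adjoint (η t) := by
  constructor
  · have := congrArg F₃ (hξ t ht)
    rwa [hamControl, hinv.self_apply_inverse, hv t ht, map_zero, map_zero, sub_zero] at this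
  · intro s hs hst
    have h1 := (h.2.2 s t hs hst).2
    rw [intervalIntegral.integral_congr (g := fun _ => 0), intervalIntegral.integral_zero,
      sub_zero] at h1
    · exact h1
    · intro θ hθ
      rw [uIcc_of_le hst] at hθ
      have h0 : 0 ≤ θ := hs.trans hθ.1
      simp only
      rw [hamEta_eq B F₁ F₂ hF₃ hinv, hξ θ h0, hv θ h0, map_zero, map_zero, add_zero, map_zero]

/-- A bounded solution of the adjoint equation that is invisible to the control vanishes if the
system is `L₂`-controllable. -/
theorem costate_eq_zero (hctrl : G.L2Controllable B) {C : ℝ} (hC : ∀ t, 0 ≤ t → ‖η t‖ ≤ C)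
    (h : ∀ t, 0 ≤ t → B.adjoint (η t) = 0 ∧
      ∀ s, 0 ≤ s → s ≤ t → η s = (G.op (t - s)).adjoint (η t)) : η 0 = 0 := by
  refine ext_inner_right ℝ fun w => ?_
  obtain ⟨y, ζ, hy⟩ := hctrl w
  rw [inner_zero_left]
  -- The pairing with a process is constant: the control contributes `(η(t), G(t - s) B ζ(s)) =
  -- (B*η(s), ζ(s)) = 0`.
  have h1 : ∀ t, 0 ≤ t → ⟪η t, y t⟫_ℝ = ⟪η 0, w⟫_ℝ := by
    intro t ht
    have hI : IntervalIntegrable (fun s => B (ζ s)) volume 0 t :=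
      (B.comp_memLp' hy.2.1).intervalIntegrable_of_Ioi le_rfl ht
    rw [hy.2.2 t ht, inner_add_right, ← innerSL_apply_apply ℝ (η t) (∫ s in (0 : ℝ)..t, _),
      ← (innerSL ℝ (η t)).intervalIntegral_comp_comm (G.intervalIntegrable_op ht le_rfl hI),
      intervalIntegral.integral_congr (g := fun _ => 0), intervalIntegral.integral_zero, add_zero,
      (h t ht).2 0 le_rfl ht, ContinuousLinearMap.adjoint_inner_left, sub_zero]
    intro s hs
    rw [uIcc_of_le ht] at hs
    simp only [innerSL_apply_apply]
    rw [← ContinuousLinearMap.adjoint_inner_left, ← (h t ht).2 s hs.1 hs.2,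
      ← ContinuousLinearMap.adjoint_inner_left, (h s hs.1).1, inner_zero_left]
  have h2 : Tendsto (fun t => ⟪η t, y t⟫_ℝ) atTop (𝓝 0) := by
    have h3 := (tendsto_zero_iff_norm_tendsto_zero.1 hy.tendsto_zero).const_mul C
    rw [mul_zero] at h3
    refine squeeze_zero_norm' ?_ h3
    filter_upwards [eventually_ge_atTop 0] with t ht
    exact (norm_inner_le_norm _ _).trans (mul_le_mul_of_nonneg_right (hC t ht) (norm_nonneg _))
  refine tendsto_nhds_unique (tendsto_const_nhds.congr' ?_) h2
  filter_upwards [eventually_ge_atTop 0] with t ht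
  exact (h1 t ht).symm

end IsHamiltonianSolution

/-! ### Square-integrability of continuous functions on the half-line -/

section Continuous

variable {E : Type*} [NormedAddCommGroup E] {f : ℝ → E}

theorem ContinuousOn.memLp_two_Ioi_of_bounded (hf : ContinuousOn f (Ici 0)) {K : ℝ}
    (h : ∀ T, 0 ≤ T → ∫ t in (0 : ℝ)..T, ‖f t‖ ^ 2 ≤ K) : MemLp f 2 (volume.restrict (Ioi 0)) := by
  have hm : AEStronglyMeasurable f (volume.restrict (Ioi 0)) :=
    (hf.mono Ioi_subset_Ici_self).aestronglyMeasurable measurableSet_Ioi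
  rw [memLp_two_iff_integrable_sq_norm hm]
  refine integrableOn_Ioi_of_intervalIntegral_norm_bounded (l := atTop) (b := id) K 0 (fun T => ?_)
    tendsto_id ?_
  · exact ((hf.norm.pow 2).memLp_Ioc (p := 1) T).integrable le_rfl
  · filter_upwards [eventually_ge_atTop 0] with T hT
    simpa using h T hT

theorem ContinuousOn.eq_zero_of_integral_norm_sq_le (hf : ContinuousOn f (Ici 0))
    (h2 : MemLp f 2 (volume.restrict (Ioi 0))) (h : ∫ t in Ioi (0 : ℝ), ‖f t‖ ^ 2 ≤ 0) {t : ℝ}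
    (ht : 0 ≤ t) : f t = 0 := by
  have h1 := (setIntegral_eq_zero_iff_of_nonneg_ae (Eventually.of_forall fun t => sq_nonneg ‖f t‖)
    h2.integrableOn_norm_sq_Ioi).1 (h.antisymm (integral_nonneg fun t => sq_nonneg _))
  have h3 : f =ᵐ[volume.restrict (Ici 0)] fun _ => 0 := by
    rw [← restrict_Ioi_eq_restrict_Ici]
    filter_upwards [h1] with t ht
    simpa using ht
  exact Measure.eqOn_of_ae_eq h3 hf continuousOn_const (by simp) ht

theorem integral_norm_sq_le_concat {a : ℝ} {g : ℝ → E} (ha : 0 ≤ a)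
    (h : MemLp (concat a f g) 2 (volume.restrict (Ioi 0))) :
    ∫ t in (0 : ℝ)..a, ‖f t‖ ^ 2 ≤ ∫ t in Ioi (0 : ℝ), ‖concat a f g t‖ ^ 2 := by
  rw [integral_Ioi_eq_add h.integrableOn_norm_sq_Ioi ha]
  have e : ∫ t in (0 : ℝ)..a, ‖concat a f g t‖ ^ 2 = ∫ t in (0 : ℝ)..a, ‖f t‖ ^ 2 := by
    refine intervalIntegral.integral_congr fun t ht => ?_
    rw [uIcc_of_le ha] at ht
    simp only [concat_of_le ht.2]
  rw [e]
  exact le_add_of_nonneg_right (integral_nonneg fun t => sq_nonneg _)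

end Continuous

/-! ### Uniqueness of the bounded solution with given state at time 0 -/

namespace C0Semigroup

variable {P : H →L[ℝ] H} (hex : ∀ x, ∃ v ξ, IsOptimalPair G B F₁ F₂ F₃ x v ξ)
  (hP : ∀ x v ξ y w ζ, IsOptimalPair G B F₁ F₂ F₃ x v ξ → G.IsAdmissiblePair B y w ζ →
    ∫ t in Ioi (0 : ℝ), polarForm F₁ F₂ F₃ (v t) (ξ t) (w t) (ζ t) = ⟪P x, y⟫_ℝ)
  {κ : ℝ} (hκ : 0 < κ) (hco : ∀ (v : ℝ → H) (ξ : ℝ → U), G.IsAdmissiblePair B 0 v ξ →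
    κ * ((∫ t in Ioi (0 : ℝ), ‖v t‖ ^ 2) + ∫ t in Ioi (0 : ℝ), ‖ξ t‖ ^ 2) ≤
      integralFunctional F₁ F₂ F₃ v ξ)
  {v η : ℝ → H} (h : IsHamiltonianSolution G B F₁ F₂ F₃ v η) (hv0 : v 0 = 0)
  {C : ℝ} (hC : ∀ t, 0 ≤ t → ‖v t‖ ≤ C ∧ ‖η t‖ ≤ C)
  (hF₃ : IsSelfAdjoint F₃) (hinv : F₃.IsInvertible)

include hex hP hκ hco h hv0 in
-- Following `v` up to `T` and a stationary process afterwards is a process through 0, so coercivity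
-- applies to it. The tail contributes `(P v(T), v(T))` to the functional, and its norms are
-- dropped.
theorem coercive_on_interval {T : ℝ} (hT : 0 ≤ T) :
    κ * ((∫ t in (0 : ℝ)..T, ‖v t‖ ^ 2) +
        ∫ t in (0 : ℝ)..T, ‖hamControl B F₂ F₃ (v t) (η t)‖ ^ 2) ≤
      (∫ t in (0 : ℝ)..T, quadForm F₁ F₂ F₃ (v t) (hamControl B F₂ F₃ (v t) (η t))) +
        ⟪P (v T), v T⟫_ℝ := by
  obtain ⟨w, ω, hw⟩ := hex (v T)
  have hc := isAdmissiblePair_concat hT h.continuousOn_hamControl (fun t ht => h.eq_mild ht) hw.1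
  rw [hv0] at hc
  have h1 := hco _ _ hc
  have h2 : ⟪P (v T), v T⟫_ℝ = ∫ t in Ioi (0 : ℝ), quadForm F₁ F₂ F₃ (w t) (ω t) := by
    rw [← hP _ _ _ _ _ _ hw hw.1]
    simp only [polarForm_self]
  have h3 : integralFunctional F₁ F₂ F₃ (concat T v w)
      (concat T (fun t => hamControl B F₂ F₃ (v t) (η t)) ω) =
      (∫ t in (0 : ℝ)..T, quadForm F₁ F₂ F₃ (v t) (hamControl B F₂ F₃ (v t) (η t))) +
        ⟪P (v T), v T⟫_ℝ := by
    rw [integralFunctional, integral_Ioi_eq_add (integrableOn_quadForm hc.1 hc.2.1) hT, h2]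
    congr 1
    · refine intervalIntegral.integral_congr fun t ht => ?_
      rw [uIcc_of_le hT] at ht
      simp only [concat_of_le ht.2]
    · refine setIntegral_congr_fun measurableSet_Ioi fun t ht => ?_
      simp only [concat_add (mem_Ioi.1 ht)]
  rw [h3] at h1
  refine le_trans (mul_le_mul_of_nonneg_left (add_le_add ?_ ?_) hκ.le) h1
  · exact integral_norm_sq_le_concat hT hc.1
  · exact integral_norm_sq_le_concat hT hc.2.1

include hex hP hκ hco h hv0 hC hF₃ hinv in
-- By the energy identity the functional over `[0, T]` is `(v(T), η(T))`. Boundedness thus bounds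
-- the right side of `coercive_on_interval` independently of `T`.
theorem isAdmissiblePair_of_bounded :
    G.IsAdmissiblePair B 0 v fun t => hamControl B F₂ F₃ (v t) (η t) := by
  have hC0 : 0 ≤ C := (norm_nonneg _).trans (hC 0 le_rfl).1
  have key : ∀ T, 0 ≤ T → (∫ t in (0 : ℝ)..T, ‖v t‖ ^ 2) +
      (∫ t in (0 : ℝ)..T, ‖hamControl B F₂ F₃ (v t) (η t)‖ ^ 2) ≤
        κ⁻¹ * (C * C + ‖P‖ * C * C) := by
    intro T hT
    have h1 := coercive_on_interval hex hP hκ hco h hv0 hT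
    rw [h.integral_quadForm hF₃ hinv hT, hv0, inner_zero_left, sub_zero] at h1
    rw [← div_eq_inv_mul, le_div_iff₀ hκ, mul_comm]
    refine h1.trans (add_le_add ?_ ?_)
    · exact (real_inner_le_norm _ _).trans
        (mul_le_mul (hC T hT).1 (hC T hT).2 (norm_nonneg _) hC0)
    · exact (real_inner_le_norm _ _).trans (mul_le_mul (P.le_opNorm_of_le (hC T hT).1) (hC T hT).1
        (norm_nonneg _) (by positivity))
  refine ⟨h.1.memLp_two_Ioi_of_bounded (K := κ⁻¹ * (C * C + ‖P‖ * C * C)) fun T hT => ?_,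
    h.continuousOn_hamControl.memLp_two_Ioi_of_bounded
      (K := κ⁻¹ * (C * C + ‖P‖ * C * C)) fun T hT => ?_, fun t ht => ?_⟩
  · exact (le_add_of_nonneg_right (intervalIntegral.integral_nonneg hT fun t _ => sq_nonneg _)).trans
      (key T hT)
  · exact (le_add_of_nonneg_left (intervalIntegral.integral_nonneg hT fun t _ => sq_nonneg _)).trans
      (key T hT)
  · have := h.eq_mild ht
    rw [hv0] at this
    exact this

include hex hP hκ hco h hv0 hC hF₃ hinv in
/-- The only bounded solution of the Hamiltonian system with `v(0) = 0` has `η(0) = 0`. -/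
theorem costate_zero_of_bounded (hctrl : G.L2Controllable B) : η 0 = 0 := by
  have ha := isAdmissiblePair_of_bounded hex hP hκ hco h hv0 hC hF₃ hinv
  -- The functional is the limit of `(v(T), η(T))`, where `v(T) → 0` because the pair is admissible
  -- and `η` is bounded.
  have hJ : integralFunctional F₁ F₂ F₃ v (fun t => hamControl B F₂ F₃ (v t) (η t)) = 0 := by
    have h1 := intervalIntegral_tendsto_integral_Ioi 0 (integrableOn_quadForm (F₁ := F₁) (F₂ := F₂)
      (F₃ := F₃) ha.1 ha.2.1) tendsto_id
    refine tendsto_nhds_unique h1 ?_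
    have h3 := (tendsto_zero_iff_norm_tendsto_zero.1 ha.tendsto_zero).mul_const C
    rw [zero_mul] at h3
    refine squeeze_zero_norm' ?_ h3
    filter_upwards [eventually_ge_atTop 0] with T hT
    rw [id, h.integral_quadForm hF₃ hinv hT, hv0, inner_zero_left, sub_zero]
    exact (norm_inner_le_norm _ _).trans (mul_le_mul_of_nonneg_left (hC T hT).2 (norm_nonneg _))
  have h0 := hco _ _ ha
  rw [hJ] at h0
  have h1 := nonpos_of_mul_nonpos_right h0 hκ
  have h2 : 0 ≤ ∫ t in Ioi (0 : ℝ), ‖v t‖ ^ 2 := integral_nonneg fun t => sq_nonneg _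
  have h3 : 0 ≤ ∫ t in Ioi (0 : ℝ), ‖hamControl B F₂ F₃ (v t) (η t)‖ ^ 2 :=
    integral_nonneg fun t => sq_nonneg _
  have hv : ∀ t, 0 ≤ t → v t = 0 := fun t ht =>
    h.1.eq_zero_of_integral_norm_sq_le ha.1 (by linarith) ht
  have hξ : ∀ t, 0 ≤ t → hamControl B F₂ F₃ (v t) (η t) = 0 := fun t ht =>
    h.continuousOn_hamControl.eq_zero_of_integral_norm_sq_le ha.2.1 (by linarith) ht
  exact IsHamiltonianSolution.costate_eq_zero hctrl (fun t ht => (hC t ht).2)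
    fun t ht => h.adjoint_apply_of_eq_zero hF₃ hinv hv hξ ht

include hex hP hκ hco hF₃ hinv in
-- The difference between a bounded solution and the one built from the stationary process with the
-- same `v 0` has zero initial state, so the initial costates agree.
theorem boundedSubspace_eq (hctrl : G.L2Controllable B) :
    boundedSubspace G B F₁ F₂ F₃ = {z | ∃ x : H, z = (x, -(P x))} := by
  ext z
  constructor
  · rintro ⟨v, η, h, rfl, C, hC⟩
    obtain ⟨w, ω, hw⟩ := hex (v 0)
    obtain ⟨w', η', h', e, C', hC'⟩ := hw.mem_boundedSubspace hex hP hF₃ hinv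
    rw [Prod.ext_iff] at e
    have h0 := costate_zero_of_bounded hex hP hκ hco (h.sub h') (C := C + C')
      (sub_eq_zero.2 e.1.symm)
      (fun t ht => ⟨(norm_sub_le _ _).trans (add_le_add (hC t ht).1 (hC' t ht).1),
        (norm_sub_le _ _).trans (add_le_add (hC t ht).2 (hC' t ht).2)⟩) hF₃ hinv hctrl
    exact ⟨v 0, Prod.ext rfl ((sub_eq_zero.1 h0).trans e.2)⟩
  · rintro ⟨x, rfl⟩
    obtain ⟨v, ξ, h⟩ := hex x
    exact h.mem_boundedSubspace hex hP hF₃ hinv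

end C0Semigroup

end BoundedSolutions


theorem mainTheorem5 {H U : Type*}
    [NormedAddCommGroup H] [InnerProductSpace ℝ H] [CompleteSpace H]
    [NormedAddCommGroup U] [InnerProductSpace ℝ U] [CompleteSpace U]
    (G : C0Semigroup H) (j : ℕ) (hdich : G.HasExponentialDichotomy j)
    (B : U →L[ℝ] H) (F₁ : H →L[ℝ] H) (F₂ : H →L[ℝ] U) (F₃ : U →L[ℝ] U)
    (hF₁ : IsSelfAdjoint F₁) (hF₃ : IsSelfAdjoint F₃)
    (hF₃pos : ∃ c : ℝ, 0 < c ∧ ∀ ξ : U, c * ‖ξ‖ ^ 2 ≤ inner ℝ (F₃ ξ) ξ)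
    (δ : ℝ) (hδ : 0 < δ) (hfreq : FrequencyCondition G B F₁ F₂ F₃ δ)
    (hctrl : G.L2Controllable B) :
    (∀ ω : ℝ, ∃ R, G.generator.complexify.IsResolventAt (Complex.I * ω) R) ∧
    BddAbove (Set.range fun ω : ℝ => ‖G.transfer B ω‖) ∧
    (∀ (v : ℝ → H) (ξ : ℝ → U), G.IsAdmissiblePair B 0 v ξ →
      δ / ((⨆ ω : ℝ, ‖G.transfer B ω‖) ^ 2 + 1) *
          ((∫ t in Set.Ioi (0 : ℝ), ‖v t‖ ^ 2) + ∫ t in Set.Ioi (0 : ℝ), ‖ξ t‖ ^ 2) ≤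
        integralFunctional F₁ F₂ F₃ v ξ) ∧
    Nonoscillating G B F₁ F₂ F₃ := by
  have hco := fun v ξ (h : G.IsAdmissiblePair B 0 v ξ) =>
    C0Semigroup.FrequencyCondition.le_integralFunctional hdich hδ hfreq h
  have hκ : 0 < δ / ((⨆ ω : ℝ, ‖G.transfer B ω‖) ^ 2 + 1) := by positivity
  have hinv := F₃.isInvertible_of_coercive hF₃pos
  refine ⟨fun ω => ?_, hdich.bddAbove_norm_transfer B, hco, ?_⟩
  · obtain ⟨_, -, h⟩ := hdich.exists_isResolventAt
    obtain ⟨R, hR, -⟩ := h ω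
    exact ⟨R, hR⟩
  · obtain ⟨P, hPsa, hex, hP⟩ :=
      C0Semigroup.exists_optimal_value_operator hctrl hF₁ F₂ hF₃ hκ hco
    exact ⟨P, hPsa, C0Semigroup.boundedSubspace_eq hex hP hκ hco hF₃ hinv hctrl⟩
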